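/- Let $d\ge 1$, let $\Omega\subseteq\mathbb R^d$ be a non-empty open set (possibly unbounded), and let $V=V_1+iV_2\in\mathcal C^1(\overline\Omega;\mathbb C)$ (with $V_1,V_2$ real-valued) and $\mathbf A\in\mathcal C^2(\overline\Omega;\mathbb R^d)$; here $f\in\mathcal C^n(\overline\Omega)$ means that $f\in\mathcal C^n(\Omega)$ and that $f$ and all its derivatives up to order $n$ extend continuously to $\overline\Omega$. Put $$B_{jk}:=\partial_jA_k-\partial_kA_j,\quad |\mathbf B|^2:=\sum_{j,k=1}^dB_{jk}^2,\quad m:=\sqrt{1+|\mathbf B|^2+|V|^2},\quad \Phi:=\frac{V_2}{m},\quad \Psi:=\frac{\mathbf B}{m},\quad |\nabla\Psi|^2:=\sum_{j,k=1}^d|\nabla\Psi_{jk}|^2 .$$ Let $H^1_{\mathbf A}(\Omega)$ be the space of all $u\in L^2(\Omega)$ whose distributional magnetic gradient $(-i\nabla+\mathbf A)u$ is in $L^2(\Omega)$, with norm $(\|u\|^2+\|(-i\nabla+\mathbf A)u\|^2)^{1/2}$, let $H^1_{\mathbf A,0}(\Omega)$ be the closure of $\mathcal C_0^\infty(\Omega)$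 in it, and let $$\mathscr V:=\{u\in H^1_{\mathbf A,0}(\Omega): |V|^{1/2}u\in L^2(\Omega)\},\qquad Q(u,v):=\langle(-i\nabla+\mathbf A)u,(-i\nabla+\mathbf A)v\rangle+\int_\Omega Vu\bar v\,dx\quad(u,v\in\mathscr V),$$ where $\langle\cdot,\cdot\rangle$ is the inner product of $L^2$, linear in the first argument. Let $\mathscr L$ be the operator in $L^2(\Omega)$ with $$\mathrm{Dom}(\mathscr L):=\{u\in\mathscr V: v\mapsto Q(u,v)\text{ is continuous on }\mathscr V\text{ for the norm of }L^2(\Omega)\},\qquad Q(u,v)=\langle\mathscr Lu,v\rangle\quad\text{for all }u\in\mathrm{Dom}(\mathscr L),\ v\in\mathscr V.$$ Proposition. Assume that there are constants $\gamma_1>0$ and $\gamma_2\in\mathbb R$ such that, everywhere in $\Omega$, $$\frac{V_2^2+\frac1{12d}|\mathbf B|^2}{m}+V_1-9\left(|\nabla\Phi|^2+|\nabla\Psi|^2\right)\ \ge\ \gamma_1|V|-\gamma_2 ,$$ and that $|V(x)|\to+\infty$ as $|x|\to+\infty$, $x\in\Omega$ (a void condition if $\Omega$ is bounded). Then $\mathscr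 L$ is an operator with compact resolvent: $\mathscr L$ is closed, its resolvent set (the set of all $z\in\mathbb C$ such that $\mathscr L-z:\mathrm{Dom}(\mathscr L)\to L^2(\Omega)$ is bijective) is non-empty, and $(\mathscr L-z)^{-1}$ is a compact operator on $L^2(\Omega)$ for every $z$ in the resolvent set. -/

import Mathlib

open MeasureTheory Filter Topology Distributions

noncomputable section

/-! ### Closed operators with compact resolvent -/

section Resolvent

variable {H : Type*} [NormedAddCommGroup H] [InnerProductSpace ℂ H]

/-- The map `T - z : Dom(T) → H`. -/
def shiftedOperator (T : H →ₗ.[ℂ] H) (z : ℂ) : T.domain →ₗ[ℂ] H :=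
  T.toFun - z • T.domain.subtype

/-- The resolvent set: all `z` such that `T - z` is bijective from `Dom(T)` onto `H`. -/
def operatorResolventSet (T : H →ₗ.[ℂ] H) : Set ℂ :=
  {z | Function.Bijective (shiftedOperator T z)}

/-- The resolvent `(T - z)⁻¹`, as a map from `H` to `H`. -/
def operatorResolvent (T : H →ₗ.[ℂ] H) (z : ℂ) (hz : z ∈ operatorResolventSet T) : H →ₗ[ℂ] H :=
  T.domain.subtype ∘ₗ (LinearEquiv.ofBijective (shiftedOperator T z) hz).symm.toLinearMap

/-- `T` is a closed operator with non-empty resolvent set all of whose resolvents are compact. -/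
def HasCompactResolvent (T : H →ₗ.[ℂ] H) : Prop :=
  T.IsClosed ∧ (operatorResolventSet T).Nonempty ∧
    ∀ (z : ℂ) (hz : z ∈ operatorResolventSet T), IsCompactOperator (operatorResolvent T z hz)

end Resolvent

/-! ### The electromagnetic data -/

/-- `f ∈ Cⁿ(Ω̄)` for an open set `Ω`: `f` is of class `Cⁿ` in `Ω`, and `f` and all its derivatives
up to order `n` extend continuously to the closure of `Ω`. -/
def ContDiffUpToBoundary {d : ℕ} {F : Type*} [NormedAddCommGroup F] [NormedSpace ℝ F] (n : ℕ)
    (Ω : Set (EuclideanSpace ℝ (Fin d))) (f : EuclideanSpace ℝ (Fin d) → F) : Prop :=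
  ContDiffOn ℝ n f Ω ∧
    ∀ k ≤ n, ∃ g : EuclideanSpace ℝ (Fin d) →
        ContinuousMultilinearMap ℝ (fun _ : Fin k => EuclideanSpace ℝ (Fin d)) F,
      ContinuousOn g (closure Ω) ∧ Set.EqOn (iteratedFDeriv ℝ k f) g Ω

/-- A non-empty open set `Ω ⊆ ℝᵈ` with a scalar potential `V ∈ C¹(Ω̄; ℂ)` and a vector potential
`A ∈ C²(Ω̄; ℝᵈ)`. The values of `V` and `A` outside of `Ω` are irrelevant. -/
structure ElectromagneticSystem (d : ℕ) where
  Ω : TopologicalSpace.Opens (EuclideanSpace ℝ (Fin d))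
  nonempty : (Ω : Set (EuclideanSpace ℝ (Fin d))).Nonempty
  V : EuclideanSpace ℝ (Fin d) → ℂ
  A : EuclideanSpace ℝ (Fin d) → EuclideanSpace ℝ (Fin d)
  contDiff_V : ContDiffUpToBoundary 1 (Ω : Set (EuclideanSpace ℝ (Fin d))) V
  contDiff_A : ContDiffUpToBoundary 2 (Ω : Set (EuclideanSpace ℝ (Fin d))) A

namespace ElectromagneticSystem

variable {d : ℕ} (S : ElectromagneticSystem d)

/-- The partial derivative `∂ⱼ f (x)`. -/
def partialD {F : Type*} [NormedAddCommGroup F] [NormedSpace ℝ F] (j : Fin d)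
    (f : EuclideanSpace ℝ (Fin d) → F) (x : EuclideanSpace ℝ (Fin d)) : F :=
  fderiv ℝ f x (EuclideanSpace.single j 1)

/-- The magnetic matrix `B_{jk} = ∂ⱼ A_k - ∂_k Aⱼ`. -/
def B (j k : Fin d) (x : EuclideanSpace ℝ (Fin d)) : ℝ :=
  partialD j (fun y => S.A y k) x - partialD k (fun y => S.A y j) x

/-- `|B(x)|² = ∑_{j,k} B_{jk}(x)²`. -/
def normSqB (x : EuclideanSpace ℝ (Fin d)) : ℝ :=
  ∑ j, ∑ k, S.B j k x ^ 2

/-- `m_{B,V} = (1 + |B|² + |V|²)^{1/2}`. -/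
def m (x : EuclideanSpace ℝ (Fin d)) : ℝ :=
  √(1 + S.normSqB x + ‖S.V x‖ ^ 2)

/-- `Φ = (Im V) / m_{B,V}`. -/
def Phi (x : EuclideanSpace ℝ (Fin d)) : ℝ := (S.V x).im / S.m x

/-- `Ψ = B / m_{B,V}`. -/
def Psi (j k : Fin d) (x : EuclideanSpace ℝ (Fin d)) : ℝ := S.B j k x / S.m x

/-- `|∇Φ(x)|²`. -/
def normSqGradPhi (x : EuclideanSpace ℝ (Fin d)) : ℝ :=
  ∑ i, partialD i S.Phi x ^ 2

/-- `|∇Ψ(x)|² = ∑_{j,k} |∇Ψ_{jk}(x)|²`. -/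
def normSqGradPsi (x : EuclideanSpace ℝ (Fin d)) : ℝ :=
  ∑ j, ∑ k, ∑ i, partialD i (S.Psi j k) x ^ 2

/-- The main hypothesis: for some `γ₁ > 0` and `γ₂ ∈ ℝ`, everywhere in `Ω`,
`(V₂² + |B|²/(12d)) / m_{B,V} + V₁ - 9 (|∇Φ|² + |∇Ψ|²) ≥ γ₁ |V| - γ₂`. -/
def MainAssumption : Prop :=
  ∃ γ₁ γ₂ : ℝ, 0 < γ₁ ∧ ∀ x ∈ S.Ω,
    γ₁ * ‖S.V x‖ - γ₂ ≤
      ((S.V x).im ^ 2 + 1 / (12 * (d : ℝ)) * S.normSqB x) / S.m x + (S.V x).re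
        - 9 * (S.normSqGradPhi x + S.normSqGradPsi x)

/-- `|V(x)| → ∞` as `|x| → ∞` in `Ω`. -/
def Confining : Prop :=
  Tendsto (fun x => ‖S.V x‖)
    (Bornology.cobounded (EuclideanSpace ℝ (Fin d)) ⊓
      𝓟 (S.Ω : Set (EuclideanSpace ℝ (Fin d)))) atTop

/-! ### Weak magnetic derivatives -/

/-- Lebesgue measure on `Ω`. -/
abbrev vol : Measure (EuclideanSpace ℝ (Fin d)) :=
  volume.restrict (S.Ω : Set (EuclideanSpace ℝ (Fin d)))

/-- The Hilbert space `L²(Ω; ℂ)`. -/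
abbrev L2 : Type := Lp ℂ 2 S.vol

/-- `f = (-i∂ⱼ + Aⱼ) u` in the sense of distributions on `Ω`, for `u, f ∈ L²(Ω)`. -/
def IsMagDeriv (j : Fin d) (u f : S.L2) : Prop :=
  ∀ φ : 𝓓(S.Ω, ℂ),
    ∫ x, f x * φ x ∂S.vol =
      ∫ x, u x * (Complex.I * partialD j φ x + (S.A x j : ℂ) * φ x) ∂S.vol

lemma continuousOn_V : ContinuousOn S.V (S.Ω : Set (EuclideanSpace ℝ (Fin d))) :=
  S.contDiff_V.1.continuousOn

lemma continuousOn_A : ContinuousOn S.A (S.Ω : Set (EuclideanSpace ℝ (Fin d))) :=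
  S.contDiff_A.1.continuousOn

/-- A function which is continuous on `Ω` times a test function is continuous on `ℝᵈ`. -/
lemma continuous_mul_test {a : EuclideanSpace ℝ (Fin d) → ℂ}
    (ha : ContinuousOn a (S.Ω : Set (EuclideanSpace ℝ (Fin d)))) (φ : 𝓓(S.Ω, ℂ)) :
    Continuous fun x => a x * φ x := by
  refine continuous_of_tsupport fun x hx => ?_
  have hx' : x ∈ (S.Ω : Set (EuclideanSpace ℝ (Fin d))) :=
    φ.tsupport_subset (closure_mono (fun y hy => right_ne_zero_of_mul hy) hx)
  exact (ha.continuousAt (S.Ω.isOpen.mem_nhds hx')).mul φ.continuous.continuousAt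

lemma memLp_mul_test {a : EuclideanSpace ℝ (Fin d) → ℂ}
    (ha : ContinuousOn a (S.Ω : Set (EuclideanSpace ℝ (Fin d)))) (φ : 𝓓(S.Ω, ℂ)) :
    MemLp (fun x => a x * φ x) 2 S.vol :=
  (S.continuous_mul_test ha φ).memLp_of_hasCompactSupport φ.hasCompactSupport.mul_left

lemma memLp_test (φ : 𝓓(S.Ω, ℂ)) : MemLp φ 2 S.vol :=
  φ.continuous.memLp_of_hasCompactSupport φ.hasCompactSupport

lemma continuous_partialD_test (j : Fin d) (φ : 𝓓(S.Ω, ℂ)) : Continuous (partialD j φ) :=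
  (φ.contDiff.continuous_fderiv (by simp)).clm_apply continuous_const

lemma hasCompactSupport_partialD_test (j : Fin d) (φ : 𝓓(S.Ω, ℂ)) :
    HasCompactSupport (partialD j φ) :=
  φ.hasCompactSupport.fderiv_apply (𝕜 := ℝ) (EuclideanSpace.single j 1)

lemma continuousOn_A_apply (j : Fin d) :
    ContinuousOn (fun x => (S.A x j : ℂ)) (S.Ω : Set (EuclideanSpace ℝ (Fin d))) := by
  have h : Continuous fun y : EuclideanSpace ℝ (Fin d) => ((y j : ℝ) : ℂ) := by fun_prop
  exact h.comp_continuousOn S.continuousOn_A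

lemma memLp_partialD_test (j : Fin d) (φ : 𝓓(S.Ω, ℂ)) : MemLp (partialD j φ) 2 S.vol :=
  (S.continuous_partialD_test j φ).memLp_of_hasCompactSupport
    (S.hasCompactSupport_partialD_test j φ)

lemma memLp_magTest (c : ℂ) (j : Fin d) (φ : 𝓓(S.Ω, ℂ)) :
    MemLp (fun x => c * partialD j φ x + (S.A x j : ℂ) * φ x) 2 S.vol :=
  ((S.memLp_partialD_test j φ).const_mul c).add (S.memLp_mul_test (S.continuousOn_A_apply j) φ)

lemma integrable_mul_of_memLp (u : S.L2) {g : EuclideanSpace ℝ (Fin d) → ℂ}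
    (hg : MemLp g 2 S.vol) : Integrable (fun x => u x * g x) S.vol :=
  (Lp.memLp u).integrable_mul hg

/-- Functions in `L²(Ω)` are determined by their action on test functions. -/
lemma eq_of_integral_test {f g : S.L2}
    (h : ∀ φ : 𝓓(S.Ω, ℂ), ∫ x, f x * φ x ∂S.vol = ∫ x, g x * φ x ∂S.vol) : f = g := by
  have hloc : LocallyIntegrableOn (fun x => f x - g x)
      (S.Ω : Set (EuclideanSpace ℝ (Fin d))) volume := by
    have h1 : LocallyIntegrable (fun x => f x - g x) S.vol :=
      (((Lp.memLp f).sub (Lp.memLp g)).locallyIntegrable (by norm_num))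
    intro x hx
    obtain ⟨U, hU, hUi⟩ := h1 x
    refine ⟨U ∩ S.Ω, Filter.inter_mem (mem_nhdsWithin_of_mem_nhds hU) self_mem_nhdsWithin, ?_⟩
    rw [IntegrableOn, Measure.restrict_restrict' S.Ω.isOpen.measurableSet] at hUi
    exact hUi
  have h0 := S.Ω.isOpen.ae_eq_zero_of_integral_contDiff_smul_eq_zero hloc (fun ψ hψ hc hs => by
    have hφc : ContDiff ℝ (⊤ : ℕ∞) fun x => ((ψ x : ℝ) : ℂ) :=
      Complex.ofRealCLM.contDiff.comp hψ
    have hsub : tsupport (fun x => ((ψ x : ℝ) : ℂ)) ⊆ tsupport ψ :=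
      closure_mono fun x hx hx0 => hx (by simp [hx0])
    let φ : 𝓓(S.Ω, ℂ) := ⟨fun x => ((ψ x : ℝ) : ℂ), hφc,
      hc.of_isClosed_subset (isClosed_tsupport _) hsub, hsub.trans hs⟩
    have hφ : ∀ x, φ x = ((ψ x : ℝ) : ℂ) := fun x => rfl
    have key : ∫ x, (ψ x) • (f x - g x) ∂S.vol = 0 := by
      have e : ∀ x, (ψ x) • (f x - g x) = f x * φ x - g x * φ x := fun x => by
        rw [hφ, Complex.real_smul]; ring
      simp_rw [e]
      rw [integral_sub (S.integrable_mul_of_memLp f (S.memLp_test φ))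
        (S.integrable_mul_of_memLp g (S.memLp_test φ)), h φ, sub_self]
    rw [← key]
    refine (setIntegral_eq_integral_of_forall_compl_eq_zero fun x hx => ?_).symm
    have : ψ x = 0 := by
      by_contra hne
      exact hx (hs (subset_tsupport _ hne))
    simp [this])
  refine Lp.ext ?_
  rw [EventuallyEq, ae_restrict_iff' S.Ω.isOpen.measurableSet]
  filter_upwards [h0] with x hx hxΩ
  exact sub_eq_zero.1 (hx hxΩ)

lemma IsMagDeriv.unique {S : ElectromagneticSystem d} {j : Fin d} {u f g : S.L2}
    (hf : S.IsMagDeriv j u f) (hg : S.IsMagDeriv j u g) : f = g :=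
  S.eq_of_integral_test fun φ => (hf φ).trans (hg φ).symm

lemma IsMagDeriv.add {S : ElectromagneticSystem d} {j : Fin d} {u v f g : S.L2}
    (hf : S.IsMagDeriv j u f) (hg : S.IsMagDeriv j v g) : S.IsMagDeriv j (u + v) (f + g) := by
  intro φ
  have e1 : (fun x => (f + g : S.L2) x * φ x) =ᵐ[S.vol] fun x => f x * φ x + g x * φ x := by
    filter_upwards [Lp.coeFn_add f g] with x hx
    rw [hx, Pi.add_apply, add_mul]
  have e2 : (fun x => (u + v : S.L2) x * (Complex.I * partialD j φ x + (S.A x j : ℂ) * φ x))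
      =ᵐ[S.vol] fun x => u x * (Complex.I * partialD j φ x + (S.A x j : ℂ) * φ x)
        + v x * (Complex.I * partialD j φ x + (S.A x j : ℂ) * φ x) := by
    filter_upwards [Lp.coeFn_add u v] with x hx
    rw [hx, Pi.add_apply, add_mul]
  rw [integral_congr_ae e1, integral_congr_ae e2,
    integral_add (S.integrable_mul_of_memLp f (S.memLp_test φ))
      (S.integrable_mul_of_memLp g (S.memLp_test φ)),
    integral_add (S.integrable_mul_of_memLp u (S.memLp_magTest _ j φ))
      (S.integrable_mul_of_memLp v (S.memLp_magTest _ j φ)), hf φ, hg φ]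

lemma IsMagDeriv.smul {S : ElectromagneticSystem d} {j : Fin d} {u f : S.L2} (c : ℂ)
    (hf : S.IsMagDeriv j u f) : S.IsMagDeriv j (c • u) (c • f) := by
  intro φ
  have e1 : (fun x => (c • f : S.L2) x * φ x) =ᵐ[S.vol] fun x => c * (f x * φ x) := by
    filter_upwards [Lp.coeFn_smul c f] with x hx
    rw [hx, Pi.smul_apply, smul_eq_mul, mul_assoc]
  have e2 : (fun x => (c • u : S.L2) x * (Complex.I * partialD j φ x + (S.A x j : ℂ) * φ x))
      =ᵐ[S.vol] fun x => c * (u x * (Complex.I * partialD j φ x + (S.A x j : ℂ) * φ x)) := by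
    filter_upwards [Lp.coeFn_smul c u] with x hx
    rw [hx, Pi.smul_apply, smul_eq_mul, mul_assoc]
  rw [integral_congr_ae e1, integral_congr_ae e2, integral_const_mul, integral_const_mul, hf φ]

lemma isMagDeriv_zero (j : Fin d) : S.IsMagDeriv j 0 0 := by
  intro φ
  have e : ∀ g : EuclideanSpace ℝ (Fin d) → ℂ,
      (fun x => (0 : S.L2) x * g x) =ᵐ[S.vol] fun _ => 0 := fun g => by
    filter_upwards [Lp.coeFn_zero ℂ 2 S.vol] with x hx
    rw [hx, Pi.zero_apply, zero_mul]
  rw [integral_congr_ae (e _), integral_congr_ae (e _)]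

/-! ### The magnetic Sobolev spaces -/

/-- `H¹_A(Ω) = {u ∈ L²(Ω) : (-i∇ + A) u ∈ L²(Ω)}`. -/
def H1A : Submodule ℂ S.L2 where
  carrier := {u | ∀ j, ∃ f, S.IsMagDeriv j u f}
  add_mem' hu hv j := ⟨_, (hu j).choose_spec.add (hv j).choose_spec⟩
  zero_mem' j := ⟨0, S.isMagDeriv_zero j⟩
  smul_mem' c _ hu j := ⟨_, (hu j).choose_spec.smul c⟩

/-- The component `(-i∂ⱼ + Aⱼ) u` of `(-i∇ + A) u`, for `u ∈ H¹_A(Ω)`. -/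
def magDeriv (j : Fin d) : S.H1A →ₗ[ℂ] S.L2 where
  toFun u := (u.2 j).choose
  map_add' u v := ((u + v).2 j).choose_spec.unique
    ((u.2 j).choose_spec.add (v.2 j).choose_spec)
  map_smul' c u := ((c • u).2 j).choose_spec.unique ((u.2 j).choose_spec.smul c)

lemma isMagDeriv_magDeriv (j : Fin d) (u : S.H1A) : S.IsMagDeriv j u (S.magDeriv j u) :=
  (u.2 j).choose_spec

/-- The norm of `H¹_A(Ω)`, `(‖u‖² + ‖(-i∇ + A) u‖²)^{1/2}`. -/
def normH1A (u : S.H1A) : ℝ :=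
  √(‖(u : S.L2)‖ ^ 2 + ∑ j, ‖S.magDeriv j u‖ ^ 2)

lemma normH1A_eq (u : S.H1A) : S.normH1A u =
    ‖WithLp.toLp 2 ((u : S.L2), WithLp.toLp 2 fun j => S.magDeriv j u)‖ := by
  rw [WithLp.prod_norm_eq_of_L2, PiLp.norm_eq_of_L2, normH1A,
    Real.sq_sqrt (Finset.sum_nonneg fun _ _ => sq_nonneg _)]
  rfl

lemma normH1A_add_le (u v : S.H1A) : S.normH1A (u + v) ≤ S.normH1A u + S.normH1A v := by
  simp only [normH1A_eq]
  refine le_trans (le_of_eq ?_) (norm_add_le _ _)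
  congr 1
  simp only [Submodule.coe_add, map_add, ← WithLp.toLp_add, Prod.mk_add_mk]
  rfl

lemma normH1A_smul (c : ℂ) (u : S.H1A) : S.normH1A (c • u) = ‖c‖ * S.normH1A u := by
  simp only [normH1A_eq]
  rw [← norm_smul]
  congr 1
  simp only [Submodule.coe_smul, map_smul, ← WithLp.toLp_smul, Prod.smul_mk]
  rfl

/-- `u ∈ L²(Ω)` is (the class of) a function in `C₀^∞(Ω)`. -/
def IsTest (u : S.L2) : Prop := ∃ φ : 𝓓(S.Ω, ℂ), u =ᵐ[S.vol] φ

/-- `H¹_{A,0}(Ω)`, the closure of `C₀^∞(Ω)` in `H¹_A(Ω)`. -/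
def H1A0 : Submodule ℂ S.H1A where
  carrier := {u | ∀ ε > 0, ∃ v : S.H1A, S.IsTest v ∧ S.normH1A (u - v) < ε}
  add_mem' {u v} hu hv ε hε := by
    obtain ⟨u', ⟨φ, hφ⟩, hu'⟩ := hu (ε / 2) (half_pos hε)
    obtain ⟨v', ⟨ψ, hψ⟩, hv'⟩ := hv (ε / 2) (half_pos hε)
    refine ⟨u' + v', ⟨φ + ψ, ?_⟩, ?_⟩
    · filter_upwards [Lp.coeFn_add (u' : S.L2) v', hφ, hψ] with x hx h1 h2
      rw [Submodule.coe_add, hx, Pi.add_apply, h1, h2]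
      rfl
    · rw [add_sub_add_comm]
      linarith [S.normH1A_add_le (u - u') (v - v')]
  zero_mem' ε hε := by
    refine ⟨0, ⟨0, ?_⟩, ?_⟩
    · filter_upwards [Lp.coeFn_zero ℂ 2 S.vol] with x hx
      exact hx
    · simpa [normH1A] using hε
  smul_mem' c u hu ε hε := by
    have hc : 0 < ‖c‖ + 1 := by positivity
    obtain ⟨u', ⟨φ, hφ⟩, hu'⟩ := hu (ε / (‖c‖ + 1)) (by positivity)
    refine ⟨c • u', ⟨c • φ, ?_⟩, ?_⟩
    · filter_upwards [Lp.coeFn_smul c (u' : S.L2), hφ] with x hx h1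
      rw [Submodule.coe_smul, hx, Pi.smul_apply, h1]
      rfl
    · rw [← smul_sub, normH1A_smul]
      have h0 : 0 ≤ S.normH1A (u - u') := Real.sqrt_nonneg _
      rw [lt_div_iff₀ hc] at hu'
      nlinarith

/-! ### The form and the operator -/

/-- The variational space `𝒱 = {u ∈ H¹_{A,0}(Ω) : |V|^{1/2} u ∈ L²(Ω)}`. -/
def formDomain : Submodule ℂ S.H1A where
  carrier := {u | u ∈ S.H1A0 ∧ MemLp (fun x => (√‖S.V x‖ : ℂ) * (u : S.L2) x) 2 S.vol}
  add_mem' {u v} hu hv := by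
    refine ⟨add_mem hu.1 hv.1, (hu.2.add hv.2).ae_eq ?_⟩
    filter_upwards [Lp.coeFn_add (u : S.L2) v] with x hx
    rw [Submodule.coe_add, hx, Pi.add_apply, Pi.add_apply, mul_add]
  zero_mem' := by
    refine ⟨zero_mem _, (MemLp.zero (ε := ℂ)).ae_eq ?_⟩
    filter_upwards [Lp.coeFn_zero ℂ 2 S.vol] with x hx
    rw [Submodule.coe_zero, hx, Pi.zero_apply, mul_zero]
  smul_mem' c u hu := by
    refine ⟨Submodule.smul_mem _ _ hu.1, (hu.2.const_mul c).ae_eq ?_⟩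
    filter_upwards [Lp.coeFn_smul c (u : S.L2)] with x hx
    rw [Submodule.coe_smul, hx, Pi.smul_apply, smul_eq_mul]
    ring

/-- The sesquilinear form
`Q(u, v) = ⟨(-i∇ + A) u, (-i∇ + A) v⟩ + ∫_Ω V u v̄`, linear in `u` and antilinear in `v`
(Mathlib's inner product is antilinear in its first argument). -/
def form (u v : S.formDomain) : ℂ :=
  ∑ j, inner ℂ (S.magDeriv j v) (S.magDeriv j u)
    + ∫ x, S.V x * ((u : S.H1A) : S.L2) x * (starRingEnd ℂ) (((v : S.H1A) : S.L2) x) ∂S.vol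

lemma integrable_form (u v : S.formDomain) : Integrable
    (fun x => S.V x * ((u : S.H1A) : S.L2) x * (starRingEnd ℂ) (((v : S.H1A) : S.L2) x))
    S.vol := by
  have hV : AEStronglyMeasurable S.V S.vol :=
    S.continuousOn_V.aestronglyMeasurable S.Ω.isOpen.measurableSet
  refine (u.2.2.norm.integrable_mul v.2.2.norm).mono' ?_ (ae_of_all _ fun x => ?_)
  · exact (hV.mul (Lp.aestronglyMeasurable _)).mul
      (Complex.continuous_conj.comp_aestronglyMeasurable (Lp.aestronglyMeasurable _))
  · simp only [norm_mul, RCLike.norm_conj, Pi.mul_apply, Complex.norm_real,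
      Real.norm_of_nonneg (Real.sqrt_nonneg _)]
    apply le_of_eq
    nth_rw 1 [← Real.mul_self_sqrt (norm_nonneg (S.V x))]
    ring

lemma form_add_left (u u' v : S.formDomain) :
    S.form (u + u') v = S.form u v + S.form u' v := by
  have e : ∫ x, S.V x * (((u + u' : S.formDomain) : S.H1A) : S.L2) x *
      (starRingEnd ℂ) (((v : S.H1A) : S.L2) x) ∂S.vol =
      ∫ x, S.V x * ((u : S.H1A) : S.L2) x * (starRingEnd ℂ) (((v : S.H1A) : S.L2) x) ∂S.vol +
      ∫ x, S.V x * ((u' : S.H1A) : S.L2) x * (starRingEnd ℂ) (((v : S.H1A) : S.L2) x) ∂S.vol := by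
    rw [← integral_add (S.integrable_form u v) (S.integrable_form u' v)]
    refine integral_congr_ae ?_
    filter_upwards [Lp.coeFn_add ((u : S.H1A) : S.L2) (u' : S.H1A)] with x hx
    rw [Submodule.coe_add, Submodule.coe_add, hx, Pi.add_apply]
    ring
  rw [form, e]
  simp only [form, Submodule.coe_add, map_add, inner_add_right, Finset.sum_add_distrib]
  ring

lemma form_smul_left (c : ℂ) (u v : S.formDomain) : S.form (c • u) v = c * S.form u v := by
  have e : ∫ x, S.V x * (((c • u : S.formDomain) : S.H1A) : S.L2) x *
      (starRingEnd ℂ) (((v : S.H1A) : S.L2) x) ∂S.vol =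
      c * ∫ x, S.V x * ((u : S.H1A) : S.L2) x *
        (starRingEnd ℂ) (((v : S.H1A) : S.L2) x) ∂S.vol := by
    rw [← integral_const_mul]
    refine integral_congr_ae ?_
    filter_upwards [Lp.coeFn_smul c ((u : S.H1A) : S.L2)] with x hx
    rw [Submodule.coe_smul, Submodule.coe_smul, hx, Pi.smul_apply, smul_eq_mul]
    ring
  rw [form, e]
  simp only [form, Submodule.coe_smul, map_smul, inner_smul_right, ← Finset.mul_sum]
  ring

lemma form_add_right (u v v' : S.formDomain) :
    S.form u (v + v') = S.form u v + S.form u v' := by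
  have e : ∫ x, S.V x * ((u : S.H1A) : S.L2) x *
      (starRingEnd ℂ) ((((v + v' : S.formDomain) : S.H1A) : S.L2) x) ∂S.vol =
      ∫ x, S.V x * ((u : S.H1A) : S.L2) x * (starRingEnd ℂ) (((v : S.H1A) : S.L2) x) ∂S.vol +
      ∫ x, S.V x * ((u : S.H1A) : S.L2) x * (starRingEnd ℂ) (((v' : S.H1A) : S.L2) x) ∂S.vol := by
    rw [← integral_add (S.integrable_form u v) (S.integrable_form u v')]
    refine integral_congr_ae ?_
    filter_upwards [Lp.coeFn_add ((v : S.H1A) : S.L2) (v' : S.H1A)] with x hx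
    rw [Submodule.coe_add, Submodule.coe_add, hx, Pi.add_apply, map_add]
    ring
  rw [form, e]
  simp only [form, Submodule.coe_add, map_add, inner_add_left, Finset.sum_add_distrib]
  ring

lemma form_smul_right (c : ℂ) (u v : S.formDomain) :
    S.form u (c • v) = (starRingEnd ℂ) c * S.form u v := by
  have e : ∫ x, S.V x * ((u : S.H1A) : S.L2) x *
      (starRingEnd ℂ) ((((c • v : S.formDomain) : S.H1A) : S.L2) x) ∂S.vol =
      (starRingEnd ℂ) c * ∫ x, S.V x * ((u : S.H1A) : S.L2) x *
        (starRingEnd ℂ) (((v : S.H1A) : S.L2) x) ∂S.vol := by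
    rw [← integral_const_mul]
    refine integral_congr_ae ?_
    filter_upwards [Lp.coeFn_smul c ((v : S.H1A) : S.L2)] with x hx
    rw [Submodule.coe_smul, Submodule.coe_smul, hx, Pi.smul_apply, smul_eq_mul, map_mul]
    ring
  rw [form, e]
  simp only [form, Submodule.coe_smul, map_smul, inner_smul_left, ← Finset.mul_sum]
  ring

/-- The class in `L²(Ω)` of a test function has `(-i∂ⱼ + Aⱼ) φ` as weak magnetic derivative. -/
lemma isMagDeriv_test (j : Fin d) (φ : 𝓓(S.Ω, ℂ)) :
    S.IsMagDeriv j (S.memLp_test φ).toLp ((S.memLp_magTest (-Complex.I) j φ).toLp) := by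
  intro ψ
  have e1 : (fun x => ((S.memLp_magTest (-Complex.I) j φ).toLp : S.L2) x * ψ x) =ᵐ[S.vol]
      fun x => (-Complex.I * partialD j φ x + (S.A x j : ℂ) * φ x) * ψ x := by
    filter_upwards [(S.memLp_magTest (-Complex.I) j φ).coeFn_toLp] with x hx
    rw [hx]
  have e2 : (fun x => ((S.memLp_test φ).toLp : S.L2) x *
        (Complex.I * partialD j ψ x + (S.A x j : ℂ) * ψ x)) =ᵐ[S.vol]
      fun x => φ x * (Complex.I * partialD j ψ x + (S.A x j : ℂ) * ψ x) := by
    filter_upwards [(S.memLp_test φ).coeFn_toLp] with x hx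
    rw [hx]
  have j1 : Integrable (fun x => (-Complex.I * partialD j φ x + (S.A x j : ℂ) * φ x) * ψ x)
      S.vol := (S.memLp_magTest (-Complex.I) j φ).integrable_mul (S.memLp_test ψ)
  have j2 : Integrable (fun x => φ x * (Complex.I * partialD j ψ x + (S.A x j : ℂ) * ψ x))
      S.vol := (S.memLp_test φ).integrable_mul (S.memLp_magTest Complex.I j ψ)
  rw [integral_congr_ae e1, integral_congr_ae e2, ← sub_eq_zero, ← integral_sub j1 j2]
  have i1 : Integrable (fun x => partialD j φ x * ψ x) volume :=
    ((S.continuous_partialD_test j φ).mul ψ.continuous).integrable_of_hasCompactSupport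
      ψ.hasCompactSupport.mul_left
  have i2 : Integrable (fun x => φ x * partialD j ψ x) volume :=
    (φ.continuous.mul (S.continuous_partialD_test j ψ)).integrable_of_hasCompactSupport
      φ.hasCompactSupport.mul_right
  have i3 : Integrable (fun x => φ x * ψ x) volume :=
    (φ.continuous.mul ψ.continuous).integrable_of_hasCompactSupport
      φ.hasCompactSupport.mul_right
  have hibp : ∫ x, φ x * partialD j ψ x = -∫ x, partialD j φ x * ψ x :=
    integral_mul_fderiv_eq_neg_fderiv_mul_of_integrable i1 i2 i3
      (fun x _ => (φ.contDiff.differentiable (by simp)) x)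
      (fun x _ => (ψ.contDiff.differentiable (by simp)) x)
  have e3 : ∀ x, (-Complex.I * partialD j φ x + (S.A x j : ℂ) * φ x) * ψ x -
      φ x * (Complex.I * partialD j ψ x + (S.A x j : ℂ) * ψ x) =
      -Complex.I * (partialD j φ x * ψ x + φ x * partialD j ψ x) := fun x => by ring
  simp_rw [e3]
  rw [setIntegral_eq_integral_of_forall_compl_eq_zero, integral_const_mul, integral_add i1 i2,
    hibp, add_neg_cancel, mul_zero]
  intro x hx
  have h1 : φ x = 0 := by
    by_contra hne
    exact hx (φ.tsupport_subset (subset_tsupport _ hne))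
  have h2 : ψ x = 0 := by
    by_contra hne
    exact hx (ψ.tsupport_subset (subset_tsupport _ hne))
  simp [h1, h2]

/-- A test function, as an element of `H¹_A(Ω)`. -/
def testH1A (φ : 𝓓(S.Ω, ℂ)) : S.H1A :=
  ⟨(S.memLp_test φ).toLp, fun j => ⟨_, S.isMagDeriv_test j φ⟩⟩

/-- Test functions belong to the variational space. -/
lemma testH1A_mem_formDomain (φ : 𝓓(S.Ω, ℂ)) : S.testH1A φ ∈ S.formDomain := by
  refine ⟨fun ε hε => ⟨S.testH1A φ, ⟨φ, (S.memLp_test φ).coeFn_toLp⟩, ?_⟩, ?_⟩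
  · simpa [normH1A] using hε
  · have hc : ContinuousOn (fun x => (√‖S.V x‖ : ℂ))
        (S.Ω : Set (EuclideanSpace ℝ (Fin d))) :=
      Complex.continuous_ofReal.comp_continuousOn
        (Real.continuous_sqrt.comp_continuousOn S.continuousOn_V.norm)
    refine (S.memLp_mul_test hc φ).ae_eq ?_
    filter_upwards [(S.memLp_test φ).coeFn_toLp] with x hx
    simp only [testH1A]
    rw [hx]

/-- The embedding of the variational space into `L²(Ω)`. -/
def formEmbedding : S.formDomain →ₗ[ℂ] S.L2 := S.H1A.subtype ∘ₗ S.formDomain.subtype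

/-- The variational space is dense in `L²(Ω)`, in the form of a uniqueness statement. -/
lemma eq_of_inner_formEmbedding {f g : S.L2}
    (h : ∀ v : S.formDomain, inner ℂ (S.formEmbedding v) f = inner ℂ (S.formEmbedding v) g) :
    f = g := by
  refine S.eq_of_integral_test fun φ => ?_
  have hconj : ContDiff ℝ (⊤ : ℕ∞) fun x => (starRingEnd ℂ) (φ x) :=
    Complex.conjCLE.contDiff.comp φ.contDiff
  have hsub : tsupport (fun x => (starRingEnd ℂ) (φ x)) ⊆ tsupport φ :=
    closure_mono fun x hx hx0 => hx (by simp [hx0])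
  let ψ : 𝓓(S.Ω, ℂ) := ⟨fun x => (starRingEnd ℂ) (φ x), hconj,
    φ.hasCompactSupport.of_isClosed_subset (isClosed_tsupport _) hsub,
    hsub.trans φ.tsupport_subset⟩
  have hψ : ∀ x, ψ x = (starRingEnd ℂ) (φ x) := fun x => rfl
  have key : ∀ w : S.L2, inner ℂ (S.formEmbedding ⟨_, S.testH1A_mem_formDomain ψ⟩) w =
      ∫ x, w x * φ x ∂S.vol := fun w => by
    rw [L2.inner_def]
    refine integral_congr_ae ?_
    filter_upwards [(S.memLp_test ψ).coeFn_toLp] with x hx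
    simp only [formEmbedding, testH1A, LinearMap.comp_apply, Submodule.subtype_apply]
    rw [hx, hψ, RCLike.inner_apply, Complex.conj_conj]
  rw [← key f, ← key g, h]

/-- `u ∈ Dom(ℒ)`: the map `v ↦ Q(u, v)` is continuous on `𝒱` for the norm of `L²(Ω)`. Here `𝒱`,
being a subset of `L²(Ω)`, carries the topology induced by the norm of `L²(Ω)`. -/
def InOperatorDomain (u : S.formDomain) : Prop :=
  Continuous fun v : S.formDomain => S.form u v

/-- The Riesz representation defining `ℒ u`. -/
lemma existsUnique_repr (u : S.formDomain) (hu : S.InOperatorDomain u) :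
    ∃! w : S.L2, ∀ v : S.formDomain, S.form u v = inner ℂ (S.formEmbedding v) w := by
  have hinj : Function.Injective S.formEmbedding := fun a b hab =>
    Subtype.ext (Subtype.ext hab)
  let p : Submodule ℂ S.L2 := LinearMap.range S.formEmbedding
  let e : S.formDomain ≃ₗ[ℂ] p := LinearEquiv.ofInjective S.formEmbedding hinj
  have he : ∀ y : p, S.formEmbedding (e.symm y) = y := fun y => by
    conv_rhs => rw [← e.apply_symm_apply y]
    rfl
  have hec : Continuous e.symm := by
    rw [continuous_induced_rng, continuous_induced_rng]
    refine continuous_subtype_val.congr fun y => (he y).symm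
  let F₀ : S.formDomain →ₗ[ℂ] ℂ :=
    { toFun := fun v => (starRingEnd ℂ) (S.form u v)
      map_add' := fun v v' => by rw [form_add_right, map_add]
      map_smul' := fun c v => by
        rw [form_smul_right, map_mul, Complex.conj_conj]; rfl }
  let F : p →L[ℂ] ℂ :=
    { toLinearMap := F₀ ∘ₗ e.symm.toLinearMap
      cont := Complex.continuous_conj.comp (hu.comp hec) }
  obtain ⟨G, hG, -⟩ := exists_extension_norm_eq p F
  refine ⟨(InnerProductSpace.toDual ℂ S.L2).symm G, fun v => ?_, fun w hw => ?_⟩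
  · have h1 : G (S.formEmbedding v) = (starRingEnd ℂ) (S.form u v) := by
      have h2 := hG (e v)
      have h3 : F (e v) = (starRingEnd ℂ) (S.form u v) := by
        change (starRingEnd ℂ) (S.form u (e.symm (e v))) = _
        rw [e.symm_apply_apply]
      exact h2.trans h3
    rw [← inner_conj_symm, InnerProductSpace.toDual_symm_apply, h1, Complex.conj_conj]
  · refine S.eq_of_inner_formEmbedding fun v => ?_
    have h1 : G (S.formEmbedding v) = (starRingEnd ℂ) (S.form u v) := by
      have h2 := hG (e v)
      have h3 : F (e v) = (starRingEnd ℂ) (S.form u v) := by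
        change (starRingEnd ℂ) (S.form u (e.symm (e v))) = _
        rw [e.symm_apply_apply]
      exact h2.trans h3
    rw [← hw, ← inner_conj_symm, InnerProductSpace.toDual_symm_apply, h1, Complex.conj_conj]

/-- `Dom(ℒ)`, as a subspace of `𝒱`. -/
def operatorFormDomain : Submodule ℂ S.formDomain where
  carrier := {u | S.InOperatorDomain u}
  add_mem' {u u'} hu hu' := by
    change Continuous fun v => S.form (u + u') v
    simp only [form_add_left]
    exact Continuous.add hu hu'
  zero_mem' := by
    change Continuous fun v => S.form 0 v
    have : ∀ v, S.form 0 v = 0 := fun v => by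
      simpa using S.form_smul_left 0 0 v
    simp only [this]
    exact continuous_const
  smul_mem' c u hu := by
    change Continuous fun v => S.form (c • u) v
    simp only [form_smul_left]
    exact Continuous.mul continuous_const hu

/-- `u ↦ ℒ u` on `Dom(ℒ)`, characterised by `Q(u, v) = ⟨ℒ u, v⟩` for all `v ∈ 𝒱`. -/
def operatorMap : S.operatorFormDomain →ₗ[ℂ] S.L2 where
  toFun u := (S.existsUnique_repr u u.2).choose
  map_add' u u' := by
    refine S.eq_of_inner_formEmbedding fun v => ?_
    rw [inner_add_right, ← (S.existsUnique_repr _ (u + u').2).choose_spec.1,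
      ← (S.existsUnique_repr _ u.2).choose_spec.1,
      ← (S.existsUnique_repr _ u'.2).choose_spec.1]
    exact S.form_add_left _ _ _
  map_smul' c u := by
    refine S.eq_of_inner_formEmbedding fun v => ?_
    rw [RingHom.id_apply, inner_smul_right, ← (S.existsUnique_repr _ (c • u).2).choose_spec.1,
      ← (S.existsUnique_repr _ u.2).choose_spec.1]
    exact S.form_smul_left _ _ _

lemma formEmbedding_comp_injective :
    Function.Injective (S.formEmbedding ∘ₗ S.operatorFormDomain.subtype) := fun _ _ hab =>
  Subtype.ext (Subtype.ext (Subtype.ext hab))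

/-- The operator `ℒ`, the Dirichlet realisation of `(-i∇ + A)² + V` in `L²(Ω)`, as an unbounded
operator in `L²(Ω)`. -/
def operator : S.L2 →ₗ.[ℂ] S.L2 where
  domain := LinearMap.range (S.formEmbedding ∘ₗ S.operatorFormDomain.subtype)
  toFun := S.operatorMap ∘ₗ
    (LinearEquiv.ofInjective _ S.formEmbedding_comp_injective).symm.toLinearMap

/-- The defining property of `ℒ`: `u ∈ Dom(ℒ)` and `ℒ u = w` if and only if `u ∈ 𝒱` and
`Q(u, v) = ⟨w, v⟩` for all `v ∈ 𝒱`. -/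
lemma mem_operator_graph_iff (u w : S.L2) :
    (u, w) ∈ S.operator.graph ↔ ∃ u' : S.formDomain, S.formEmbedding u' = u ∧
      ∀ v : S.formDomain, S.form u' v = inner ℂ (S.formEmbedding v) w := by
  rw [LinearPMap.mem_graph_iff]
  constructor
  · rintro ⟨⟨_, y, rfl⟩, rfl, rfl⟩
    refine ⟨y, rfl, fun v => ?_⟩
    rw [(S.existsUnique_repr y y.2).choose_spec.1 v]
    congr 1
    change S.operatorMap y = S.operatorMap
      ((LinearEquiv.ofInjective _ S.formEmbedding_comp_injective).symm _)
    congr 1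
    exact ((LinearEquiv.ofInjective _ S.formEmbedding_comp_injective).symm_apply_apply y).symm
  · rintro ⟨u', rfl, hw⟩
    have hu' : S.InOperatorDomain u' := by
      have hc : Continuous S.formEmbedding :=
        continuous_subtype_val.comp continuous_subtype_val
      change Continuous fun v => S.form u' v
      simp only [hw]
      exact hc.inner continuous_const
    refine ⟨⟨_, ⟨u', hu'⟩, rfl⟩, rfl, ?_⟩
    change S.operatorMap ((LinearEquiv.ofInjective _ S.formEmbedding_comp_injective).symm _) = w
    refine (congrArg S.operatorMap ((LinearEquiv.ofInjective _
      S.formEmbedding_comp_injective).symm_apply_apply _)).trans ?_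
    exact (S.existsUnique_repr u' hu').unique
      (S.existsUnique_repr u' hu').choose_spec.1 hw

end ElectromagneticSystem

end

/-! Write D_j for -i∂_j + A_j. The form `Q` need not be coercive in the usual sense: Re Q(u,u)
contains only V₁, which may be very negative, while V₂ and the magnetic field do not appear in it
with a sign. The missing positivity comes from two sources.

Testing against Φu gives Im Q(u,Φu) = ∫ (V₂²/m)|u|² plus an error linear in ∇Φ, so the imaginary
part of V contributes positively. The commutator identity i[D_j,D_k] = B_jk, paired with Ψ_jk u,
integrated by parts and summed, bounds ∫ (|B|²/m)|u|² by (2+d)‖Du‖² + ∫ |∇Ψ|²|u|²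
(`integral_normSqB_le`), so part of the kinetic energy pays for the magnetic field. Together with
the hypothesis on the potentials this yields Re Q(u,u) + Im Q(u,Φu) ≥ ½‖Du‖² + γ₁∫|V||u|² - γ₂‖u‖²,
and the same with Q(Φu,u) (`coercive_left`, `coercive_right`).

These two inequalities are the hypotheses of a generalised Lax–Milgram theorem whose multiplier is
multiplication by Φ (`bijective_of_multiplier`). The multiplier must be bounded on the variational
space; for this the same hypothesis is read as an upper bound on |∇Φ|²
(`integral_normSqGradPhi_le`). As Φ is real, a real shift of the operator does not disturb the
imaginary part.

All integrations by parts take place on compactly supported functions and extend by density of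
C₀^∞(Ω) in the form norm (`graphMap_mem_closure`). The variational space is realised as a closed
subspace of a finite power of L²(Ω) through u ↦ (u, |V|^{1/2}u, Du). Since Φu is only C¹,
mollification is needed to place it in that subspace.

Finally the resolvent factors through the embedding of the variational space into L²(Ω), which is
compact by an Ehrling inequality (`exists_functionals`): far away |V| is large and the weighted norm
controls the mass; in a ball A is bounded, so the magnetic gradient controls the ordinary one, and
Poincaré's inequality on small cells leaves finitely many averages. Extension by zero makes
regularity of ∂Ω unnecessary. -/

noncomputable section

/-! ### Abstract operators associated with coercive forms -/

section Abstract

/-- Ehrling-type criterion for compactness. -/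
theorem isCompactOperator_of_norm_le {X Y : Type*} [NormedAddCommGroup X] [NormedSpace ℂ X]
    [NormedAddCommGroup Y] [NormedSpace ℂ Y] [CompleteSpace Y] (J : X →L[ℂ] Y)
    (h : ∀ ε > (0 : ℝ), ∃ (ι : Type) (_ : Fintype ι) (L : X →L[ℂ] EuclideanSpace ℂ ι),
      ∀ x, ‖J x‖ ≤ ε * ‖x‖ + ‖L x‖) : IsCompactOperator J := by
  refine (isCompactOperator_iff_isCompact_closure_image_closedBall (J : X →ₗ[ℂ] Y)
    one_pos).2 ?_
  refine TotallyBounded.isCompact_of_isClosed (TotallyBounded.closure ?_) isClosed_closure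
  rw [Metric.totallyBounded_iff]
  intro ε hε
  -- Two points of the unit ball are at distance at most 2, so the total error will be 2·(ε/4) + ε/4
  -- < ε.
  obtain ⟨ι, _, L, hL⟩ := h (ε / 4) (by positivity)
  have hb : Bornology.IsBounded (L '' Metric.closedBall 0 1) :=
    L.lipschitz.isBounded_image Metric.isBounded_closedBall
  have htb : TotallyBounded (L '' Metric.closedBall 0 1) :=
    (hb.isCompact_closure.totallyBounded).subset subset_closure
  obtain ⟨t, hts, htf, ht⟩ := totallyBounded_iff_subset.1 htb _
    (Metric.dist_mem_uniformity (show (0 : ℝ) < ε / 4 by positivity))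
  -- One preimage in the unit ball is selected for each net point; being in bijection with the net,
  -- the set of preimages is finite.
  obtain ⟨s, hs, hsf⟩ := Set.exists_subset_bijOn (s := Metric.closedBall (0 : X) 1 ∩ L ⁻¹' t)
    (f := L)
  have himg : L '' (Metric.closedBall (0 : X) 1 ∩ L ⁻¹' t) = t := by
    ext y
    constructor
    · rintro ⟨x, hx, rfl⟩
      exact hx.2
    · intro hy
      obtain ⟨x, hx, rfl⟩ := hts hy
      exact ⟨x, ⟨hx, hy⟩, rfl⟩
  rw [himg] at hsf
  have hsfin : s.Finite := Set.Finite.of_finite_image (by rw [hsf.image_eq]; exact htf) hsf.injOn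
  refine ⟨J '' s, hsfin.image _, ?_⟩
  rintro _ ⟨x, hx, rfl⟩
  obtain ⟨y, hy, hxy⟩ := Set.mem_iUnion₂.1 (ht ⟨x, hx, rfl⟩)
  obtain ⟨z, hz, rfl⟩ := hsf.surjOn hy
  refine Set.mem_iUnion₂.2 ⟨J z, ⟨z, hz, rfl⟩, ?_⟩
  have hz1 : ‖z‖ ≤ 1 := by simpa using (hs hz).1
  have hx1 : ‖x‖ ≤ 1 := by simpa using hx
  have h1 := hL (x - z)
  have h2 : ‖L (x - z)‖ < ε / 4 := by
    rw [map_sub, ← dist_eq_norm]; exact hxy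
  have h3 : ‖x - z‖ ≤ 2 := (norm_sub_le _ _).trans (by linarith)
  rw [Metric.mem_ball]
  change dist (J x) (J z) < ε
  rw [dist_eq_norm, ← map_sub]
  nlinarith

variable {X H : Type*} [NormedAddCommGroup X] [InnerProductSpace ℂ X] [CompleteSpace X]
  [NormedAddCommGroup H] [InnerProductSpace ℂ H] [CompleteSpace H]

/-- A bounded operator is bijective if it satisfies the generalised Lax–Milgram condition with
multiplier `M`, on both sides. -/
theorem bijective_of_multiplier (b M : X →L[ℂ] X) (α : ℝ) (hα : 0 < α)
    (h₁ : ∀ x, α * ‖x‖ ^ 2 ≤ (inner ℂ x (b x)).re + (inner ℂ (M x) (b x)).im)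
    (h₂ : ∀ x, α * ‖x‖ ^ 2 ≤ (inner ℂ x (b x)).re + (inner ℂ x (b (M x))).im) :
    Function.Bijective b := by
  have key : ∀ f : X →L[ℂ] X, (∀ x, α * ‖x‖ ^ 2 ≤ (inner ℂ x (f x)).re) →
      Function.Bijective f := by
    intro f hf
    rw [← ContinuousLinearMap.isUnit_iff_bijective]
    refine ContinuousLinearMap.isUnit_of_forall_le_norm_inner_map f (c := ⟨α, hα.le⟩) hα
      fun x => ?_
    rw [← inner_conj_symm, RCLike.norm_conj]
    calc ‖x‖ ^ 2 * α = α * ‖x‖ ^ 2 := mul_comm _ _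
      _ ≤ (inner ℂ x (f x)).re := hf x
      _ ≤ ‖inner ℂ x (f x)‖ := Complex.re_le_norm _
  constructor
  -- The number Re⟨(1 + iM)x, bx⟩ is the right-hand side of `h₁`, so (1 + iM)*b is coercive, hence
  -- bijective. Only the injectivity of its right factor is kept; 1 + iM itself need not be
  -- invertible.
  · have h : Function.Injective (ContinuousLinearMap.adjoint (1 + Complex.I • M) ∘L b) := by
      refine (key _ fun x => (h₁ x).trans (le_of_eq ?_)).1
      rw [ContinuousLinearMap.comp_apply, ContinuousLinearMap.adjoint_inner_right]
      have : (1 + Complex.I • M) x = x + Complex.I • M x := rfl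
      rw [this, inner_add_left, inner_smul_left]
      simp
    rw [ContinuousLinearMap.coe_comp] at h
    exact h.of_comp
  -- Dually, b(1 - iM) is coercive by `h₂`, and the left factor of a surjection is surjective.
  · have h : Function.Surjective (b ∘L (1 - Complex.I • M)) := by
      refine (key _ fun x => (h₂ x).trans (le_of_eq ?_)).2
      have : (b ∘L (1 - Complex.I • M)) x = b x - Complex.I • b (M x) := by
        rw [← map_smul, ← map_sub]; rfl
      rw [this, inner_sub_right, inner_smul_right]
      simp
    rw [ContinuousLinearMap.coe_comp] at h
    exact h.of_comp

/-- A bijective shift with bounded inverse implies closedness, and compactness of one resolvent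
implies compactness of all of them. -/
theorem hasCompactResolvent_of_compact (T : H →ₗ.[ℂ] H) (z₀ : ℂ) (R : H →L[ℂ] H)
    (hR : IsCompactOperator R)
    (hT : ∀ u w, (u, w) ∈ T.graph ↔ u = R (w - z₀ • u)) : HasCompactResolvent T := by
  have hcl : T.IsClosed := by
    have : (T.graph : Set (H × H)) = {p | p.1 = R (p.2 - z₀ • p.1)} := by
      ext ⟨u, w⟩
      exact hT u w
    rw [LinearPMap.IsClosed, this]
    exact isClosed_eq (by fun_prop) (by fun_prop)
  have hsh : ∀ z (x : T.domain), shiftedOperator T z x = T x - z • (x : H) := fun _ _ => rfl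
  refine ⟨hcl, ⟨z₀, ?_, fun w => ?_⟩, fun z hz => ?_⟩
  · refine (injective_iff_map_eq_zero _).2 fun x hx => ?_
    have h1 := (hT x (T x)).1 (T.mem_graph x)
    rw [← hsh, hx, map_zero] at h1
    exact Subtype.ext h1
  · have h1 : (R w, w + z₀ • R w) ∈ T.graph := (hT _ _).2 (by simp)
    obtain ⟨x, hx1, hx2⟩ := T.mem_graph_iff.1 h1
    refine ⟨x, ?_⟩
    rw [hsh, hx2, hx1]
    simp
  · have hsp : ∀ w, (operatorResolvent T z hz w, w + z • operatorResolvent T z hz w) ∈ T.graph := by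
      intro w
      let x := (LinearEquiv.ofBijective (shiftedOperator T z) hz).symm w
      have hx : shiftedOperator T z x = w :=
        (LinearEquiv.ofBijective (shiftedOperator T z) hz).apply_symm_apply w
      refine T.mem_graph_iff.2 ⟨x, rfl, ?_⟩
      rw [hsh] at hx
      exact sub_eq_iff_eq_add.1 hx
    -- Boundedness of the resolvent is the closed graph theorem: its graph is the preimage of the
    -- closed graph of T under (w,u) ↦ (u, w + zu).
    have hcont : Continuous (operatorResolvent T z hz) := by
      refine LinearMap.continuous_of_isClosed_graph _ ?_
      have : ((operatorResolvent T z hz).graph : Set (H × H)) =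
          {p | (p.2, p.1 + z • p.2) ∈ T.graph} := by
        ext ⟨w, u⟩
        simp only [SetLike.mem_coe, LinearMap.mem_graph_iff, Set.mem_ofPred_eq]
        refine ⟨fun h => h ▸ hsp w, fun h => ?_⟩
        obtain ⟨x, hx1, hx2⟩ := T.mem_graph_iff.1 h
        have : shiftedOperator T z x = w := by
          rw [hsh, hx2, hx1]; simp
        rw [← this]
        change u = ((LinearEquiv.ofBijective (shiftedOperator T z) hz).symm
          ((LinearEquiv.ofBijective (shiftedOperator T z) hz) x) : T.domain)
        rw [LinearEquiv.symm_apply_apply]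
        exact hx1.symm
      rw [this]
      have hc : Continuous fun p : H × H => (p.2, p.1 + z • p.2) := by fun_prop
      exact IsClosed.preimage hc hcl
    let Rz : H →L[ℂ] H := ⟨operatorResolvent T z hz, hcont⟩
    -- This is the resolvent identity R_z = R(1 + (z - z₀)R_z), which exhibits R_z as a compact
    -- operator after a bounded one.
    have : (operatorResolvent T z hz : H → H) = R ∘ (1 + (z - z₀) • Rz : H →L[ℂ] H) := by
      funext w
      refine ((hT _ _).1 (hsp w)).trans ?_
      change R _ = R (w + (z - z₀) • operatorResolvent T z hz w)
      rw [sub_smul, add_sub_assoc]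
    rw [this]
    exact hR.comp_clm _

/-- The operator associated with a bounded form on a compactly embedded Hilbert space, coercive in
the generalised sense, has compact resolvent. -/
theorem hasCompactResolvent_of_form (T : H →ₗ.[ℂ] H) (J : X →L[ℂ] H) (a M : X →L[ℂ] X)
    (α μ : ℝ) (hα : 0 < α)
    (hT : ∀ u w, (u, w) ∈ T.graph ↔ ∃ x, J x = u ∧ ∀ v, inner ℂ v (a x) = inner ℂ (J v) w)
    (hJ : IsCompactOperator J)
    (h₁ : ∀ x, α * ‖x‖ ^ 2 ≤
      (inner ℂ x (a x)).re + (inner ℂ (M x) (a x)).im + μ * ‖J x‖ ^ 2)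
    (h₂ : ∀ x, α * ‖x‖ ^ 2 ≤
      (inner ℂ x (a x)).re + (inner ℂ x (a (M x))).im + μ * ‖J x‖ ^ 2)
    (hM : ∀ x, (inner ℂ (J x) (J (M x))).im = 0) : HasCompactResolvent T := by
  let b : X →L[ℂ] X := a + (μ : ℂ) • (ContinuousLinearMap.adjoint J ∘L J)
  have hb : ∀ v x, inner ℂ v (b x) = inner ℂ v (a x) + μ * inner ℂ (J v) (J x) := by
    intro v x
    have : b x = a x + (μ : ℂ) • ContinuousLinearMap.adjoint J (J x) := rfl
    rw [this, inner_add_right, inner_smul_right, ContinuousLinearMap.adjoint_inner_right]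
  have hM' : ∀ x, (inner ℂ (J (M x)) (J x)).im = 0 := fun x => by
    rw [← inner_conj_symm, Complex.conj_im, hM, neg_zero]
  have hre : ∀ x, (inner ℂ (J x) (J x)).re = ‖J x‖ ^ 2 := fun x => by
    rw [inner_self_eq_norm_sq_to_K]; norm_cast
  have hbij : Function.Bijective b := by
    refine bijective_of_multiplier b M α hα (fun x => ?_) (fun x => ?_)
    · rw [hb, hb, Complex.add_re, Complex.add_im, Complex.re_ofReal_mul, Complex.im_ofReal_mul,
        hM', hre]
      linarith [h₁ x]
    · rw [hb, hb, Complex.add_re, Complex.add_im, Complex.re_ofReal_mul, Complex.im_ofReal_mul,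
        hM, hre]
      linarith [h₂ x]
  let e : X ≃L[ℂ] X := ContinuousLinearEquiv.ofBijective b
    (LinearMap.ker_eq_bot.2 hbij.1) (LinearMap.range_eq_top.2 hbij.2)
  have he : ∀ x, e x = b x := fun x => rfl
  -- With b = a + μJ*J, the equation (T + μ)u = w reads bx = J*w with u = Jx. The resolvent at -μ is
  -- therefore J b⁻¹ J*, compact because J is.
  refine hasCompactResolvent_of_compact T (-μ : ℂ)
    (J ∘L (e.symm : X →L[ℂ] X) ∘L ContinuousLinearMap.adjoint J)
    (hJ.comp_clm ((e.symm : X →L[ℂ] X) ∘L ContinuousLinearMap.adjoint J)) fun u w => ?_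
  rw [hT]
  constructor
  · rintro ⟨x, rfl, hx⟩
    have : b x = ContinuousLinearMap.adjoint J (w - (-μ : ℂ) • J x) := by
      refine ext_inner_left ℂ fun v => ?_
      rw [hb, hx, ContinuousLinearMap.adjoint_inner_right, inner_sub_right, inner_smul_right]
      ring
    simp only [ContinuousLinearMap.comp_apply, ← this]
    exact congrArg J (e.symm_apply_apply x).symm
  · intro h
    refine ⟨e.symm (ContinuousLinearMap.adjoint J (w - (-μ : ℂ) • u)), h.symm, fun v => ?_⟩
    set x := e.symm (ContinuousLinearMap.adjoint J (w - (-μ : ℂ) • u)) with hx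
    have h1 : b x = ContinuousLinearMap.adjoint J (w - (-μ : ℂ) • u) := e.apply_symm_apply _
    have h2 := hb v x
    have h3 : J x = u := h.symm
    rw [h1, ContinuousLinearMap.adjoint_inner_right, inner_sub_right, inner_smul_right, h3] at h2
    linear_combination -h2

end Abstract

namespace ElectromagneticSystem

variable {d : ℕ} (S : ElectromagneticSystem d)

/-! ### Pointwise magnetic calculus on compactly supported functions -/

/-- `u` is of class `Cⁿ`, with compact support contained in `Ω`. -/
structure IsTestFn (n : ℕ∞) (u : EuclideanSpace ℝ (Fin d) → ℂ) : Prop where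
  contDiff : ContDiff ℝ n u
  hasCompactSupport : HasCompactSupport u
  tsupport_subset : tsupport u ⊆ S.Ω

/-- `(-i∂ⱼ + Aⱼ) u`, pointwise. -/
def magD (j : Fin d) (u : EuclideanSpace ℝ (Fin d) → ℂ) (x : EuclideanSpace ℝ (Fin d)) : ℂ :=
  -Complex.I * partialD j u x + (S.A x j : ℂ) * u x

lemma isTestFn_coe {n : ℕ∞} (φ : 𝓓^{n}(S.Ω, ℂ)) : S.IsTestFn n φ :=
  ⟨φ.contDiff, φ.hasCompactSupport, φ.tsupport_subset⟩

section Basic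

variable {S}
variable {u w : EuclideanSpace ℝ (Fin d) → ℂ}

lemma IsTestFn.of_le {n k : ℕ∞} (hu : S.IsTestFn n u) (h : k ≤ n) : S.IsTestFn k u :=
  ⟨hu.contDiff.of_le (by exact_mod_cast h), hu.hasCompactSupport, hu.tsupport_subset⟩

lemma partialD_eq_zero_of_notMem_tsupport {F : Type*} [NormedAddCommGroup F] [NormedSpace ℝ F]
    {f : EuclideanSpace ℝ (Fin d) → F} {x : EuclideanSpace ℝ (Fin d)} (hx : x ∉ tsupport f)
    (j : Fin d) : partialD j f x = 0 := by
  have : fderiv ℝ f x = 0 := by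
    by_contra h
    exact hx (support_fderiv_subset ℝ h)
  simp [partialD, this]

lemma magD_eq_zero_of_notMem_tsupport {x : EuclideanSpace ℝ (Fin d)} (hx : x ∉ tsupport u)
    (j : Fin d) : S.magD j u x = 0 := by
  simp [magD, partialD_eq_zero_of_notMem_tsupport hx, image_eq_zero_of_notMem_tsupport hx]

lemma IsTestFn.continuous {n : ℕ∞} (hu : S.IsTestFn n u) : Continuous u := hu.contDiff.continuous

lemma IsTestFn.differentiable (hu : S.IsTestFn 1 u) : Differentiable ℝ u :=
  hu.contDiff.differentiable (by simp)

lemma IsTestFn.continuous_partialD (hu : S.IsTestFn 1 u) (j : Fin d) : Continuous (partialD j u) :=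
  (hu.contDiff.continuous_fderiv (by simp)).clm_apply continuous_const

lemma IsTestFn.continuousOn_magD (hu : S.IsTestFn 1 u) (j : Fin d) :
    ContinuousOn (S.magD j u) (S.Ω : Set (EuclideanSpace ℝ (Fin d))) :=
  (continuous_const.mul (hu.continuous_partialD j)).continuousOn.add
    ((S.continuousOn_A_apply j).mul hu.continuous.continuousOn)

lemma IsTestFn.integrable {n : ℕ∞} (hu : S.IsTestFn n u) {F : Type*} [NormedAddCommGroup F]
    {f : EuclideanSpace ℝ (Fin d) → F}
    (hf : ContinuousOn f (S.Ω : Set (EuclideanSpace ℝ (Fin d))))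
    (h0 : ∀ x ∉ tsupport u, f x = 0) : Integrable f S.vol := by
  have h1 : IntegrableOn f (tsupport u) volume :=
    (hf.mono hu.tsupport_subset).integrableOn_compact hu.hasCompactSupport
  have h2 : Integrable f volume := by
    rwa [integrableOn_iff_integrable_of_support_subset] at h1
    intro x hx
    by_contra h
    exact hx (h0 x h)
  exact h2.restrict

lemma IsTestFn.continuous_of_continuousOn {n : ℕ∞} (hu : S.IsTestFn n u) {F : Type*}
    [NormedAddCommGroup F] {f : EuclideanSpace ℝ (Fin d) → F}
    (hf : ContinuousOn f (S.Ω : Set (EuclideanSpace ℝ (Fin d))))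
    (h0 : ∀ x ∉ tsupport u, f x = 0) : Continuous f := by
  refine continuous_of_tsupport fun x hx => ?_
  have h1 : tsupport f ⊆ tsupport u :=
    closure_minimal (fun y hy => by_contra fun h => hy (h0 y h)) (isClosed_tsupport u)
  exact hf.continuousAt (S.Ω.isOpen.mem_nhds (hu.tsupport_subset (h1 hx)))

lemma IsTestFn.memLp {n : ℕ∞} (hu : S.IsTestFn n u) {F : Type*} [NormedAddCommGroup F]
    {f : EuclideanSpace ℝ (Fin d) → F}
    (hf : ContinuousOn f (S.Ω : Set (EuclideanSpace ℝ (Fin d))))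
    (h0 : ∀ x ∉ tsupport u, f x = 0) : MemLp f 2 S.vol :=
  (hu.continuous_of_continuousOn hf h0).memLp_of_hasCompactSupport
    (HasCompactSupport.intro hu.hasCompactSupport h0)

lemma tsupport_subset_of_forall {F : Type*} [Zero F] {f : EuclideanSpace ℝ (Fin d) → F}
    (h0 : ∀ x ∉ tsupport u, f x = 0) : tsupport f ⊆ tsupport u :=
  closure_minimal (fun y hy => by_contra fun h => hy (h0 y h)) (isClosed_tsupport u)

/-- The coefficients are regular only inside Ω. At a point of the support of the new function this
suffices, since Ω is open; at any other point the function vanishes nearby. -/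
lemma IsTestFn.of_contDiffOn {n k : ℕ∞} (hu : S.IsTestFn n u)
    (hw : ContDiffOn ℝ k w (S.Ω : Set (EuclideanSpace ℝ (Fin d))))
    (h0 : ∀ x ∉ tsupport u, w x = 0) : S.IsTestFn k w := by
  have h1 := tsupport_subset_of_forall h0
  refine ⟨contDiff_iff_contDiffAt.2 fun x => ?_, HasCompactSupport.intro hu.hasCompactSupport h0,
    h1.trans hu.tsupport_subset⟩
  by_cases hx : x ∈ tsupport w
  · exact hw.contDiffAt (S.Ω.isOpen.mem_nhds (hu.tsupport_subset (h1 hx)))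
  · exact contDiffAt_const.congr_of_eventuallyEq (notMem_tsupport_iff_eventuallyEq.1 hx)

lemma IsTestFn.mul {n : ℕ∞} (hu : S.IsTestFn n u) {a : EuclideanSpace ℝ (Fin d) → ℝ}
    (ha : ContDiffOn ℝ n a (S.Ω : Set (EuclideanSpace ℝ (Fin d)))) :
    S.IsTestFn n (fun x => (a x : ℂ) * u x) :=
  hu.of_contDiffOn ((Complex.ofRealCLM.contDiff.comp_contDiffOn ha).mul hu.contDiff.contDiffOn)
    fun x hx => by simp [image_eq_zero_of_notMem_tsupport hx]

lemma IsTestFn.partialD_mul (hu : S.IsTestFn 1 u) {a : EuclideanSpace ℝ (Fin d) → ℝ}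
    (ha : ContDiffOn ℝ 1 a (S.Ω : Set (EuclideanSpace ℝ (Fin d)))) (j : Fin d)
    (x : EuclideanSpace ℝ (Fin d)) :
    partialD j (fun x => (a x : ℂ) * u x) x = a x * partialD j u x + partialD j a x * u x := by
  by_cases hx : x ∈ tsupport u
  · have h1 : HasFDerivAt a (fderiv ℝ a x) x :=
      ((ha.contDiffAt (S.Ω.isOpen.mem_nhds (hu.tsupport_subset hx))).differentiableAt
        (by simp)).hasFDerivAt
    have h2 : HasFDerivAt u (fderiv ℝ u x) x := (hu.differentiable x).hasFDerivAt
    have h3 := (Complex.ofRealCLM.hasFDerivAt.comp x h1).mul h2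
    have e : (fun x => (a x : ℂ) * u x) = Complex.ofRealCLM ∘ a * u := rfl
    simp only [partialD]
    rw [e, h3.fderiv]
    simp
    ring
  · rw [partialD_eq_zero_of_notMem_tsupport hx, image_eq_zero_of_notMem_tsupport hx,
      partialD_eq_zero_of_notMem_tsupport fun h => hx (tsupport_subset_of_forall
        (u := u) (fun y hy => by simp [image_eq_zero_of_notMem_tsupport hy]) h)]
    simp

lemma IsTestFn.magD_mul (hu : S.IsTestFn 1 u) {a : EuclideanSpace ℝ (Fin d) → ℝ}
    (ha : ContDiffOn ℝ 1 a (S.Ω : Set (EuclideanSpace ℝ (Fin d)))) (j : Fin d)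
    (x : EuclideanSpace ℝ (Fin d)) :
    S.magD j (fun x => (a x : ℂ) * u x) x =
      a x * S.magD j u x - Complex.I * (partialD j a x * u x) := by
  rw [magD, hu.partialD_mul ha, magD]
  ring

lemma IsTestFn.partialD_conj (hu : S.IsTestFn 1 u) (j : Fin d) (x : EuclideanSpace ℝ (Fin d)) :
    partialD j (fun y => (starRingEnd ℂ) (u y)) x = (starRingEnd ℂ) (partialD j u x) := by
  have h := (Complex.conjCLE.toContinuousLinearMap.hasFDerivAt.comp x
    (hu.differentiable x).hasFDerivAt).fderiv
  simp only [partialD]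
  have e : (fun y => (starRingEnd ℂ) (u y)) = Complex.conjCLE.toContinuousLinearMap ∘ u := rfl
  rw [e, h]
  rfl

/-- The magnetic derivative is symmetric. -/
lemma IsTestFn.integral_magD_mul_conj (hu : S.IsTestFn 1 u) (hw : S.IsTestFn 1 w) (j : Fin d) :
    ∫ x, S.magD j u x * (starRingEnd ℂ) (w x) ∂S.vol =
      ∫ x, u x * (starRingEnd ℂ) (S.magD j w x) ∂S.vol := by
  have hc : Continuous (starRingEnd ℂ) := Complex.continuous_conj
  have j1 : Integrable (fun x => S.magD j u x * (starRingEnd ℂ) (w x)) S.vol :=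
    hu.integrable ((hu.continuousOn_magD j).mul (hc.comp hw.continuous).continuousOn)
      fun x hx => by simp [magD_eq_zero_of_notMem_tsupport hx]
  have j2 : Integrable (fun x => u x * (starRingEnd ℂ) (S.magD j w x)) S.vol :=
    hu.integrable (hu.continuous.continuousOn.mul (hc.comp_continuousOn (hw.continuousOn_magD j)))
      fun x hx => by simp [image_eq_zero_of_notMem_tsupport hx]
  rw [← sub_eq_zero, ← integral_sub j1 j2]
  have hcw : Continuous fun x => (starRingEnd ℂ) (w x) := hc.comp hw.continuous
  have hcd : Continuous (partialD j fun x => (starRingEnd ℂ) (w x)) := by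
    have : partialD j (fun x => (starRingEnd ℂ) (w x)) =
        fun x => (starRingEnd ℂ) (partialD j w x) := funext (hw.partialD_conj j)
    rw [this]
    exact hc.comp (hw.continuous_partialD j)
  have hcu := hu.hasCompactSupport
  have i1 : Integrable (fun x => partialD j u x * (starRingEnd ℂ) (w x)) volume :=
    ((hu.continuous_partialD j).mul hcw).integrable_of_hasCompactSupport
      (hcu.fderiv_apply (𝕜 := ℝ) (EuclideanSpace.single j 1)).mul_right
  have i2 : Integrable (fun x => u x * partialD j (fun x => (starRingEnd ℂ) (w x)) x) volume :=
    (hu.continuous.mul hcd).integrable_of_hasCompactSupport hcu.mul_right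
  have i3 : Integrable (fun x => u x * (starRingEnd ℂ) (w x)) volume :=
    (hu.continuous.mul hcw).integrable_of_hasCompactSupport hcu.mul_right
  have hibp : ∫ x, u x * partialD j (fun x => (starRingEnd ℂ) (w x)) x =
      -∫ x, partialD j u x * (starRingEnd ℂ) (w x) :=
    integral_mul_fderiv_eq_neg_fderiv_mul_of_integrable i1 i2 i3
      (fun x _ => hu.differentiable x)
      (fun x _ => (Complex.conjCLE.differentiable.comp hw.differentiable) x)
  have e3 : ∀ x, S.magD j u x * (starRingEnd ℂ) (w x) - u x * (starRingEnd ℂ) (S.magD j w x) =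
      -Complex.I * (partialD j u x * (starRingEnd ℂ) (w x) +
        u x * partialD j (fun x => (starRingEnd ℂ) (w x)) x) := fun x => by
    rw [hw.partialD_conj]
    simp only [magD, map_add, map_mul, map_neg, Complex.conj_I, Complex.conj_ofReal]
    ring
  simp_rw [e3]
  -- The integrand vanishes off Ω, so the integration by parts is done on the whole space and leaves
  -- no boundary term.
  rw [setIntegral_eq_integral_of_forall_compl_eq_zero, integral_const_mul, integral_add i1 i2,
    hibp, add_neg_cancel, mul_zero]
  intro x hx
  have h1 : x ∉ tsupport u := fun h => hx (hu.tsupport_subset h)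
  simp [image_eq_zero_of_notMem_tsupport h1, partialD_eq_zero_of_notMem_tsupport h1]

end Basic

/-! ### Regularity of the coefficients -/

lemma contDiffOn_A_apply (k : Fin d) :
    ContDiffOn ℝ 2 (fun x => S.A x k) (S.Ω : Set (EuclideanSpace ℝ (Fin d))) := by
  have h : ContDiff ℝ 2 fun y : EuclideanSpace ℝ (Fin d) => y k :=
    (EuclideanSpace.proj (𝕜 := ℝ) k).contDiff
  exact h.comp_contDiffOn S.contDiff_A.1

lemma contDiffOn_partialD {F : Type*} [NormedAddCommGroup F] [NormedSpace ℝ F] {n k : WithTop ℕ∞}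
    {f : EuclideanSpace ℝ (Fin d) → F}
    (hf : ContDiffOn ℝ n f (S.Ω : Set (EuclideanSpace ℝ (Fin d)))) (h : k + 1 ≤ n) (j : Fin d) :
    ContDiffOn ℝ k (partialD j f) (S.Ω : Set (EuclideanSpace ℝ (Fin d))) :=
  (hf.fderiv_of_isOpen S.Ω.isOpen h).clm_apply contDiffOn_const

lemma contDiffOn_B (j k : Fin d) :
    ContDiffOn ℝ 1 (S.B j k) (S.Ω : Set (EuclideanSpace ℝ (Fin d))) :=
  (S.contDiffOn_partialD (S.contDiffOn_A_apply k) (by norm_num) j).sub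
    (S.contDiffOn_partialD (S.contDiffOn_A_apply j) (by norm_num) k)

lemma contDiffOn_normSqB :
    ContDiffOn ℝ 1 S.normSqB (S.Ω : Set (EuclideanSpace ℝ (Fin d))) :=
  ContDiffOn.sum fun j _ => ContDiffOn.sum fun k _ => (S.contDiffOn_B j k).pow 2

lemma normSqB_nonneg (x : EuclideanSpace ℝ (Fin d)) : 0 ≤ S.normSqB x :=
  Finset.sum_nonneg fun _ _ => Finset.sum_nonneg fun _ _ => sq_nonneg _

lemma m_pos (x : EuclideanSpace ℝ (Fin d)) : 0 < S.m x :=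
  Real.sqrt_pos.2 (by have := S.normSqB_nonneg x; positivity)

lemma m_sq (x : EuclideanSpace ℝ (Fin d)) : S.m x ^ 2 = 1 + S.normSqB x + ‖S.V x‖ ^ 2 :=
  Real.sq_sqrt (by have := S.normSqB_nonneg x; positivity)

lemma contDiffOn_m : ContDiffOn ℝ 1 S.m (S.Ω : Set (EuclideanSpace ℝ (Fin d))) := by
  refine ContDiffOn.sqrt ((contDiffOn_const.add S.contDiffOn_normSqB).add
    (S.contDiff_V.1.norm_sq ℝ)) fun x _ => ?_
  have := S.normSqB_nonneg x
  positivity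

lemma contDiffOn_Phi : ContDiffOn ℝ 1 S.Phi (S.Ω : Set (EuclideanSpace ℝ (Fin d))) :=
  (Complex.imCLM.contDiff.comp_contDiffOn S.contDiff_V.1).div S.contDiffOn_m
    fun x _ => (S.m_pos x).ne'

lemma contDiffOn_Psi (j k : Fin d) :
    ContDiffOn ℝ 1 (S.Psi j k) (S.Ω : Set (EuclideanSpace ℝ (Fin d))) :=
  (S.contDiffOn_B j k).div S.contDiffOn_m fun x _ => (S.m_pos x).ne'

lemma continuousOn_partialD {F : Type*} [NormedAddCommGroup F] [NormedSpace ℝ F]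
    {f : EuclideanSpace ℝ (Fin d) → F}
    (hf : ContDiffOn ℝ 1 f (S.Ω : Set (EuclideanSpace ℝ (Fin d)))) (j : Fin d) :
    ContinuousOn (partialD j f) (S.Ω : Set (EuclideanSpace ℝ (Fin d))) :=
  (S.contDiffOn_partialD (k := 0) hf (by norm_num) j).continuousOn

lemma continuousOn_normSqGradPhi :
    ContinuousOn S.normSqGradPhi (S.Ω : Set (EuclideanSpace ℝ (Fin d))) :=
  continuousOn_finsetSum _ fun i _ => (S.continuousOn_partialD S.contDiffOn_Phi i).pow 2

lemma continuousOn_normSqGradPsi :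
    ContinuousOn S.normSqGradPsi (S.Ω : Set (EuclideanSpace ℝ (Fin d))) :=
  continuousOn_finsetSum _ fun j _ => continuousOn_finsetSum _ fun k _ =>
    continuousOn_finsetSum _ fun i _ => (S.continuousOn_partialD (S.contDiffOn_Psi j k) i).pow 2

lemma abs_Phi_le (x : EuclideanSpace ℝ (Fin d)) : |S.Phi x| ≤ 1 := by
  rw [Phi, abs_div, abs_of_pos (S.m_pos x), div_le_one (S.m_pos x)]
  refine (Complex.abs_im_le_norm _).trans ?_
  refine abs_le_of_sq_le_sq' ?_ (S.m_pos x).le |>.2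
  rw [S.m_sq]
  linarith [S.normSqB_nonneg x]

/-- Dividing by m, which dominates |B|, makes the Hilbert–Schmidt norm of Ψ at most 1. The leading
commutator terms are then bounded by the energy with a constant independent of the size of the
field. -/
lemma sum_Psi_sq_le (x : EuclideanSpace ℝ (Fin d)) : ∑ j, ∑ k, S.Psi j k x ^ 2 ≤ 1 := by
  have : ∑ j, ∑ k, S.Psi j k x ^ 2 = S.normSqB x / S.m x ^ 2 := by
    simp only [Psi, div_pow, normSqB, Finset.sum_div]
  rw [this, div_le_one (by have := S.m_pos x; positivity), S.m_sq]
  nlinarith [sq_nonneg ‖S.V x‖]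

lemma sum_B_mul_Psi (x : EuclideanSpace ℝ (Fin d)) :
    ∑ j, ∑ k, S.B j k x * S.Psi j k x = S.normSqB x / S.m x := by
  simp only [Psi, normSqB, Finset.sum_div]
  refine Finset.sum_congr rfl fun j _ => Finset.sum_congr rfl fun k _ => ?_
  ring

/-! ### The commutator -/

variable {S}

lemma IsTestFn.isTestFn_magD {u : EuclideanSpace ℝ (Fin d) → ℂ} (hu : S.IsTestFn 2 u) (j : Fin d) :
    S.IsTestFn 1 (S.magD j u) := by
  refine hu.of_contDiffOn ?_ fun x hx => magD_eq_zero_of_notMem_tsupport hx j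
  have h2 : ContDiffOn ℝ 2 u (S.Ω : Set (EuclideanSpace ℝ (Fin d))) := hu.contDiff.contDiffOn
  refine (contDiffOn_const.mul (S.contDiffOn_partialD h2 (by norm_num) j)).add ?_
  exact (Complex.ofRealCLM.contDiff.comp_contDiffOn
    ((S.contDiffOn_A_apply j).of_le (by norm_num))).mul (h2.of_le (by norm_num))

lemma partialD_partialD_comm {u : EuclideanSpace ℝ (Fin d) → ℂ} (hu : ContDiff ℝ 2 u)
    (j k : Fin d) (x : EuclideanSpace ℝ (Fin d)) :
    partialD j (partialD k u) x = partialD k (partialD j u) x := by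
  have h : ∀ i l : Fin d, partialD i (partialD l u) x =
      fderiv ℝ (fderiv ℝ u) x (EuclideanSpace.single i 1) (EuclideanSpace.single l 1) := by
    intro i l
    have hd : DifferentiableAt ℝ (fderiv ℝ u) x :=
      (hu.fderiv_right (m := 1) (by norm_num)).differentiable (by simp) x
    have e : partialD l u = fun y => fderiv ℝ u y (EuclideanSpace.single l 1) := rfl
    rw [partialD, e, fderiv_clm_apply hd (by fun_prop)]
    simp
  rw [h, h]
  exact (hu.contDiffAt.isSymmSndFDerivAt (by simp)) _ _

lemma IsTestFn.partialD_magD {u : EuclideanSpace ℝ (Fin d) → ℂ} (hu : S.IsTestFn 2 u)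
    (j k : Fin d) (x : EuclideanSpace ℝ (Fin d)) :
    partialD j (S.magD k u) x = -Complex.I * partialD j (partialD k u) x +
      S.A x k * partialD j u x + partialD j (fun y => S.A y k) x * u x := by
  have hu1 : S.IsTestFn 1 u := hu.of_le (by norm_num)
  have hA : ContDiffOn ℝ 1 (fun x => S.A x k) (S.Ω : Set (EuclideanSpace ℝ (Fin d))) :=
    (S.contDiffOn_A_apply k).of_le (by norm_num)
  have h := hu1.partialD_mul hA j x
  have hd1 : DifferentiableAt ℝ (fun y => -Complex.I * partialD k u y) x := by
    have : ContDiff ℝ 1 (partialD k u) :=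
      (hu.contDiff.fderiv_right (m := 1) (by norm_num)).clm_apply contDiff_const
    exact (this.differentiable (by simp) x).const_mul _
  have hd2 : DifferentiableAt ℝ (fun y => (S.A y k : ℂ) * u y) x :=
    (hu1.mul hA).differentiable x
  have e : S.magD k u = fun y => -Complex.I * partialD k u y + (S.A y k : ℂ) * u y := rfl
  have hd3 : DifferentiableAt ℝ (partialD k u) x := by
    have : ContDiff ℝ 1 (partialD k u) :=
      (hu.contDiff.fderiv_right (m := 1) (by norm_num)).clm_apply contDiff_const
    exact this.differentiable (by simp) x
  have h5 : partialD j (S.magD k u) x = partialD j (fun y => -Complex.I * partialD k u y) x +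
      partialD j (fun y => (S.A y k : ℂ) * u y) x := by
    rw [e]
    simp only [partialD] at *
    rw [fderiv_fun_add hd1 hd2]
    rfl
  have h6 : partialD j (fun y => -Complex.I * partialD k u y) x =
      -Complex.I * partialD j (partialD k u) x := by
    conv_lhs => rw [partialD]
    rw [fderiv_const_mul hd3]
    rfl
  rw [h5, h6, h]
  ring

/-- Second derivatives cancel by symmetry and the products A_jA_k by commutativity, so only the
derivatives of A survive. This is where the magnetic field enters the estimates. -/
lemma IsTestFn.commutator {u : EuclideanSpace ℝ (Fin d) → ℂ} (hu : S.IsTestFn 2 u)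
    (j k : Fin d) (x : EuclideanSpace ℝ (Fin d)) :
    S.magD j (S.magD k u) x - S.magD k (S.magD j u) x = -Complex.I * S.B j k x * u x := by
  have e : ∀ i l, S.magD i (S.magD l u) x =
      -Complex.I * partialD i (S.magD l u) x + S.A x i * S.magD l u x := fun _ _ => rfl
  rw [e, e, hu.partialD_magD, hu.partialD_magD, partialD_partialD_comm hu.contDiff j k, B]
  simp only [magD]
  push_cast
  ring

end ElectromagneticSystem

namespace ElectromagneticSystem

variable {d : ℕ} (S : ElectromagneticSystem d)

/-! ### Energy inequalities on test functions -/

/-- `|(-i∇ + A) u|²`, pointwise. -/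
def energyDensity (u : EuclideanSpace ℝ (Fin d) → ℂ) (x : EuclideanSpace ℝ (Fin d)) : ℝ :=
  ∑ j, ‖S.magD j u x‖ ^ 2

/-- The integrand of the form `Q(u, w)`. -/
def formDensity (u w : EuclideanSpace ℝ (Fin d) → ℂ) (x : EuclideanSpace ℝ (Fin d)) : ℂ :=
  ∑ j, S.magD j u x * (starRingEnd ℂ) (S.magD j w x) + S.V x * u x * (starRingEnd ℂ) (w x)

variable {S}
variable {u : EuclideanSpace ℝ (Fin d) → ℂ}

lemma energyDensity_nonneg (x : EuclideanSpace ℝ (Fin d)) : 0 ≤ S.energyDensity u x :=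
  Finset.sum_nonneg fun _ _ => sq_nonneg _

lemma IsTestFn.continuousOn_energyDensity (hu : S.IsTestFn 1 u) :
    ContinuousOn (S.energyDensity u) (S.Ω : Set (EuclideanSpace ℝ (Fin d))) :=
  continuousOn_finsetSum _ fun j _ => (hu.continuousOn_magD j).norm.pow 2

lemma IsTestFn.integrable_energyDensity (hu : S.IsTestFn 1 u) :
    Integrable (S.energyDensity u) S.vol :=
  hu.integrable hu.continuousOn_energyDensity fun x hx => by
    simp [energyDensity, magD_eq_zero_of_notMem_tsupport hx]

lemma IsTestFn.integrable_mul_sq (hu : S.IsTestFn 1 u) {a : EuclideanSpace ℝ (Fin d) → ℝ}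
    (ha : ContinuousOn a (S.Ω : Set (EuclideanSpace ℝ (Fin d)))) :
    Integrable (fun x => a x * ‖u x‖ ^ 2) S.vol :=
  hu.integrable (ha.mul (hu.continuous.continuousOn.norm.pow 2)) fun x hx => by
    simp [image_eq_zero_of_notMem_tsupport hx]

lemma IsTestFn.integrable_formDensity (hu : S.IsTestFn 1 u)
    {w : EuclideanSpace ℝ (Fin d) → ℂ} (hw : S.IsTestFn 1 w) :
    Integrable (S.formDensity u w) S.vol := by
  have hc : Continuous (starRingEnd ℂ) := Complex.continuous_conj
  refine hu.integrable (ContinuousOn.add (continuousOn_finsetSum _ fun j _ =>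
    (hu.continuousOn_magD j).mul (hc.comp_continuousOn (hw.continuousOn_magD j)))
    ((S.continuousOn_V.mul hu.continuous.continuousOn).mul
      (hc.comp hw.continuous).continuousOn)) fun x hx => ?_
  simp [formDensity, magD_eq_zero_of_notMem_tsupport hx, image_eq_zero_of_notMem_tsupport hx]

/-- Replace B_jk u by i[D_j,D_k]u, pair it with Ψ_jk u, and move the outer derivative across by
symmetry. Class C² makes D_k u a C¹ function, so that a second magnetic derivative and the
integration by parts are available. -/
lemma IsTestFn.integral_B_mul_Psi (hu : S.IsTestFn 2 u) (j k : Fin d) :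
    ∫ x, S.B j k x * S.Psi j k x * ‖u x‖ ^ 2 ∂S.vol =
      ∫ x, (Complex.I * (S.magD k u x * (starRingEnd ℂ)
          (S.magD j (fun y => (S.Psi j k y : ℂ) * u y) x) -
        S.magD j u x * (starRingEnd ℂ)
          (S.magD k (fun y => (S.Psi j k y : ℂ) * u y) x))).re ∂S.vol := by
  have hu1 : S.IsTestFn 1 u := hu.of_le (by norm_num)
  have hw : S.IsTestFn 1 fun y => (S.Psi j k y : ℂ) * u y := hu1.mul (S.contDiffOn_Psi j k)
  set w : EuclideanSpace ℝ (Fin d) → ℂ := fun y => (S.Psi j k y : ℂ) * u y with hwdef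
  have hc : Continuous (starRingEnd ℂ) := Complex.continuous_conj
  have hI : ∀ f g : EuclideanSpace ℝ (Fin d) → ℂ, S.IsTestFn 1 f → S.IsTestFn 1 g → ∀ i,
      Integrable (fun x => f x * (starRingEnd ℂ) (S.magD i g x)) S.vol := fun f g hf hg i =>
    hf.integrable (hf.continuous.continuousOn.mul (hc.comp_continuousOn (hg.continuousOn_magD i)))
      fun x hx => by simp [image_eq_zero_of_notMem_tsupport hx]
  have hI' : ∀ f g : EuclideanSpace ℝ (Fin d) → ℂ, S.IsTestFn 1 f → S.IsTestFn 1 g → ∀ i,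
      Integrable (fun x => S.magD i f x * (starRingEnd ℂ) (g x)) S.vol := fun f g hf hg i =>
    hf.integrable ((hf.continuousOn_magD i).mul (hc.comp hg.continuous).continuousOn)
      fun x hx => by simp [magD_eq_zero_of_notMem_tsupport hx]
  have key : ∫ x, ((S.B j k x * S.Psi j k x * ‖u x‖ ^ 2 : ℝ) : ℂ) ∂S.vol =
      ∫ x, Complex.I * (S.magD k u x * (starRingEnd ℂ) (S.magD j w x) -
        S.magD j u x * (starRingEnd ℂ) (S.magD k w x)) ∂S.vol := by
    rw [integral_const_mul, integral_sub (hI _ _ (hu.isTestFn_magD k) hw j)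
      (hI _ _ (hu.isTestFn_magD j) hw k),
      ← (hu.isTestFn_magD k).integral_magD_mul_conj hw j,
      ← (hu.isTestFn_magD j).integral_magD_mul_conj hw k,
      ← integral_sub (hI' _ _ (hu.isTestFn_magD k) hw j) (hI' _ _ (hu.isTestFn_magD j) hw k),
      ← integral_const_mul]
    refine integral_congr_ae (ae_of_all _ fun x => ?_)
    have h1 := hu.commutator j k x
    have h2 : u x * (starRingEnd ℂ) (u x) = ((‖u x‖ ^ 2 : ℝ) : ℂ) := by
      rw [Complex.mul_conj, Complex.normSq_eq_norm_sq]
    have h3 : (starRingEnd ℂ) (w x) = (S.Psi j k x : ℂ) * (starRingEnd ℂ) (u x) := by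
      simp [hwdef]
    simp only []
    rw [← sub_mul, h1, h3]
    push_cast at h2 ⊢
    rw [← h2]
    linear_combination (S.B j k x * S.Psi j k x * u x * (starRingEnd ℂ) (u x)) * Complex.I_mul_I
  have hint : Integrable (fun x => Complex.I * (S.magD k u x * (starRingEnd ℂ) (S.magD j w x) -
        S.magD j u x * (starRingEnd ℂ) (S.magD k w x))) S.vol :=
    ((hI _ _ (hu.isTestFn_magD k) hw j).sub (hI _ _ (hu.isTestFn_magD j) hw k)).const_mul _
  have hre := integral_re hint
  simp only [RCLike.re_to_complex] at hre
  rw [hre, ← key, integral_complex_ofReal, Complex.ofReal_re]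

/-- The pointwise bound on the commutator terms. -/
lemma commutator_bound {a b : ℂ} (s : ℂ) (p g h : ℝ) :
    (Complex.I * (a * (starRingEnd ℂ) (p * b - Complex.I * (g * s)) -
      b * (starRingEnd ℂ) (p * a - Complex.I * (h * s)))).re ≤
      2 * (‖a‖ * ‖b‖ * |p|) + (‖a‖ ^ 2 + ‖b‖ ^ 2) / 2 + (g ^ 2 + h ^ 2) / 2 * ‖s‖ ^ 2 := by
  refine (Complex.re_le_norm _).trans ?_
  -- The product rule D_j(Ψu) = ΨD_ju - i(∂_jΨ)u gives a main term carrying Ψ, left untouched, and a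
  -- gradient term split by Young's inequality with equal weights.
  have h1 : ∀ (c e : ℂ) (g : ℝ), ‖c * (starRingEnd ℂ) (p * e - Complex.I * (g * s))‖ ≤
      ‖c‖ * ‖e‖ * |p| + ‖c‖ ^ 2 / 2 + g ^ 2 / 2 * ‖s‖ ^ 2 := by
    intro c e g
    rw [norm_mul, RCLike.norm_conj]
    have h2 : ‖(p : ℂ) * e - Complex.I * (g * s)‖ ≤ |p| * ‖e‖ + |g| * ‖s‖ := by
      refine (norm_sub_le _ _).trans (le_of_eq ?_)
      simp
    have h3 := mul_le_mul_of_nonneg_left h2 (norm_nonneg c)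
    have h4 : |g| ^ 2 = g ^ 2 := sq_abs g
    nlinarith [sq_nonneg (‖c‖ - |g| * ‖s‖)]
  rw [norm_mul, Complex.norm_I, one_mul]
  refine (norm_sub_le _ _).trans ?_
  have := h1 a b g
  have := h1 b a h
  nlinarith

/-- Cauchy–Schwarz over pairs (j,k): the squares of the products ‖a_k‖‖a_j‖ sum to (∑‖a_j‖²)². Using
the Hilbert–Schmidt norm of p avoids a factor d here. -/
lemma sum_commutator_bound (a : Fin d → ℂ) (p : Fin d → Fin d → ℝ)
    (hp : ∑ j, ∑ k, p j k ^ 2 ≤ 1) : ∑ j, ∑ k, ‖a k‖ * ‖a j‖ * |p j k| ≤ ∑ j, ‖a j‖ ^ 2 := by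
  have h := Finset.sum_mul_sq_le_sq_mul_sq (Finset.univ : Finset (Fin d × Fin d))
    (fun i => ‖a i.2‖ * ‖a i.1‖) (fun i => |p i.1 i.2|)
  simp only [Fintype.sum_prod_type, sq_abs] at h
  have h2 : ∑ j, ∑ k, (‖a k‖ * ‖a j‖) ^ 2 = (∑ j, ‖a j‖ ^ 2) ^ 2 := by
    rw [sq (∑ j, ‖a j‖ ^ 2), Finset.sum_mul_sum]
    refine Finset.sum_congr rfl fun j _ => Finset.sum_congr rfl fun k _ => ?_
    ring
  rw [h2] at h
  have h0 : 0 ≤ ∑ j, ‖a j‖ ^ 2 := Finset.sum_nonneg fun _ _ => sq_nonneg _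
  refine (abs_le_of_sq_le_sq' (h.trans ?_) h0).2
  nlinarith [sq_nonneg (∑ j, ‖a j‖ ^ 2)]

/-- The magnetic field is controlled by the magnetic gradient. -/
lemma IsTestFn.integral_normSqB_le (hu : S.IsTestFn 2 u) :
    ∫ x, S.normSqB x / S.m x * ‖u x‖ ^ 2 ∂S.vol ≤
      ∫ x, ((2 + d) * S.energyDensity u x + S.normSqGradPsi x * ‖u x‖ ^ 2) ∂S.vol := by
  have hu1 : S.IsTestFn 1 u := hu.of_le (by norm_num)
  have hw : ∀ j k, S.IsTestFn 1 fun y => (S.Psi j k y : ℂ) * u y := fun j k =>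
    hu1.mul (S.contDiffOn_Psi j k)
  have hc : Continuous (starRingEnd ℂ) := Complex.continuous_conj
  have i1 : ∀ j k, Integrable (fun x => S.B j k x * S.Psi j k x * ‖u x‖ ^ 2) S.vol := fun j k =>
    hu1.integrable_mul_sq ((S.contDiffOn_B j k).mul (S.contDiffOn_Psi j k)).continuousOn
  have hI : ∀ f g : EuclideanSpace ℝ (Fin d) → ℂ, S.IsTestFn 1 f → S.IsTestFn 1 g → ∀ i l,
      Integrable (fun x => S.magD l f x * (starRingEnd ℂ) (S.magD i g x)) S.vol :=
    fun f g hf hg i l => hf.integrable ((hf.continuousOn_magD l).mul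
      (hc.comp_continuousOn (hg.continuousOn_magD i)))
      fun x hx => by simp [magD_eq_zero_of_notMem_tsupport hx]
  have i2 : ∀ j k, Integrable (fun x => (Complex.I * (S.magD k u x * (starRingEnd ℂ)
          (S.magD j (fun y => (S.Psi j k y : ℂ) * u y) x) -
        S.magD j u x * (starRingEnd ℂ)
          (S.magD k (fun y => (S.Psi j k y : ℂ) * u y) x))).re) S.vol := fun j k =>
    ((((hI u _ hu1 (hw j k) j k).sub (hI u _ hu1 (hw j k) k j))).const_mul Complex.I).re
  have e1 : ∫ x, S.normSqB x / S.m x * ‖u x‖ ^ 2 ∂S.vol =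
      ∑ j, ∑ k, ∫ x, S.B j k x * S.Psi j k x * ‖u x‖ ^ 2 ∂S.vol := by
    simp_rw [← integral_finsetSum _ fun k _ => i1 _ k]
    rw [← integral_finsetSum _ fun j _ => integrable_finsetSum _ fun k _ => i1 j k]
    simp_rw [← Finset.sum_mul, sum_B_mul_Psi]
  rw [e1]
  simp_rw [hu.integral_B_mul_Psi, ← integral_finsetSum _ fun k _ => i2 _ k]
  rw [← integral_finsetSum _ fun j _ => integrable_finsetSum _ fun k _ => i2 j k]
  refine integral_mono (integrable_finsetSum _ fun j _ => integrable_finsetSum _ fun k _ => i2 j k)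
    ((hu1.integrable_energyDensity.const_mul _).add
      (hu1.integrable_mul_sq S.continuousOn_normSqGradPsi)) fun x => ?_
  simp only [hu1.magD_mul (S.contDiffOn_Psi _ _)]
  refine (Finset.sum_le_sum fun j _ => Finset.sum_le_sum fun k _ =>
    commutator_bound (u x) (S.Psi j k x) _ _).trans ?_
  simp only [Finset.sum_add_distrib, ← Finset.mul_sum, ← Finset.sum_mul, ← Finset.sum_div]
  have h1 := sum_commutator_bound (fun j => S.magD j u x) (fun j k => S.Psi j k x)
    (S.sum_Psi_sq_le x)
  have h2 : ∀ j k i, partialD i (S.Psi j k) x ^ 2 ≤ ∑ i, partialD i (S.Psi j k) x ^ 2 :=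
    fun j k i => Finset.single_le_sum (f := fun i => partialD i (S.Psi j k) x ^ 2)
      (fun _ _ => sq_nonneg _) (Finset.mem_univ i)
  have h3 : ∑ j, ∑ k, partialD j (S.Psi j k) x ^ 2 ≤ S.normSqGradPsi x :=
    Finset.sum_le_sum fun j _ => Finset.sum_le_sum fun k _ => h2 j k j
  have h4 : ∑ j, ∑ k, partialD k (S.Psi j k) x ^ 2 ≤ S.normSqGradPsi x :=
    Finset.sum_le_sum fun j _ => Finset.sum_le_sum fun k _ => h2 j k k
  -- In (2 + d), the 2 comes from the terms carrying Ψ, and the d from summing (‖a_k‖² + ‖a_j‖²)/2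
  -- over all pairs, where one index is always free.
  simp only [Finset.sum_const, Finset.card_univ, Fintype.card_fin, nsmul_eq_mul]
  have h5 : ∑ j, ‖S.magD j u x‖ ^ 2 = S.energyDensity u x := rfl
  rw [h5, ← Finset.mul_sum, h5]
  rw [h5] at h1
  nlinarith [sq_nonneg ‖u x‖]

/-- `∑ⱼ ∂ⱼΦ Re ((-i∂ⱼ + Aⱼ) u ū)`. -/
lemma IsTestFn.im_formDensity_mul_Phi (hu : S.IsTestFn 1 u) (x : EuclideanSpace ℝ (Fin d)) :
    (S.formDensity u (fun y => (S.Phi y : ℂ) * u y) x).im =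
      ∑ j, partialD j S.Phi x * (S.magD j u x * (starRingEnd ℂ) (u x)).re +
        (S.V x).im ^ 2 / S.m x * ‖u x‖ ^ 2 := by
  have h2 : u x * (starRingEnd ℂ) (u x) = ((‖u x‖ ^ 2 : ℝ) : ℂ) := by
    rw [Complex.mul_conj, Complex.normSq_eq_norm_sq]
  simp only [formDensity, hu.magD_mul S.contDiffOn_Phi, Complex.add_im, Complex.im_sum]
  congr 1
  · refine Finset.sum_congr rfl fun j _ => ?_
    simp only [map_sub, map_mul, Complex.conj_ofReal, Complex.conj_I]
    simp
    ring
  · have : S.V x * u x * (starRingEnd ℂ) ((S.Phi x : ℂ) * u x) =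
        S.V x * ((S.Phi x * ‖u x‖ ^ 2 : ℝ) : ℂ) := by
      rw [map_mul, Complex.conj_ofReal]
      push_cast at h2 ⊢
      linear_combination (S.V x * S.Phi x) * h2
    rw [this, Complex.im_mul_ofReal, Phi]
    ring

/-- Interchanging the two arguments reverses the sign of the gradient term only, so a bound on its
absolute value serves both orders. -/
lemma IsTestFn.im_formDensity_Phi_mul (hu : S.IsTestFn 1 u) (x : EuclideanSpace ℝ (Fin d)) :
    (S.formDensity (fun y => (S.Phi y : ℂ) * u y) u x).im =
      -∑ j, partialD j S.Phi x * (S.magD j u x * (starRingEnd ℂ) (u x)).re +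
        (S.V x).im ^ 2 / S.m x * ‖u x‖ ^ 2 := by
  have h2 : u x * (starRingEnd ℂ) (u x) = ((‖u x‖ ^ 2 : ℝ) : ℂ) := by
    rw [Complex.mul_conj, Complex.normSq_eq_norm_sq]
  simp only [formDensity, hu.magD_mul S.contDiffOn_Phi, Complex.add_im, Complex.im_sum,
    ← Finset.sum_neg_distrib]
  congr 1
  · refine Finset.sum_congr rfl fun j _ => ?_
    simp
    ring
  · have : S.V x * ((S.Phi x : ℂ) * u x) * (starRingEnd ℂ) (u x) =
        S.V x * ((S.Phi x * ‖u x‖ ^ 2 : ℝ) : ℂ) := by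
      push_cast at h2 ⊢
      linear_combination (S.V x * S.Phi x) * h2
    rw [this, Complex.im_mul_ofReal, Phi]
    ring

lemma re_formDensity_self (x : EuclideanSpace ℝ (Fin d)) :
    (S.formDensity u u x).re = S.energyDensity u x + (S.V x).re * ‖u x‖ ^ 2 := by
  have h2 : ∀ z : ℂ, z * (starRingEnd ℂ) z = ((‖z‖ ^ 2 : ℝ) : ℂ) := fun z => by
    rw [Complex.mul_conj, Complex.normSq_eq_norm_sq]
  rw [formDensity, mul_assoc, h2, Complex.add_re, Complex.re_mul_ofReal, Complex.re_sum]
  simp only [h2, Complex.ofReal_re, energyDensity]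

lemma abs_sum_grad_le (x : EuclideanSpace ℝ (Fin d)) :
    |∑ j, partialD j S.Phi x * (S.magD j u x * (starRingEnd ℂ) (u x)).re| ≤
      S.energyDensity u x / 8 + 2 * S.normSqGradPhi x * ‖u x‖ ^ 2 := by
  refine (Finset.abs_sum_le_sum_abs _ _).trans ?_
  rw [energyDensity, normSqGradPhi, Finset.sum_div, Finset.mul_sum, Finset.sum_mul,
    ← Finset.sum_add_distrib]
  refine Finset.sum_le_sum fun j _ => ?_
  have h1 : |(S.magD j u x * (starRingEnd ℂ) (u x)).re| ≤ ‖S.magD j u x‖ * ‖u x‖ := by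
    refine (Complex.abs_re_le_norm _).trans ?_
    rw [norm_mul, RCLike.norm_conj]
  rw [abs_mul]
  have h3 := mul_le_mul_of_nonneg_left h1 (abs_nonneg (partialD j S.Phi x))
  have h4 : |partialD j S.Phi x| ^ 2 = partialD j S.Phi x ^ 2 := sq_abs _
  rw [← h4]
  -- Young's inequality ab ≤ a²/8 + 2b². The small weight 1/8 on the energy leaves room for the
  -- magnetic term.
  nlinarith [sq_nonneg (‖S.magD j u x‖ - 4 * (|partialD j S.Phi x| * ‖u x‖))]

/-! ### Consequences of the main hypothesis: generalised coercivity and control of ∇Φ -/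

section Coercive

variable {γ₁ γ₂ : ℝ}

/-- The main hypothesis, with explicit constants. -/
def MainBound (S : ElectromagneticSystem d) (γ₁ γ₂ : ℝ) : Prop := ∀ x ∈ S.Ω,
  γ₁ * ‖S.V x‖ - γ₂ ≤
      ((S.V x).im ^ 2 + 1 / (12 * (d : ℝ)) * S.normSqB x) / S.m x + (S.V x).re
        - 9 * (S.normSqGradPhi x + S.normSqGradPsi x)

lemma integral_mono_vol {f g : EuclideanSpace ℝ (Fin d) → ℝ} (hf : Integrable f S.vol)
    (hg : Integrable g S.vol) (h : ∀ x ∈ S.Ω, f x ≤ g x) : ∫ x, f x ∂S.vol ≤ ∫ x, g x ∂S.vol :=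
  setIntegral_mono_on hf hg S.Ω.isOpen.measurableSet h

lemma normSqGradPhi_nonneg (x : EuclideanSpace ℝ (Fin d)) : 0 ≤ S.normSqGradPhi x :=
  Finset.sum_nonneg fun _ _ => sq_nonneg _

lemma normSqGradPsi_nonneg (x : EuclideanSpace ℝ (Fin d)) : 0 ≤ S.normSqGradPsi x :=
  Finset.sum_nonneg fun _ _ => Finset.sum_nonneg fun _ _ => Finset.sum_nonneg fun _ _ =>
    sq_nonneg _

/-- The normalised version of the bound on the magnetic field. -/
lemma IsTestFn.integral_normSqB_div_le (hd : 1 ≤ d) (hu : S.IsTestFn 2 u) :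
    ∫ x, 1 / (12 * (d : ℝ)) * (S.normSqB x / S.m x) * ‖u x‖ ^ 2 ∂S.vol ≤
      ∫ x, (S.energyDensity u x / 4 + S.normSqGradPsi x * ‖u x‖ ^ 2) ∂S.vol := by
  have hu1 : S.IsTestFn 1 u := hu.of_le (by norm_num)
  have hd' : (1 : ℝ) ≤ d := by exact_mod_cast hd
  simp_rw [mul_assoc (1 / (12 * (d : ℝ)))]
  rw [integral_const_mul]
  refine (mul_le_mul_of_nonneg_left hu.integral_normSqB_le (by positivity)).trans ?_
  rw [← integral_const_mul]
  have i1 := hu1.integrable_mul_sq S.continuousOn_normSqGradPsi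
  have i2 := hu1.integrable_energyDensity
  refine integral_mono (((i2.const_mul _).add i1).const_mul _) ((i2.div_const 4).add i1) fun x => ?_
  have h1 := energyDensity_nonneg (S := S) (u := u) x
  have h2 : 0 ≤ S.normSqGradPsi x * ‖u x‖ ^ 2 := mul_nonneg (normSqGradPsi_nonneg x) (sq_nonneg _)
  simp only []
  -- For d ≥ 1 one has (2 + d)/(12d) ≤ 3d/(12d) = 1/4; this explains the constant 1/(12d) in the
  -- hypothesis.
  rw [one_div, inv_mul_le_iff₀ (by positivity)]
  nlinarith

/-- The function `g` stands for the imaginary part of either density, with u or Φu in the first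
slot; only their common lower bound matters. Of the full energy, 1/8 is spent on ∇Φ and 1/4 on the
magnetic field, leaving 5/8 ≥ 1/2. The factor 9 in the hypothesis more than covers the gradient
losses 2|∇Φ|² and |∇Ψ|². -/
lemma IsTestFn.coercive_aux (hd : 1 ≤ d) (h : S.MainBound γ₁ γ₂) (hu : S.IsTestFn 2 u)
    {g : EuclideanSpace ℝ (Fin d) → ℝ} (hg : Integrable g S.vol)
    (hgu : ∀ x, (S.V x).im ^ 2 / S.m x * ‖u x‖ ^ 2 -
      (S.energyDensity u x / 8 + 2 * S.normSqGradPhi x * ‖u x‖ ^ 2) ≤ g x) :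
    1 / 2 * ∫ x, S.energyDensity u x ∂S.vol + γ₁ * ∫ x, ‖S.V x‖ * ‖u x‖ ^ 2 ∂S.vol
      - γ₂ * ∫ x, ‖u x‖ ^ 2 ∂S.vol ≤
      (∫ x, S.formDensity u u x ∂S.vol).re + ∫ x, g x ∂S.vol := by
  have hu1 : S.IsTestFn 1 u := hu.of_le (by norm_num)
  have i0 := hu1.integrable_formDensity hu1
  have hre := integral_re i0
  simp only [RCLike.re_to_complex] at hre
  have i1 := hu1.integrable_mul_sq S.continuousOn_normSqGradPsi
  have i2 := hu1.integrable_energyDensity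
  have i3 : Integrable (fun x => ‖S.V x‖ * ‖u x‖ ^ 2) S.vol :=
    hu1.integrable_mul_sq S.continuousOn_V.norm
  have i4 : Integrable (fun x => ‖u x‖ ^ 2) S.vol := by
    simpa using hu1.integrable_mul_sq (continuousOn_const (c := (1 : ℝ)))
  have i5 : Integrable (fun x => 1 / (12 * (d : ℝ)) * (S.normSqB x / S.m x) * ‖u x‖ ^ 2) S.vol :=
    hu1.integrable_mul_sq (continuousOn_const.mul
      (S.contDiffOn_normSqB.continuousOn.div S.contDiffOn_m.continuousOn
        fun x _ => (S.m_pos x).ne'))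
  have hB := hu.integral_normSqB_div_le hd
  rw [← hre]
  -- The magnetic bound `hB` holds only after integration, so its two sides are added here to the
  -- two sides of a pointwise inequality and removed at the end.
  have key := integral_mono_vol (S := S)
    ((((i2.const_mul (1 / 2)).add (i3.const_mul γ₁)).sub (i4.const_mul γ₂)).add
      ((i2.div_const 4).add i1)) ((i0.re.add hg).add i5) fun x hx => by
    simp only [Pi.add_apply, Pi.sub_apply, RCLike.re_to_complex, re_formDensity_self]
    have h1 := mul_le_mul_of_nonneg_right (h x hx) (sq_nonneg ‖u x‖)
    have h2 := energyDensity_nonneg (S := S) (u := u) x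
    have h3 : 0 ≤ S.normSqGradPsi x * ‖u x‖ ^ 2 :=
      mul_nonneg (normSqGradPsi_nonneg x) (sq_nonneg _)
    have h4 : 0 ≤ S.normSqGradPhi x * ‖u x‖ ^ 2 :=
      mul_nonneg (normSqGradPhi_nonneg x) (sq_nonneg _)
    have h5 := hgu x
    have e : ((S.V x).im ^ 2 + 1 / (12 * (d : ℝ)) * S.normSqB x) / S.m x =
      (S.V x).im ^ 2 / S.m x + 1 / (12 * (d : ℝ)) * (S.normSqB x / S.m x) := by ring
    rw [e] at h1
    nlinarith
  have e1 := integral_add (((i2.const_mul (1 / 2)).add (i3.const_mul γ₁)).sub (i4.const_mul γ₂))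
      ((i2.div_const 4).add i1)
  have e2 := integral_add (i0.re.add hg) i5
  have e3 := integral_sub ((i2.const_mul (1 / 2)).add (i3.const_mul γ₁)) (i4.const_mul γ₂)
  have e4 := integral_add (i2.const_mul (1 / 2)) (i3.const_mul γ₁)
  have e5 := integral_add i0.re hg
  simp only [Pi.add_apply, Pi.sub_apply, RCLike.re_to_complex] at e1 e2 e3 e4 e5 key
  rw [e1, e2, e3, e4, e5, integral_const_mul, integral_const_mul, integral_const_mul] at key
  linarith

lemma IsTestFn.coercive_left (hd : 1 ≤ d) (h : S.MainBound γ₁ γ₂) (hu : S.IsTestFn 2 u) :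
    1 / 2 * ∫ x, S.energyDensity u x ∂S.vol + γ₁ * ∫ x, ‖S.V x‖ * ‖u x‖ ^ 2 ∂S.vol
      - γ₂ * ∫ x, ‖u x‖ ^ 2 ∂S.vol ≤
      (∫ x, S.formDensity u u x ∂S.vol).re +
        (∫ x, S.formDensity u (fun y => (S.Phi y : ℂ) * u y) x ∂S.vol).im := by
  have hu1 : S.IsTestFn 1 u := hu.of_le (by norm_num)
  have i := hu1.integrable_formDensity (hu1.mul S.contDiffOn_Phi)
  have him := integral_im i
  simp only [RCLike.im_to_complex] at him
  rw [← him]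
  refine hu.coercive_aux hd h i.im fun x => ?_
  rw [hu1.im_formDensity_mul_Phi]
  have := abs_le.1 (abs_sum_grad_le (S := S) (u := u) x)
  linarith [this.1]

lemma IsTestFn.coercive_right (hd : 1 ≤ d) (h : S.MainBound γ₁ γ₂) (hu : S.IsTestFn 2 u) :
    1 / 2 * ∫ x, S.energyDensity u x ∂S.vol + γ₁ * ∫ x, ‖S.V x‖ * ‖u x‖ ^ 2 ∂S.vol
      - γ₂ * ∫ x, ‖u x‖ ^ 2 ∂S.vol ≤
      (∫ x, S.formDensity u u x ∂S.vol).re +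
        (∫ x, S.formDensity (fun y => (S.Phi y : ℂ) * u y) u x ∂S.vol).im := by
  have hu1 : S.IsTestFn 1 u := hu.of_le (by norm_num)
  have i := (hu1.mul S.contDiffOn_Phi).integrable_formDensity hu1
  have him := integral_im i
  simp only [RCLike.im_to_complex] at him
  rw [← him]
  refine hu.coercive_aux hd h i.im fun x => ?_
  rw [hu1.im_formDensity_Phi_mul]
  have := abs_le.1 (abs_sum_grad_le (S := S) (u := u) x)
  linarith [this.2]

/-- The gradient of `Φ` is form-bounded. -/
lemma IsTestFn.integral_normSqGradPhi_le (hd : 1 ≤ d) (hγ : 0 ≤ γ₁) (h : S.MainBound γ₁ γ₂)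
    (hu : S.IsTestFn 2 u) :
    ∫ x, S.normSqGradPhi x * ‖u x‖ ^ 2 ∂S.vol ≤
      ∫ x, S.energyDensity u x ∂S.vol + 2 * ∫ x, ‖S.V x‖ * ‖u x‖ ^ 2 ∂S.vol
      + |γ₂| * ∫ x, ‖u x‖ ^ 2 ∂S.vol := by
  have hu1 : S.IsTestFn 1 u := hu.of_le (by norm_num)
  have i1 := hu1.integrable_mul_sq S.continuousOn_normSqGradPsi
  have i1' := hu1.integrable_mul_sq S.continuousOn_normSqGradPhi
  have i2 := hu1.integrable_energyDensity
  have i3 : Integrable (fun x => ‖S.V x‖ * ‖u x‖ ^ 2) S.vol :=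
    hu1.integrable_mul_sq S.continuousOn_V.norm
  have i4 : Integrable (fun x => ‖u x‖ ^ 2) S.vol := by
    simpa using hu1.integrable_mul_sq (continuousOn_const (c := (1 : ℝ)))
  have i5 : Integrable (fun x => 1 / (12 * (d : ℝ)) * (S.normSqB x / S.m x) * ‖u x‖ ^ 2) S.vol :=
    hu1.integrable_mul_sq (continuousOn_const.mul
      (S.contDiffOn_normSqB.continuousOn.div S.contDiffOn_m.continuousOn
        fun x _ => (S.m_pos x).ne'))
  have hB := hu.integral_normSqB_div_le hd
  -- The hypothesis is now used as an upper bound for the gradients: since V₂²/m + V₁ ≤ 2|V|, it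
  -- bounds 9(|∇Φ|² + |∇Ψ|²) by 2|V| + |γ₂| + |B|²/(12dm). The last term is again absorbed through
  -- `hB`.
  have key := integral_mono_vol (S := S) (i1'.add ((i2.div_const 4).add i1))
    (((i2.add (i3.const_mul 2)).add (i4.const_mul |γ₂|)).add i5) fun x hx => by
    simp only [Pi.add_apply]
    have h1 := mul_le_mul_of_nonneg_right (h x hx) (sq_nonneg ‖u x‖)
    have h2 := energyDensity_nonneg (S := S) (u := u) x
    have h3 : 0 ≤ S.normSqGradPsi x * ‖u x‖ ^ 2 :=
      mul_nonneg (normSqGradPsi_nonneg x) (sq_nonneg _)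
    have h4 : 0 ≤ S.normSqGradPhi x * ‖u x‖ ^ 2 :=
      mul_nonneg (normSqGradPhi_nonneg x) (sq_nonneg _)
    have e : ((S.V x).im ^ 2 + 1 / (12 * (d : ℝ)) * S.normSqB x) / S.m x =
      (S.V x).im ^ 2 / S.m x + 1 / (12 * (d : ℝ)) * (S.normSqB x / S.m x) := by ring
    rw [e] at h1
    have h5 : (S.V x).im ^ 2 / S.m x ≤ ‖S.V x‖ := by
      have ha := S.abs_Phi_le x
      have hb : (S.V x).im ^ 2 / S.m x = S.Phi x * (S.V x).im := by rw [Phi]; ring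
      rw [hb]
      refine (le_abs_self _).trans ?_
      rw [abs_mul]
      exact (mul_le_mul ha (Complex.abs_im_le_norm _) (abs_nonneg _) zero_le_one).trans
        (one_mul _).le
    have h6 : (S.V x).re ≤ ‖S.V x‖ := Complex.re_le_norm _
    have h7 : γ₂ ≤ |γ₂| := le_abs_self _
    have h8 := mul_le_mul_of_nonneg_right (add_le_add (add_le_add h5 h6) h7) (sq_nonneg ‖u x‖)
    have h9 : 0 ≤ γ₁ * ‖S.V x‖ * ‖u x‖ ^ 2 := by positivity
    nlinarith
  have e1 := integral_add i1' ((i2.div_const 4).add i1)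
  have e2 := integral_add ((i2.add (i3.const_mul 2)).add (i4.const_mul |γ₂|)) i5
  have e3 := integral_add (i2.add (i3.const_mul 2)) (i4.const_mul |γ₂|)
  have e4 := integral_add i2 (i3.const_mul 2)
  simp only [Pi.add_apply] at e1 e2 e3 e4 key
  rw [e1, e2, e3, e4, integral_const_mul, integral_const_mul] at key
  linarith

end Coercive

end ElectromagneticSystem

namespace ElectromagneticSystem

variable {d : ℕ} (S : ElectromagneticSystem d)

/-! ### The graph of the form norm -/

/-- The Hilbert space in which `u ↦ (u, |V|^{1/2} u, (-i∇ + A) u)` takes its values. -/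
abbrev GraphSpace : Type := PiLp 2 fun _ : Option (Option (Fin d)) => S.L2

/-- `u ↦ |V|^{1/2} u` on the variational space. -/
def weighted : S.formDomain →ₗ[ℂ] S.L2 where
  toFun u := u.2.2.toLp
  map_add' u v := by
    rw [← MemLp.toLp_add, MemLp.toLp_eq_toLp_iff]
    filter_upwards [Lp.coeFn_add ((u : S.H1A) : S.L2) v] with x hx
    rw [Submodule.coe_add, Submodule.coe_add, hx, Pi.add_apply, Pi.add_apply, mul_add]
  map_smul' c u := by
    rw [RingHom.id_apply, ← MemLp.toLp_const_smul, MemLp.toLp_eq_toLp_iff]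
    filter_upwards [Lp.coeFn_smul c ((u : S.H1A) : S.L2)] with x hx
    rw [Submodule.coe_smul, Submodule.coe_smul, hx, Pi.smul_apply, Pi.smul_apply, smul_eq_mul,
      smul_eq_mul]
    ring

lemma coeFn_weighted (u : S.formDomain) :
    S.weighted u =ᵐ[S.vol] fun x => (√‖S.V x‖ : ℂ) * ((u : S.H1A) : S.L2) x :=
  u.2.2.coeFn_toLp

/-- The components of `(u, |V|^{1/2} u, (-i∇ + A) u)`. -/
def graphComp : Option (Option (Fin d)) → S.formDomain →ₗ[ℂ] S.L2
  | none => S.formEmbedding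
  | some none => S.weighted
  | some (some j) => S.magDeriv j ∘ₗ S.formDomain.subtype

/-- The map `u ↦ (u, |V|^{1/2} u, (-i∇ + A) u)`. -/
def graphMap : S.formDomain →ₗ[ℂ] S.GraphSpace :=
  (WithLp.linearEquiv 2 ℂ (Option (Option (Fin d)) → S.L2)).symm.toLinearMap ∘ₗ
    LinearMap.pi S.graphComp

@[simp] lemma graphMap_apply (u : S.formDomain) (o : Option (Option (Fin d))) :
    S.graphMap u o = S.graphComp o u := rfl

lemma graphMap_injective : Function.Injective S.graphMap := fun _ _ h =>
  Subtype.ext (Subtype.ext (congrArg (fun y : S.GraphSpace => y none) h))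

/-- The components of `(u, |V|^{1/2} u, (-i∇ + A) u)` for a compactly supported `C¹` function. -/
def testComp (u : EuclideanSpace ℝ (Fin d) → ℂ) :
    Option (Option (Fin d)) → EuclideanSpace ℝ (Fin d) → ℂ
  | none => u
  | some none => fun x => (√‖S.V x‖ : ℂ) * u x
  | some (some j) => S.magD j u

lemma continuousOn_sqrt_V : ContinuousOn (fun x => (√‖S.V x‖ : ℂ))
    (S.Ω : Set (EuclideanSpace ℝ (Fin d))) :=
  Complex.continuous_ofReal.comp_continuousOn
    (Real.continuous_sqrt.comp_continuousOn S.continuousOn_V.norm)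

variable {S}
variable {u w : EuclideanSpace ℝ (Fin d) → ℂ}

lemma testComp_eq_zero {x : EuclideanSpace ℝ (Fin d)} (hx : x ∉ tsupport u) :
    ∀ o, S.testComp u o x = 0
  | none => image_eq_zero_of_notMem_tsupport hx
  | some none => by simp [testComp, image_eq_zero_of_notMem_tsupport hx]
  | some (some j) => magD_eq_zero_of_notMem_tsupport hx j

lemma IsTestFn.continuousOn_testComp (hu : S.IsTestFn 1 u) :
    ∀ o, ContinuousOn (S.testComp u o) (S.Ω : Set (EuclideanSpace ℝ (Fin d)))
  | none => hu.continuous.continuousOn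
  | some none => S.continuousOn_sqrt_V.mul hu.continuous.continuousOn
  | some (some j) => hu.continuousOn_magD j

lemma IsTestFn.memLp_testComp (hu : S.IsTestFn 1 u) (o : Option (Option (Fin d))) :
    MemLp (S.testComp u o) 2 S.vol :=
  hu.memLp (hu.continuousOn_testComp o) fun _ hx => testComp_eq_zero hx o

lemma testComp_linear (c : ℂ) (hu : S.IsTestFn 1 u) (hw : S.IsTestFn 1 w) :
    ∀ o x, S.testComp (fun y => c * u y + w y) o x = c * S.testComp u o x + S.testComp w o x
  | none, x => rfl
  | some none, x => by simp only [testComp]; ring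
  | some (some j), x => by
    have : partialD j (fun y => c * u y + w y) x = c * partialD j u x + partialD j w x := by
      simp only [partialD]
      rw [fderiv_fun_add ((hu.differentiable x).const_mul c) (hw.differentiable x),
        fderiv_const_mul (hu.differentiable x)]
      rfl
    simp only [testComp, magD, this]
    ring

/-- The element `(u, |V|^{1/2} u, (-i∇ + A) u)` for a compactly supported `C¹` function. -/
def testGraph (hu : S.IsTestFn 1 u) : S.GraphSpace :=
  WithLp.toLp 2 fun o => (hu.memLp_testComp o).toLp

@[simp] lemma testGraph_apply (hu : S.IsTestFn 1 u) (o : Option (Option (Fin d))) :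
    testGraph hu o = (hu.memLp_testComp o).toLp := rfl

lemma IsTestFn.linear {n : ℕ∞} (c : ℂ) (hu : S.IsTestFn n u) (hw : S.IsTestFn n w) :
    S.IsTestFn n fun y => c * u y + w y := by
  have hs : tsupport (fun y => c * u y + w y) ⊆ tsupport u ∪ tsupport w := by
    refine (tsupport_add (fun y => c * u y) w).trans (Set.union_subset_union_left _ ?_)
    exact closure_mono fun y hy => right_ne_zero_of_mul hy
  refine ⟨(contDiff_const.mul hu.contDiff).add hw.contDiff, ?_,
    hs.trans (Set.union_subset hu.tsupport_subset hw.tsupport_subset)⟩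
  exact (IsCompact.union hu.hasCompactSupport hw.hasCompactSupport).of_isClosed_subset
    (isClosed_tsupport _) hs

lemma testGraph_linear (c : ℂ) (hu : S.IsTestFn 1 u) (hw : S.IsTestFn 1 w) :
    testGraph (hu.linear c hw) = c • testGraph hu + testGraph hw := by
  ext1 o
  rw [PiLp.add_apply, PiLp.smul_apply, testGraph_apply, testGraph_apply, testGraph_apply,
    ← MemLp.toLp_const_smul, ← MemLp.toLp_add, MemLp.toLp_eq_toLp_iff]
  exact ae_of_all _ fun x => testComp_linear c hu hw o x

lemma testGraph_congr (hu : S.IsTestFn 1 u) (hw : S.IsTestFn 1 w) (h : u = w) :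
    testGraph hu = testGraph hw := by subst h; rfl

lemma norm_toLp_sq {f : EuclideanSpace ℝ (Fin d) → ℂ} (hf : MemLp f 2 S.vol) :
    ‖hf.toLp‖ ^ 2 = ∫ x, ‖f x‖ ^ 2 ∂S.vol := by
  have h : (inner ℂ hf.toLp hf.toLp : ℂ) = ((‖hf.toLp‖ ^ 2 : ℝ) : ℂ) := by
    rw [inner_self_eq_norm_sq_to_K]; norm_cast
  rw [L2.inner_def] at h
  have h2 : ∫ x, inner ℂ ((hf.toLp f : S.L2) x) ((hf.toLp f : S.L2) x) ∂S.vol =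
      ∫ x, ((‖f x‖ ^ 2 : ℝ) : ℂ) ∂S.vol := by
    refine integral_congr_ae ?_
    filter_upwards [hf.coeFn_toLp] with x hx
    rw [hx, inner_self_eq_norm_sq_to_K]
    norm_cast
  rw [h2, integral_complex_ofReal] at h
  exact_mod_cast h.symm

lemma norm_sq_L2 (f : S.L2) : ‖f‖ ^ 2 = ∫ x, ‖f x‖ ^ 2 ∂S.vol := by
  have := norm_toLp_sq (S := S) (Lp.memLp f)
  rwa [Lp.toLp_coeFn] at this

/-- The square of the form norm of a test function. -/
lemma norm_testGraph_sq (hu : S.IsTestFn 1 u) : ‖testGraph hu‖ ^ 2 =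
    ∫ x, ‖u x‖ ^ 2 ∂S.vol + ∫ x, ‖S.V x‖ * ‖u x‖ ^ 2 ∂S.vol + ∫ x, S.energyDensity u x ∂S.vol := by
  rw [PiLp.norm_sq_eq_of_L2]
  simp only [testGraph_apply, norm_toLp_sq, Fintype.sum_option, testComp, energyDensity]
  rw [integral_finsetSum, add_assoc]
  · congr 2
    refine integral_congr_ae (ae_of_all _ fun x => ?_)
    simp only [norm_mul, mul_pow, Complex.norm_real, Real.norm_eq_abs, sq_abs]
    rw [Real.sq_sqrt (norm_nonneg _)]
  · intro j _
    exact hu.integrable ((hu.continuousOn_magD j).norm.pow 2) fun x hx => by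
      simp [magD_eq_zero_of_notMem_tsupport hx]

/-! ### Test functions in the variational space -/

variable (S) in
/-- Test functions, as elements of the variational space. -/
def testForm : 𝓓(S.Ω, ℂ) →ₗ[ℂ] S.formDomain where
  toFun φ := ⟨S.testH1A φ, S.testH1A_mem_formDomain φ⟩
  map_add' φ ψ := Subtype.ext (Subtype.ext (MemLp.toLp_add (S.memLp_test φ) (S.memLp_test ψ)))
  map_smul' c φ := Subtype.ext (Subtype.ext (MemLp.toLp_const_smul c (S.memLp_test φ)))

lemma isTestFn_one (φ : 𝓓(S.Ω, ℂ)) : S.IsTestFn 1 φ := (S.isTestFn_coe φ).of_le le_top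

lemma graphMap_testForm (φ : 𝓓(S.Ω, ℂ)) :
    S.graphMap (S.testForm φ) = testGraph (isTestFn_one φ) := by
  ext1 o
  rw [graphMap_apply, testGraph_apply]
  match o with
  | none => rfl
  | some none =>
    refine Lp.ext ((S.coeFn_weighted _).trans ?_)
    filter_upwards [(S.memLp_test φ).coeFn_toLp,
      ((isTestFn_one φ).memLp_testComp (some none)).coeFn_toLp] with x hx hx2
    rw [hx2]
    simp only [testComp, testForm, testH1A, LinearMap.coe_mk, AddHom.coe_mk]
    rw [hx]
  | some (some j) =>
    exact (S.isMagDeriv_magDeriv j _).unique (S.isMagDeriv_test j φ)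

/-! ### Bounded multiplication operators -/

lemma memLp_mul_of_bound {b : EuclideanSpace ℝ (Fin d) → ℂ}
    (hb : ContinuousOn b (S.Ω : Set (EuclideanSpace ℝ (Fin d)))) {C : ℝ}
    (hC : ∀ x ∈ S.Ω, ‖b x‖ ≤ C) (f : S.L2) : MemLp (fun x => b x * f x) 2 S.vol :=
  MemLp.of_le_mul (Lp.memLp f)
    ((hb.aestronglyMeasurable S.Ω.isOpen.measurableSet).mul (Lp.aestronglyMeasurable f))
    ((ae_restrict_iff' S.Ω.isOpen.measurableSet).2 (ae_of_all _ fun x hx => by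
      rw [norm_mul]; exact mul_le_mul_of_nonneg_right (hC x hx) (norm_nonneg _)))

/-- Multiplication by a bounded function which is continuous on `Ω`. -/
def mulOp {b : EuclideanSpace ℝ (Fin d) → ℂ}
    (hb : ContinuousOn b (S.Ω : Set (EuclideanSpace ℝ (Fin d)))) {C : ℝ}
    (hC : ∀ x ∈ S.Ω, ‖b x‖ ≤ C) : S.L2 →L[ℂ] S.L2 :=
  LinearMap.mkContinuous
    { toFun := fun f => (memLp_mul_of_bound hb hC f).toLp
      map_add' := fun f g => by
        rw [← MemLp.toLp_add, MemLp.toLp_eq_toLp_iff]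
        filter_upwards [Lp.coeFn_add f g] with x hx
        rw [hx, Pi.add_apply, Pi.add_apply, mul_add]
      map_smul' := fun c f => by
        rw [RingHom.id_apply, ← MemLp.toLp_const_smul, MemLp.toLp_eq_toLp_iff]
        filter_upwards [Lp.coeFn_smul c f] with x hx
        rw [hx, Pi.smul_apply, Pi.smul_apply, smul_eq_mul, smul_eq_mul]
        ring } C fun f => by
      refine Lp.norm_le_mul_norm_of_ae_le_mul ?_
      filter_upwards [
        (memLp_mul_of_bound hb hC f).coeFn_toLp, ae_restrict_mem S.Ω.isOpen.measurableSet] with x hx hxΩ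
      simp only [LinearMap.coe_mk, AddHom.coe_mk]
      rw [hx, norm_mul]
      exact mul_le_mul_of_nonneg_right (hC x hxΩ) (norm_nonneg _)

lemma coeFn_mulOp {b : EuclideanSpace ℝ (Fin d) → ℂ}
    (hb : ContinuousOn b (S.Ω : Set (EuclideanSpace ℝ (Fin d)))) {C : ℝ}
    (hC : ∀ x ∈ S.Ω, ‖b x‖ ≤ C) (f : S.L2) : mulOp hb hC f =ᵐ[S.vol] fun x => b x * f x :=
  (memLp_mul_of_bound hb hC f).coeFn_toLp

lemma mulOp_toLp {b f : EuclideanSpace ℝ (Fin d) → ℂ}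
    (hb : ContinuousOn b (S.Ω : Set (EuclideanSpace ℝ (Fin d)))) {C : ℝ}
    (hC : ∀ x ∈ S.Ω, ‖b x‖ ≤ C) (hf : MemLp f 2 S.vol)
    (hbf : MemLp (fun x => b x * f x) 2 S.vol) : mulOp hb hC hf.toLp = hbf.toLp := by
  refine Lp.ext ((coeFn_mulOp hb hC _).trans ?_)
  filter_upwards [hf.coeFn_toLp, hbf.coeFn_toLp] with x h1 h2
  rw [h1, h2]

/-- Dominated convergence in L². It serves for the cut-offs, which tend to 1, and for their
derivatives, which tend to 0. -/
lemma tendsto_mulOp {b : ℕ → EuclideanSpace ℝ (Fin d) → ℂ}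
    (hb : ∀ n, ContinuousOn (b n) (S.Ω : Set (EuclideanSpace ℝ (Fin d)))) {C : ℝ}
    (hC : ∀ n, ∀ x ∈ S.Ω, ‖b n x‖ ≤ C) (c : ℂ) (hlim : ∀ x, Tendsto (fun n => b n x) atTop (𝓝 c))
    (f : S.L2) : Tendsto (fun n => mulOp (hb n) (hC n) f) atTop (𝓝 (c • f)) := by
  rw [tendsto_iff_norm_sub_tendsto_zero]
  have h1 : Tendsto (fun n => ∫ x, ‖(b n x - c) * f x‖ ^ 2 ∂S.vol) atTop
      (𝓝 (∫ x, (0 : ℝ) ∂S.vol)) := by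
    refine tendsto_integral_of_dominated_convergence (fun x => (C + ‖c‖) ^ 2 * ‖f x‖ ^ 2)
      (fun n => ?_) ?_ (fun n => ?_) (ae_of_all _ fun x => ?_)
    · exact (((((hb n).aestronglyMeasurable S.Ω.isOpen.measurableSet).sub
        aestronglyMeasurable_const).mul (Lp.aestronglyMeasurable f)).norm).pow 2
    · exact ((memLp_two_iff_integrable_sq_norm (Lp.aestronglyMeasurable f)).1
        (Lp.memLp f)).const_mul _
    · filter_upwards [ae_restrict_mem S.Ω.isOpen.measurableSet] with x hx
      rw [Real.norm_of_nonneg (by positivity), norm_mul, mul_pow]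
      gcongr
      exact (norm_sub_le _ _).trans (by gcongr; exact hC n x hx)
    · have h2 : Tendsto (fun n => ‖(b n x - c) * f x‖ ^ 2) atTop
          (𝓝 (‖(c - c) * f x‖ ^ 2)) :=
        ((((hlim x).sub_const c).mul_const (f x)).norm).pow 2
      simpa using h2
  have h2 : ∀ n, ‖mulOp (hb n) (hC n) f - c • f‖ ^ 2 = ∫ x, ‖(b n x - c) * f x‖ ^ 2 ∂S.vol := by
    intro n
    rw [norm_sq_L2]
    refine integral_congr_ae ?_
    filter_upwards [Lp.coeFn_sub (mulOp (hb n) (hC n) f) (c • f), coeFn_mulOp (hb n) (hC n) f,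
      Lp.coeFn_smul c f] with x h3 h4 h5
    rw [h3, Pi.sub_apply, h4, h5, Pi.smul_apply, smul_eq_mul, sub_mul]
  have h3 := h1.sqrt
  simp only [← h2, integral_zero, Real.sqrt_zero, Real.sqrt_sq (norm_nonneg _)] at h3
  exact h3

lemma continuous_integral_mul {g : EuclideanSpace ℝ (Fin d) → ℂ} (hg : MemLp g 2 S.vol) :
    Continuous fun f : S.L2 => ∫ x, f x * g x ∂S.vol := by
  have h : ∀ f : S.L2, ∫ x, f x * g x ∂S.vol = inner ℂ (hg.star.toLp) f := fun f => by
    rw [L2.inner_def]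
    refine integral_congr_ae ?_
    filter_upwards [hg.star.coeFn_toLp] with x hx
    rw [hx, RCLike.inner_apply]
    simp
  simp only [h]
  fun_prop

/-! ### Closedness of the graph -/

/-- Limits of test functions for the form norm belong to the variational space. -/
lemma mem_range_graphMap_of_mem_closure {y : S.GraphSpace}
    (hy : y ∈ closure (Set.range fun φ => S.graphMap (S.testForm φ))) :
    y ∈ LinearMap.range S.graphMap := by
  obtain ⟨z, hz, hlim⟩ := mem_closure_iff_seq_limit.1 hy
  choose φ hφ using hz
  have hcomp : ∀ o, Tendsto (fun n => S.graphComp o (S.testForm (φ n))) atTop (𝓝 (y o)) := by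
    intro o
    have h1 : Tendsto (fun n => z n o) atTop (𝓝 (y o)) :=
      ((PiLp.continuous_apply 2 _ o).tendsto y).comp hlim
    simpa only [← hφ, graphMap_apply] using h1
  -- For a fixed test function both sides of the weak identity are continuous for the L² norm, so
  -- the identity survives the limit.
  have hD : ∀ j, S.IsMagDeriv j (y none) (y (some (some j))) := by
    intro j ψ
    have h1 := ((continuous_integral_mul (S := S) (S.memLp_test ψ)).tendsto _).comp
      (hcomp (some (some j)))
    have h2 := ((continuous_integral_mul (S := S) (S.memLp_magTest Complex.I j ψ)).tendsto _).comp
      (hcomp none)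
    refine tendsto_nhds_unique h1 (h2.congr fun n => ?_)
    exact (S.isMagDeriv_magDeriv j (S.testForm (φ n) : S.H1A) ψ).symm
  -- Multiplication by |V|^{1/2} is unbounded in general, so the weighted component is identified by
  -- almost everywhere convergence along a subsequence, extracted twice.
  have hV : (y (some none) : S.L2) =ᵐ[S.vol] fun x => (√‖S.V x‖ : ℂ) * (y none : S.L2) x := by
    obtain ⟨n₁, hn₁, h1⟩ := (tendstoInMeasure_of_tendsto_Lp (hcomp none)).exists_seq_tendsto_ae
    obtain ⟨n₂, hn₂, h2⟩ := (tendstoInMeasure_of_tendsto_Lp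
      ((hcomp (some none)).comp hn₁.tendsto_atTop)).exists_seq_tendsto_ae
    have h3 : ∀ᵐ x ∂S.vol, ∀ n, S.weighted (S.testForm (φ n)) x =
        (√‖S.V x‖ : ℂ) * ((S.testForm (φ n) : S.H1A) : S.L2) x :=
      ae_all_iff.2 fun n => S.coeFn_weighted _
    filter_upwards [h1, h2, h3] with x hx1 hx2 hx3
    refine tendsto_nhds_unique hx2 ?_
    refine Tendsto.congr (fun i => (hx3 (n₁ (n₂ i))).symm) ?_
    exact (hx1.comp hn₂.tendsto_atTop).const_mul _
  let v : S.H1A := ⟨y none, fun j => ⟨_, hD j⟩⟩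
  have hv : ∀ j, S.magDeriv j v = y (some (some j)) := fun j =>
    (S.isMagDeriv_magDeriv j v).unique (hD j)
  have hv0 : v ∈ S.H1A0 := by
    intro ε hε
    obtain ⟨n, hn⟩ := (Metric.tendsto_atTop.1 hlim ε hε)
    refine ⟨S.testForm (φ n), ⟨φ n, (S.memLp_test (φ n)).coeFn_toLp⟩, ?_⟩
    refine lt_of_le_of_lt ?_ (hn n le_rfl)
    rw [dist_comm, dist_eq_norm, normH1A]
    refine Real.sqrt_le_iff.2 ⟨norm_nonneg _, ?_⟩
    rw [PiLp.norm_sq_eq_of_L2]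
    simp only [Fintype.sum_option, PiLp.sub_apply, ← hφ, graphMap_apply, map_sub, hv]
    have e1 : S.graphComp none (S.testForm (φ n)) = (S.testForm (φ n) : S.H1A) := rfl
    have e2 : ∀ j, S.graphComp (some (some j)) (S.testForm (φ n)) =
      S.magDeriv j (S.testForm (φ n)) := fun _ => rfl
    simp only [e1, e2]
    have e3 : ((v - (S.testForm (φ n) : S.H1A) : S.H1A) : S.L2) =
      y none - (S.testForm (φ n) : S.H1A) := rfl
    rw [e3]
    have h : 0 ≤ ‖y (some none) - S.graphComp (some none) (S.testForm (φ n))‖ ^ 2 := sq_nonneg _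
    linarith
  have hvV : v ∈ S.formDomain := ⟨hv0, (Lp.memLp (y (some none))).ae_eq hV⟩
  refine ⟨⟨v, hvV⟩, ?_⟩
  ext1 o
  rw [graphMap_apply]
  match o with
  | none => rfl
  | some none => exact Lp.ext ((S.coeFn_weighted _).trans hV.symm)
  | some (some j) => exact hv j

end ElectromagneticSystem

namespace ElectromagneticSystem

variable {d : ℕ} {S : ElectromagneticSystem d}
variable {u w : EuclideanSpace ℝ (Fin d) → ℂ}

/-! ### Density of test functions: cut-off -/

/-- Continuity up to the boundary matters here: the intersection of the closure of Ω with a ball is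
compact, whereas its intersection with Ω need not be. -/
lemma ContDiffUpToBoundary_bound {F : Type*} [NormedAddCommGroup F] [NormedSpace ℝ F] {n : ℕ}
    {Ω : Set (EuclideanSpace ℝ (Fin d))} {f : EuclideanSpace ℝ (Fin d) → F}
    (hf : ContDiffUpToBoundary n Ω f) (R : ℝ) : ∃ C, 0 ≤ C ∧ ∀ x ∈ Ω, ‖x‖ ≤ R → ‖f x‖ ≤ C := by
  obtain ⟨g, hg, hfg⟩ := hf.2 0 (Nat.zero_le _)
  have hK : IsCompact (closure Ω ∩ Metric.closedBall 0 R) :=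
    (isCompact_closedBall 0 R).inter_left isClosed_closure
  obtain ⟨C, hC⟩ := hK.exists_bound_of_continuousOn (hg.mono Set.inter_subset_left)
  refine ⟨max C 0, le_max_right _ _, fun x hx hxR => le_max_of_le_left ?_⟩
  have h := hC x ⟨subset_closure hx, by simpa using hxR⟩
  rwa [← hfg hx, norm_iteratedFDeriv_zero] at h

variable (d) in
/-- A smooth cut-off function, equal to `1` on the unit ball. -/
def bump : ContDiffBump (0 : EuclideanSpace ℝ (Fin d)) := ⟨1, 2, one_pos, one_lt_two⟩

/-- The rescaled cut-off functions. -/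
def cut (n : ℕ) (x : EuclideanSpace ℝ (Fin d)) : ℝ := bump d ((n + 1 : ℝ)⁻¹ • x)

lemma contDiff_cut (n : ℕ) : ContDiff ℝ (⊤ : ℕ∞) (cut (d := d) n) :=
  (bump d).contDiff.comp (contDiff_const_smul _)

lemma abs_cut_le (n : ℕ) (x : EuclideanSpace ℝ (Fin d)) : |cut n x| ≤ 1 := by
  rw [cut, abs_of_nonneg (bump d).nonneg]
  exact (bump d).le_one

lemma norm_lt_of_cut_ne_zero {n : ℕ} {x : EuclideanSpace ℝ (Fin d)} (h : cut n x ≠ 0) :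
    ‖x‖ < 2 * (n + 1) := by
  have h1 : (n + 1 : ℝ)⁻¹ • x ∈ Function.support (bump d) := h
  have hn : (0 : ℝ) < n + 1 := by positivity
  rw [(bump d).support_eq, mem_ball_zero_iff, norm_smul, Real.norm_of_nonneg (by positivity),
    inv_mul_lt_iff₀ hn] at h1
  have h2 : (bump d).rOut = 2 := rfl
  rw [h2] at h1
  linarith

lemma tendsto_cut (x : EuclideanSpace ℝ (Fin d)) : Tendsto (fun n => cut n x) atTop (𝓝 1) := by
  have h1 : Tendsto (fun n : ℕ => (n + 1 : ℝ)⁻¹ • x) atTop (𝓝 ((0 : ℝ) • x)) := by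
    have := tendsto_one_div_add_atTop_nhds_zero_nat (𝕜 := ℝ)
    simp only [one_div] at this
    exact this.smul_const x
  have h2 := ((bump d).continuous.tendsto _).comp h1
  rw [zero_smul, (bump d).one_of_mem_closedBall (by simpa using (bump d).rIn_pos.le)] at h2
  exact h2

lemma partialD_cut (j : Fin d) (n : ℕ) (x : EuclideanSpace ℝ (Fin d)) :
    partialD j (cut n) x = (n + 1 : ℝ)⁻¹ * partialD j (bump d) ((n + 1 : ℝ)⁻¹ • x) := by
  have e : cut (d := d) n = fun x => bump d ((n + 1 : ℝ)⁻¹ • x) := rfl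
  rw [partialD, e, fderiv_comp_smul]
  rfl

lemma exists_abs_partialD_bump_le (j : Fin d) :
    ∃ C, ∀ x, |partialD j (bump d) x| ≤ C := by
  have h1 : Continuous (partialD j (bump d)) :=
    ((bump d).contDiff (n := 1)).continuous_fderiv (by simp) |>.clm_apply continuous_const
  have h2 : HasCompactSupport (partialD j (bump d)) :=
    (bump d).hasCompactSupport.fderiv_apply (𝕜 := ℝ) (EuclideanSpace.single j 1)
  obtain ⟨C, hC⟩ := h1.bounded_above_of_compact_support h2
  exact ⟨C, fun x => hC x⟩

lemma abs_partialD_cut_le {j : Fin d} {C : ℝ} (hC : ∀ x, |partialD j (bump d) x| ≤ C) (n : ℕ)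
    (x : EuclideanSpace ℝ (Fin d)) : |partialD j (cut n) x| ≤ (n + 1 : ℝ)⁻¹ * C := by
  rw [partialD_cut, abs_mul, abs_of_nonneg (by positivity)]
  exact mul_le_mul_of_nonneg_left (hC _) (by positivity)

/-- A compactly supported smooth function, as a bundled test function. -/
def IsTestFn.toTest (hu : S.IsTestFn ⊤ u) : 𝓓(S.Ω, ℂ) :=
  ⟨u, hu.contDiff, hu.hasCompactSupport, hu.tsupport_subset⟩

lemma IsTestFn.graphMap_toTest (hu : S.IsTestFn ⊤ u) :
    S.graphMap (S.testForm hu.toTest) = testGraph (hu.of_le le_top) :=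
  graphMap_testForm _

/-- Membership in `H1A0` controls u and its magnetic derivatives only. Nothing is known about
|V|^{1/2}φ_n, which is why a cut-off is needed for density in the form norm. -/
lemma exists_seq_test (u : S.formDomain) : ∃ φ : ℕ → 𝓓(S.Ω, ℂ),
    Tendsto (fun n => S.formEmbedding (S.testForm (φ n))) atTop (𝓝 (S.formEmbedding u)) ∧
    ∀ j, Tendsto (fun n => S.magDeriv j (S.testForm (φ n))) atTop (𝓝 (S.magDeriv j u)) := by
  have h : ∀ n : ℕ, ∃ φ : 𝓓(S.Ω, ℂ), S.normH1A (u - S.testForm φ : S.H1A) < 1 / (n + 1 : ℝ) := by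
    intro n
    obtain ⟨v, ⟨φ, hφ⟩, hv⟩ := u.2.1 (1 / (n + 1 : ℝ)) (by positivity)
    refine ⟨φ, ?_⟩
    have : v = (S.testForm φ : S.H1A) := by
      refine Subtype.ext (Lp.ext (hφ.trans ?_))
      exact (S.memLp_test φ).coeFn_toLp.symm
    rwa [← this]
  choose φ hφ using h
  have hlim := tendsto_one_div_add_atTop_nhds_zero_nat (𝕜 := ℝ)
  refine ⟨φ, ?_, fun j => ?_⟩
  · rw [tendsto_iff_norm_sub_tendsto_zero]
    refine squeeze_zero (fun _ => norm_nonneg _) (fun n => ?_) hlim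
    refine le_trans ?_ (hφ n).le
    rw [normH1A, norm_sub_rev]
    refine Real.le_sqrt_of_sq_le ?_
    have : 0 ≤ ∑ j, ‖S.magDeriv j (u - S.testForm (φ n) : S.H1A)‖ ^ 2 :=
      Finset.sum_nonneg fun _ _ => sq_nonneg _
    have e : S.formEmbedding u - S.formEmbedding (S.testForm (φ n)) =
      ((u - S.testForm (φ n) : S.H1A) : S.L2) := rfl
    rw [e]
    linarith
  · rw [tendsto_iff_norm_sub_tendsto_zero]
    refine squeeze_zero (fun _ => norm_nonneg _) (fun n => ?_) hlim
    refine le_trans ?_ (hφ n).le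
    rw [normH1A, norm_sub_rev, ← map_sub]
    refine Real.le_sqrt_of_sq_le ?_
    have h1 := Finset.single_le_sum (f := fun j => ‖S.magDeriv j (u - S.testForm (φ n) : S.H1A)‖ ^ 2)
      (fun _ _ => sq_nonneg _) (Finset.mem_univ j)
    have h2 : 0 ≤ ‖((u - S.testForm (φ n) : S.H1A) : S.L2)‖ ^ 2 := sq_nonneg _
    linarith

lemma toLp_testComp_coe (φ : 𝓓(S.Ω, ℂ)) (o : Option (Option (Fin d))) :
    ((isTestFn_one φ).memLp_testComp o).toLp = S.graphComp o (S.testForm φ) := by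
  have := congrArg (fun y : S.GraphSpace => y o) (graphMap_testForm φ)
  exact this.symm

/-- Test functions are dense in the variational space for the form norm. -/
lemma graphMap_mem_closure (u : S.formDomain) :
    S.graphMap u ∈ closure (Set.range fun φ => S.graphMap (S.testForm φ)) := by
  obtain ⟨φ, hφ, hφD⟩ := exists_seq_test u
  have hcut : ∀ k : ℕ, ContinuousOn (fun x => (cut k x : ℂ))
      (S.Ω : Set (EuclideanSpace ℝ (Fin d))) := fun k =>
    (Complex.continuous_ofReal.comp (contDiff_cut k).continuous).continuousOn
  have hcutB : ∀ k : ℕ, ∀ x ∈ S.Ω, ‖(cut k x : ℂ)‖ ≤ 1 := fun k x _ => by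
    rw [Complex.norm_real]; exact abs_cut_le k x
  have hcut1 : ∀ k : ℕ, ContDiffOn ℝ 1 (cut k) (S.Ω : Set (EuclideanSpace ℝ (Fin d))) := fun k =>
    ((contDiff_cut k).of_le (by exact_mod_cast le_top)).contDiffOn
  choose C hC using exists_abs_partialD_bump_le (d := d)
  have hdcut : ∀ (j : Fin d) (k : ℕ), ContinuousOn (fun x => ((partialD j (cut k) x : ℝ) : ℂ))
      (S.Ω : Set (EuclideanSpace ℝ (Fin d))) := fun j k =>
    Complex.continuous_ofReal.comp_continuousOn (S.continuousOn_partialD (hcut1 k) j)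
  have hC0 : ∀ j, 0 ≤ C j := fun j => (abs_nonneg _).trans (hC j 0)
  have hdcutB : ∀ (j : Fin d) (k : ℕ), ∀ x ∈ S.Ω, ‖((partialD j (cut k) x : ℝ) : ℂ)‖ ≤ C j := by
    intro j k x _
    rw [Complex.norm_real]
    refine (abs_partialD_cut_le (hC j) k x).trans ?_
    refine mul_le_of_le_one_left (hC0 j) (inv_le_one_of_one_le₀ ?_)
    linarith [k.cast_nonneg (α := ℝ)]
  -- These are the components of χ_k u, with χ_k the cut-off and the product rule applied formally
  -- in the last ones. Writing them directly in the ambient space avoids proving that χ_k u belongs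
  -- to the variational space.
  let y : ℕ → S.GraphSpace := fun k => WithLp.toLp 2 fun o => match o with
    | none => mulOp (hcut k) (hcutB k) (S.formEmbedding u)
    | some none => mulOp (hcut k) (hcutB k) (S.weighted u)
    | some (some j) => mulOp (hcut k) (hcutB k) (S.magDeriv j u) -
        Complex.I • mulOp (hdcut j k) (hdcutB j k) (S.formEmbedding u)
  have hy : Tendsto y atTop (𝓝 (S.graphMap u)) := by
    refine ((PiLp.continuous_toLp 2 _).tendsto _).comp (tendsto_pi_nhds.2 fun o => ?_)
    have h1 : ∀ f : S.L2, Tendsto (fun k => mulOp (hcut k) (hcutB k) f) atTop (𝓝 f) := by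
      intro f
      have := tendsto_mulOp hcut hcutB 1 (fun x => by
        have : Tendsto (fun n => (cut n x : ℂ)) atTop (𝓝 ((1 : ℝ) : ℂ)) :=
          (Complex.continuous_ofReal.tendsto 1).comp (tendsto_cut x)
        rwa [Complex.ofReal_one] at this) f
      simpa using this
    match o with
    | none => exact h1 _
    | some none => exact h1 _
    | some (some j) =>
      have h2 := tendsto_mulOp (hdcut j) (hdcutB j) 0 (fun x => by
        rw [tendsto_zero_iff_norm_tendsto_zero]
        have h3 : Tendsto (fun n : ℕ => (n + 1 : ℝ)⁻¹ * C j) atTop (𝓝 (0 * C j)) := by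
          have := tendsto_one_div_add_atTop_nhds_zero_nat (𝕜 := ℝ)
          simp only [one_div] at this
          exact this.mul_const _
        rw [zero_mul] at h3
        refine squeeze_zero (fun _ => norm_nonneg _) (fun n => ?_) h3
        rw [Complex.norm_real]
        exact abs_partialD_cut_le (hC j) n x) (S.formEmbedding u)
      have h4 := (h1 (S.magDeriv j u)).sub (h2.const_smul Complex.I)
      rw [zero_smul, smul_zero, sub_zero] at h4
      exact h4
  refine isClosed_closure.mem_of_tendsto hy (Eventually.of_forall fun k => ?_)
  -- With k fixed, V is bounded on the part of Ω where χ_k does not vanish. Multiplication by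
  -- |V|^{1/2}χ_k is then bounded on L², and convergence of φ_n in H¹_A is enough. The limit is
  -- taken in n first, then in k.
  obtain ⟨CV, hCV0, hCV⟩ := ContDiffUpToBoundary_bound S.contDiff_V (2 * (k + 1))
  have hVcut : ContinuousOn (fun x => (√‖S.V x‖ : ℂ) * (cut k x : ℂ))
      (S.Ω : Set (EuclideanSpace ℝ (Fin d))) := S.continuousOn_sqrt_V.mul (hcut k)
  have hVcutB : ∀ x ∈ S.Ω, ‖(√‖S.V x‖ : ℂ) * (cut k x : ℂ)‖ ≤ √CV := by
    intro x hx
    by_cases h0 : cut k x = 0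
    · simp [h0]
    · rw [norm_mul, Complex.norm_real, Real.norm_of_nonneg (Real.sqrt_nonneg _)]
      refine (mul_le_of_le_one_right (Real.sqrt_nonneg _) (hcutB k x hx)).trans ?_
      exact Real.sqrt_le_sqrt (hCV x hx (norm_lt_of_cut_ne_zero h0).le)
  have hT : ∀ n, S.IsTestFn ⊤ fun x => (cut k x : ℂ) * φ n x := fun n =>
    (S.isTestFn_coe (φ n)).mul (contDiff_cut k).contDiffOn
  have hlim : Tendsto (fun n => testGraph ((hT n).of_le (k := 1) le_top)) atTop (𝓝 (y k)) := by
    refine ((PiLp.continuous_toLp 2 _).tendsto _).comp (tendsto_pi_nhds.2 fun o => ?_)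
    match o with
    | none =>
      have h1 := ((mulOp (hcut k) (hcutB k)).continuous.tendsto _).comp hφ
      refine h1.congr fun n => ?_
      exact mulOp_toLp (hcut k) (hcutB k) (S.memLp_test (φ n)) _
    | some none =>
      have h1 := ((mulOp hVcut hVcutB).continuous.tendsto _).comp hφ
      have e : mulOp hVcut hVcutB (S.formEmbedding u) =
          mulOp (hcut k) (hcutB k) (S.weighted u) := by
        refine Lp.ext ((coeFn_mulOp _ _ _).trans ?_)
        filter_upwards [coeFn_mulOp (hcut k) (hcutB k) (S.weighted u), S.coeFn_weighted u]
          with x h1 h2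
        rw [h1, h2]
        simp only [formEmbedding, LinearMap.comp_apply, Submodule.subtype_apply]
        ring
      rw [e] at h1
      refine h1.congr fun n => ?_
      have hm : MemLp (fun x => (√‖S.V x‖ : ℂ) * (cut k x : ℂ) * φ n x) 2 S.vol :=
        S.memLp_mul_test hVcut (φ n)
      refine (mulOp_toLp hVcut hVcutB (S.memLp_test (φ n)) hm).trans ?_
      rw [MemLp.toLp_eq_toLp_iff]
      exact ae_of_all _ fun x => mul_assoc _ _ _
    | some (some j) =>
      have h1 := (((mulOp (hcut k) (hcutB k)).continuous.tendsto _).comp (hφD j)).sub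
        ((((mulOp (hdcut j k) (hdcutB j k)).continuous.tendsto _).comp hφ).const_smul Complex.I)
      refine h1.congr fun n => ?_
      have e1 : S.magDeriv j (S.testForm (φ n)) =
        ((isTestFn_one (φ n)).memLp_testComp (some (some j))).toLp :=
          (toLp_testComp_coe (φ n) (some (some j))).symm
      have e2 : S.formEmbedding (S.testForm (φ n)) = (S.memLp_test (φ n)).toLp := rfl
      simp only [Function.comp_apply]
      rw [e1, e2]
      have m1 : MemLp (fun x => (cut k x : ℂ) * S.testComp (φ n) (some (some j)) x) 2 S.vol :=
        (isTestFn_one (φ n)).memLp ((hcut k).mul ((isTestFn_one (φ n)).continuousOn_magD j))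
          fun x hx => by simp [testComp_eq_zero hx]
      have m2 : MemLp (fun x => ((partialD j (cut k) x : ℝ) : ℂ) * φ n x) 2 S.vol :=
        S.memLp_mul_test (hdcut j k) (φ n)
      rw [mulOp_toLp (hdcut j k) (hdcutB j k) (S.memLp_test (φ n)) m2]
      rw [mulOp_toLp (hcut k) (hcutB k) ((isTestFn_one (φ n)).memLp_testComp (some (some j))) m1,
        ← MemLp.toLp_const_smul, ← MemLp.toLp_sub, MemLp.toLp_eq_toLp_iff]
      refine ae_of_all _ fun x => ?_
      exact ((isTestFn_one (φ n)).magD_mul (hcut1 k) j x).symm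
  refine isClosed_closure.mem_of_tendsto hlim (Eventually.of_forall fun n => subset_closure ?_)
  exact ⟨(hT n).toTest, (hT n).graphMap_toTest⟩

lemma range_graphMap_eq_closure : (LinearMap.range S.graphMap : Set S.GraphSpace) =
    closure (Set.range fun φ => S.graphMap (S.testForm φ)) := by
  refine Set.Subset.antisymm ?_ fun y hy => mem_range_graphMap_of_mem_closure hy
  rintro _ ⟨u, rfl⟩
  exact graphMap_mem_closure u

/-! ### Density of smooth functions: mollification -/

/-- Mollification gives uniform convergence of the function and its first derivatives, by uniform
continuity. The compact set K is chosen before ε, so that the coefficients have one bound on all the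
supports. -/
lemma IsTestFn.exists_smooth_approx (hu : S.IsTestFn 1 u) :
    ∃ K : Set (EuclideanSpace ℝ (Fin d)), IsCompact K ∧ K ⊆ S.Ω ∧ tsupport u ⊆ K ∧
      ∀ ε > 0, ∃ w, S.IsTestFn ⊤ w ∧ tsupport w ⊆ K ∧ (∀ x, ‖w x - u x‖ ≤ ε) ∧
        ∀ j x, ‖partialD j w x - partialD j u x‖ ≤ ε := by
  obtain ⟨δ₁, hδ₁, h1⟩ := IsCompact.exists_cthickening_subset_open hu.hasCompactSupport
    S.Ω.isOpen hu.tsupport_subset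
  have hK : IsCompact (Metric.cthickening δ₁ (tsupport u)) :=
    IsCompact.cthickening hu.hasCompactSupport
  refine ⟨Metric.cthickening δ₁ (tsupport u), hK, h1, Metric.self_subset_cthickening _,
    fun ε hε => ?_⟩
  have huc : UniformContinuous u := hu.hasCompactSupport.uniformContinuous_of_continuous hu.continuous
  have hduc : UniformContinuous (fderiv ℝ u) :=
    (hu.hasCompactSupport.fderiv ℝ).uniformContinuous_of_continuous
      (hu.contDiff.continuous_fderiv (by simp))
  obtain ⟨δ₂, hδ₂, h2⟩ := Metric.uniformContinuous_iff.1 huc ε hε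
  obtain ⟨δ₃, hδ₃, h3⟩ := Metric.uniformContinuous_iff.1 hduc ε hε
  -- The radius δ₁ keeps the supports in K; δ₂ and δ₃ are moduli of continuity of u and of its
  -- derivative.
  set δ := min δ₁ (min δ₂ δ₃) with hδdef
  have hδ : 0 < δ := lt_min hδ₁ (lt_min hδ₂ hδ₃)
  let ρ : ContDiffBump (0 : EuclideanSpace ℝ (Fin d)) := ⟨δ / 2, δ, half_pos hδ, half_lt_self hδ⟩
  let w : EuclideanSpace ℝ (Fin d) → ℂ :=
    convolution (ρ.normed volume) u (ContinuousLinearMap.lsmul ℝ ℝ) volume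
  have hli : LocallyIntegrable (ρ.normed volume) volume :=
    (ρ.contDiff_normed (n := 0)).continuous.locallyIntegrable
  have hws : Function.support w ⊆ Metric.cthickening δ₁ (tsupport u) := by
    refine (support_convolution_subset _).trans ?_
    rintro _ ⟨a, ha, b, hb, rfl⟩
    rw [ρ.support_normed_eq, mem_ball_zero_iff] at ha
    refine Metric.mem_cthickening_of_dist_le _ b _ _ (subset_tsupport u hb) ?_
    simp only [dist_eq_norm]
    rw [add_sub_cancel_right]
    exact ha.le.trans (min_le_left _ _)
  have hwt : tsupport w ⊆ Metric.cthickening δ₁ (tsupport u) :=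
    closure_minimal hws Metric.isClosed_cthickening
  have hwd : ∀ j x, partialD j w x = convolution (ρ.normed volume) (partialD j u)
      (ContinuousLinearMap.lsmul ℝ ℝ) volume x := by
    intro j x
    have h := (hu.hasCompactSupport.hasFDerivAt_convolution_right
      (ContinuousLinearMap.lsmul ℝ ℝ) hli hu.contDiff x).fderiv
    rw [partialD]
    change fderiv ℝ (convolution _ _ _ _) x _ = _
    rw [h, convolution_precompR_apply _ hli (hu.hasCompactSupport.fderiv ℝ)
      (hu.contDiff.continuous_fderiv (by simp))]
    rfl
  refine ⟨w, ⟨?_, hK.of_isClosed_subset (isClosed_tsupport _) hwt, hwt.trans h1⟩, hwt,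
    fun x => ?_, fun j x => ?_⟩
  · exact ρ.hasCompactSupport_normed.contDiff_convolution_left _ ρ.contDiff_normed
      hu.continuous.locallyIntegrable
  · rw [← dist_eq_norm]
    refine ρ.dist_normed_convolution_le hu.continuous.aestronglyMeasurable fun z hz => ?_
    exact (h2 ((Metric.mem_ball.1 hz).trans_le
      ((min_le_right _ _).trans (min_le_left _ _)))).le
  · rw [← dist_eq_norm, hwd]
    refine ρ.dist_normed_convolution_le (hu.continuous_partialD j).aestronglyMeasurable
      fun z hz => ?_
    have h4 := (h3 ((Metric.mem_ball.1 hz).trans_le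
      ((min_le_right _ _).trans (min_le_right _ _)))).le
    rw [dist_eq_norm] at h4 ⊢
    have h5 := (fderiv ℝ u z - fderiv ℝ u x).le_opNorm (EuclideanSpace.single j 1)
    rw [show ‖(EuclideanSpace.single j 1 : EuclideanSpace ℝ (Fin d))‖ = 1 by simp, mul_one] at h5
    exact h5.trans h4

/-- Compactly supported `C¹` functions are limits of test functions for the form norm. -/
lemma IsTestFn.testGraph_mem_closure (hu : S.IsTestFn 1 u) :
    testGraph hu ∈ closure (Set.range fun φ => S.graphMap (S.testForm φ)) := by
  obtain ⟨K, hK, hKΩ, huK, happ⟩ := hu.exists_smooth_approx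
  -- If a function and its partial derivatives are at most ε, its form-norm density is at most ε²
  -- times this weight, which is bounded on K.
  have hcont : ContinuousOn (fun x => 1 + ‖S.V x‖ + ∑ j, (1 + ‖(S.A x j : ℂ)‖) ^ 2) K := by
    refine ((continuousOn_const.add (S.continuousOn_V.norm)).add
      (continuousOn_finsetSum _ fun j _ =>
        (continuousOn_const.add (S.continuousOn_A_apply j).norm).pow 2)).mono hKΩ
  obtain ⟨C, hC⟩ := hK.exists_bound_of_continuousOn hcont
  have hbound : ∀ (f : EuclideanSpace ℝ (Fin d) → ℂ) (hf : S.IsTestFn 1 f), tsupport f ⊆ K →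
      ∀ ε ≥ 0, (∀ x, ‖f x‖ ≤ ε) → (∀ j x, ‖partialD j f x‖ ≤ ε) →
      ‖testGraph hf‖ ^ 2 ≤ ε ^ 2 * (C * (volume K).toReal) := by
    intro f hf hfK ε hε h1 h2
    have i1 : Integrable (fun x => ‖f x‖ ^ 2) S.vol := by
      simpa using hf.integrable_mul_sq (continuousOn_const (c := (1 : ℝ)))
    have i2 : Integrable (fun x => ‖S.V x‖ * ‖f x‖ ^ 2) S.vol :=
      hf.integrable_mul_sq S.continuousOn_V.norm
    have e := integral_add (i1.add i2) hf.integrable_energyDensity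
    simp only [Pi.add_apply] at e
    rw [norm_testGraph_sq, ← integral_add i1 i2, ← e]
    have hle : ∀ x, ‖f x‖ ^ 2 + ‖S.V x‖ * ‖f x‖ ^ 2 + S.energyDensity f x ≤
        K.indicator (fun _ => ε ^ 2 * C) x := by
      intro x
      by_cases hx : x ∈ K
      · rw [Set.indicator_of_mem hx]
        have h3 := (le_abs_self _).trans (hC x hx)
        have h4 : ‖f x‖ ^ 2 ≤ ε ^ 2 := by gcongr; exact h1 x
        have h5 : S.energyDensity f x ≤ ε ^ 2 * ∑ j, (1 + ‖(S.A x j : ℂ)‖) ^ 2 := by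
          rw [energyDensity, Finset.mul_sum]
          refine Finset.sum_le_sum fun j _ => ?_
          rw [← mul_pow]
          gcongr
          rw [magD]
          refine (norm_add_le _ _).trans ?_
          rw [norm_mul, norm_mul, norm_neg, Complex.norm_I, one_mul, mul_add, mul_one, mul_comm ε]
          gcongr
          · exact h2 j x
          · exact h1 x
        have h6 : ‖S.V x‖ * ‖f x‖ ^ 2 ≤ ‖S.V x‖ * ε ^ 2 := by gcongr
        nlinarith [sq_nonneg ε]
      · have hx' : x ∉ tsupport f := fun h => hx (hfK h)
        rw [Set.indicator_of_notMem hx]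
        simp [energyDensity, image_eq_zero_of_notMem_tsupport hx',
          magD_eq_zero_of_notMem_tsupport hx']
    have i3 : Integrable (K.indicator fun _ => ε ^ 2 * C) (volume : Measure (EuclideanSpace ℝ (Fin d))) :=
      (integrable_indicator_iff hK.measurableSet).2 (integrableOn_const hK.measure_lt_top.ne)
    -- A bound over an empty K carries no sign information, hence the case distinction, and the
    -- absolute value |D| below.
    have hC0 : 0 ≤ C ∨ K = ∅ := by
      rcases K.eq_empty_or_nonempty with h | ⟨x, hx⟩
      · exact Or.inr h
      · exact Or.inl ((norm_nonneg _).trans (hC x hx))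
    refine (integral_mono ((i1.add i2).add hf.integrable_energyDensity) i3.restrict hle).trans ?_
    have hnn : 0 ≤ K.indicator fun _ => ε ^ 2 * C := by
      intro x
      rcases hC0 with h | h
      · exact Set.indicator_nonneg (fun _ _ => by positivity) x
      · simp [h]
    refine (setIntegral_le_integral i3 (ae_of_all _ hnn)).trans ?_
    rw [integral_indicator hK.measurableSet, setIntegral_const, smul_eq_mul, Measure.real]
    exact le_of_eq (by ring)
  set D := C * (volume K).toReal with hD
  refine Metric.mem_closure_iff.2 fun ε hε => ?_
  -- The `+ 1` keeps the denominator positive when D = 0 and makes the final inequality strict.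
  obtain ⟨w, hw, hwK, hw1, hw2⟩ := happ (ε / (√|D| + 1)) (by positivity)
  refine ⟨S.graphMap (S.testForm hw.toTest), ⟨_, rfl⟩, ?_⟩
  have hw' : S.IsTestFn 1 w := hw.of_le le_top
  have hdiff : S.IsTestFn 1 fun y => (-1 : ℂ) * u y + w y := hu.linear (-1) hw'
  rw [hw.graphMap_toTest, dist_comm, dist_eq_norm]
  have e : testGraph hw' - testGraph hu = testGraph hdiff := by
    rw [testGraph_linear (-1) hu hw']; simp [sub_eq_neg_add]
  rw [e]
  have hpd : ∀ j x, partialD j (fun y => (-1 : ℂ) * u y + w y) x =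
      partialD j w x - partialD j u x := by
    intro j x
    simp only [partialD]
    rw [fderiv_fun_add ((hu.differentiable x).const_mul _) (hw'.differentiable x),
      fderiv_const_mul (hu.differentiable x)]
    simp
    ring
  have hsupp : tsupport (fun y => (-1 : ℂ) * u y + w y) ⊆ K := by
    refine closure_minimal (fun y hy => by_contra fun h => hy ?_) hK.isClosed
    simp [image_eq_zero_of_notMem_tsupport fun h' => h (huK h'),
      image_eq_zero_of_notMem_tsupport fun h' => h (hwK h')]
  have h := hbound _ hdiff hsupp (ε / (√|D| + 1)) (by positivity)
    (fun x => by
      have := hw1 x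
      rwa [show (-1 : ℂ) * u x + w x = w x - u x by ring])
    (fun j x => by rw [hpd]; exact hw2 j x)
  have h0 : ‖testGraph hdiff‖ ^ 2 < ε ^ 2 := by
    refine h.trans_lt ?_
    rw [div_pow, div_mul_eq_mul_div, div_lt_iff₀ (by positivity)]
    have h1 : D ≤ √|D| ^ 2 := by rw [Real.sq_sqrt (abs_nonneg _)]; exact le_abs_self _
    have h2 : 0 ≤ √|D| := Real.sqrt_nonneg _
    have h3 : 0 < ε ^ 2 := by positivity
    nlinarith
  exact lt_of_pow_lt_pow_left₀ 2 hε.le h0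

end ElectromagneticSystem

/-! ### A Poincaré inequality on convex sets -/

section Poincare

variable {E : Type*} [NormedAddCommGroup E] [NormedSpace ℝ E] [FiniteDimensional ℝ E]
  [MeasurableSpace E] [BorelSpace E] (μ : Measure E) [μ.IsAddHaarMeasure]

lemma lintegral_comp_add_smul {h : E → ENNReal} (hh : Measurable h) (a : E) {t : ℝ} (ht : t ≠ 0) :
    ∫⁻ y, h (a + t • y) ∂μ =
      ENNReal.ofReal |(t ^ Module.finrank ℝ E)⁻¹| * ∫⁻ y, h y ∂μ := by
  have h1 : ∫⁻ z, h (a + z) ∂(Measure.map (t • ·) μ) = ∫⁻ y, h (a + t • y) ∂μ :=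
    lintegral_map (hh.comp (measurable_const_add a)) (measurable_const_smul t)
  rw [← h1, Measure.map_addHaar_smul μ ht, lintegral_smul_measure, lintegral_add_left_eq_self]
  rfl

/-- By convexity y ↦ x + t(y - x) maps Q into itself, and its Jacobian factor t⁻ⁿ is at most 2ⁿ for
t ≥ 1/2, where n is the dimension. -/
lemma lintegral_segment_le {Q : Set E} (hQ : MeasurableSet Q) (hconv : Convex ℝ Q)
    {g : E → ENNReal} (hg : Measurable g) {t : ℝ} (ht : 1 / 2 ≤ t) (ht1 : t ≤ 1) {x : E}
    (hx : x ∈ Q) :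
    ∫⁻ y in Q, g (x + t • (y - x)) ∂μ ≤
      ENNReal.ofReal (2 ^ Module.finrank ℝ E) * ∫⁻ y in Q, g y ∂μ := by
  have ht0 : 0 < t := by linarith
  calc ∫⁻ y in Q, g (x + t • (y - x)) ∂μ
      ≤ ∫⁻ y in Q, Q.indicator g (x + t • (y - x)) ∂μ := by
        refine setLIntegral_mono' hQ fun y hy => ?_
        rw [Set.indicator_of_mem (hconv.add_smul_sub_mem hx hy ⟨ht0.le, ht1⟩)]
    _ ≤ ∫⁻ y, Q.indicator g ((x - t • x) + t • y) ∂μ := by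
        refine (setLIntegral_le_lintegral _ _).trans (le_of_eq ?_)
        refine lintegral_congr fun y => ?_
        congr 1
        rw [smul_sub]; abel
    _ ≤ _ := by
        rw [lintegral_comp_add_smul μ (hg.indicator hQ) _ ht0.ne', lintegral_indicator hQ]
        gcongr
        rw [abs_of_pos (by positivity), ← inv_pow]
        gcongr
        rw [inv_le_comm₀ ht0 two_pos]
        linarith

/-- The variance ∫(f - c)² about the mean c is nonnegative. -/
lemma sq_integral_le_integral_sq {f : ℝ → ℝ} (hf : Continuous f) :
    (∫ t in (0 : ℝ)..1, f t) ^ 2 ≤ ∫ t in (0 : ℝ)..1, f t ^ 2 := by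
  set c := ∫ t in (0 : ℝ)..1, f t with hc
  have h0 : 0 ≤ ∫ t in (0 : ℝ)..1, (f t - c) ^ 2 :=
    intervalIntegral.integral_nonneg zero_le_one fun _ _ => sq_nonneg _
  have e : ∀ t, (f t - c) ^ 2 = f t ^ 2 - 2 * c * f t + c ^ 2 := fun t => by ring
  simp_rw [e] at h0
  rw [intervalIntegral.integral_add, intervalIntegral.integral_sub,
    intervalIntegral.integral_const_mul, ← hc, intervalIntegral.integral_const] at h0
  · simp at h0
    nlinarith
  all_goals exact Continuous.intervalIntegrable (by fun_prop) _ _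

omit [FiniteDimensional ℝ E] [MeasurableSpace E] [BorelSpace E] in
lemma norm_sub_sq_le_integral {u : E → ℂ} (hu : ContDiff ℝ 1 u) (x y : E) :
    ‖u x - u y‖ ^ 2 ≤ ‖x - y‖ ^ 2 * ∫ t in (0 : ℝ)..1, ‖fderiv ℝ u (x + t • (y - x))‖ ^ 2 := by
  have hd : Continuous (fderiv ℝ u) := hu.continuous_fderiv (by simp)
  have hline : ∀ t : ℝ, HasDerivAt (fun t : ℝ => x + t • (y - x)) (y - x) t := fun t => by
    simpa using ((hasDerivAt_id t).smul_const (y - x)).const_add x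
  have hderiv : ∀ t : ℝ, HasDerivAt (fun t : ℝ => u (x + t • (y - x)))
      (fderiv ℝ u (x + t • (y - x)) (y - x)) t := fun t =>
    ((hu.differentiable (by simp) _).hasFDerivAt).comp_hasDerivAt t (hline t)
  have hint : ∫ t in (0 : ℝ)..1, fderiv ℝ u (x + t • (y - x)) (y - x) = u y - u x := by
    rw [intervalIntegral.integral_eq_sub_of_hasDerivAt (fun t _ => hderiv t)
      (Continuous.intervalIntegrable (by fun_prop) _ _)]
    simp
  have h1 : ‖u y - u x‖ ≤ ∫ t in (0 : ℝ)..1, ‖fderiv ℝ u (x + t • (y - x)) (y - x)‖ := by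
    rw [← hint]
    exact intervalIntegral.norm_integral_le_integral_norm zero_le_one
  have h2 : ∫ t in (0 : ℝ)..1, ‖fderiv ℝ u (x + t • (y - x)) (y - x)‖ ≤
      ∫ t in (0 : ℝ)..1, ‖fderiv ℝ u (x + t • (y - x))‖ * ‖x - y‖ := by
    refine intervalIntegral.integral_mono_on zero_le_one
      (Continuous.intervalIntegrable (by fun_prop) _ _)
      (Continuous.intervalIntegrable (by fun_prop) _ _) fun t _ => ?_
    rw [norm_sub_rev x y]
    exact ContinuousLinearMap.le_opNorm _ _
  rw [intervalIntegral.integral_mul_const] at h2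
  have h3 := sq_integral_le_integral_sq
    (f := fun t : ℝ => ‖fderiv ℝ u (x + t • (y - x))‖) (by fun_prop)
  rw [norm_sub_rev]
  calc ‖u y - u x‖ ^ 2
      ≤ ((∫ t in (0 : ℝ)..1, ‖fderiv ℝ u (x + t • (y - x))‖) * ‖x - y‖) ^ 2 := by
        gcongr; exact h1.trans h2
    _ = ‖x - y‖ ^ 2 * (∫ t in (0 : ℝ)..1, ‖fderiv ℝ u (x + t • (y - x))‖) ^ 2 := by ring
    _ ≤ _ := by gcongr

omit [FiniteDimensional ℝ E] [MeasurableSpace E] [BorelSpace E] in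
lemma enorm_sub_sq_le_lintegral {u : E → ℂ} (hu : ContDiff ℝ 1 u) (x y : E) :
    ENNReal.ofReal (‖u x - u y‖ ^ 2) ≤ ENNReal.ofReal (‖x - y‖ ^ 2) *
      ∫⁻ t in Set.Ioc (0 : ℝ) 1, ENNReal.ofReal (‖fderiv ℝ u (x + t • (y - x))‖ ^ 2) := by
  have hd : Continuous (fderiv ℝ u) := hu.continuous_fderiv (by simp)
  have hc : Continuous fun t : ℝ => ‖fderiv ℝ u (x + t • (y - x))‖ ^ 2 := by fun_prop
  have hi : Integrable (fun t : ℝ => ‖fderiv ℝ u (x + t • (y - x))‖ ^ 2)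
      (volume.restrict (Set.Ioc (0 : ℝ) 1)) :=
    (intervalIntegrable_iff_integrableOn_Ioc_of_le zero_le_one).1 (hc.intervalIntegrable 0 1)
  rw [← ofReal_integral_eq_lintegral_ofReal hi (ae_of_all _ fun _ => sq_nonneg _),
    ← ENNReal.ofReal_mul (sq_nonneg _), ← intervalIntegral.integral_of_le zero_le_one]
  exact ENNReal.ofReal_le_ofReal (norm_sub_sq_le_integral hu x y)

/-- Write u(x) - u(y) as an integral of the gradient along the segment, and exchange the integrals
so that t is outermost. For each t the double integral of the gradient is then bounded by a change
of variables. -/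
lemma lintegral_lintegral_sub_le {Q : Set E} (hQ : MeasurableSet Q) (hconv : Convex ℝ Q)
    (hfin : μ Q ≠ ⊤) {δ : ℝ} (hδ : ∀ x ∈ Q, ∀ y ∈ Q, ‖x - y‖ ≤ δ) {u : E → ℂ}
    (hu : ContDiff ℝ 1 u) :
    ∫⁻ x in Q, ∫⁻ y in Q, ENNReal.ofReal (‖u x - u y‖ ^ 2) ∂μ ∂μ ≤
      ENNReal.ofReal (δ ^ 2 * 2 ^ Module.finrank ℝ E) * μ Q *
        ∫⁻ x in Q, ENNReal.ofReal (‖fderiv ℝ u x‖ ^ 2) ∂μ := by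
  have hd : Continuous (fderiv ℝ u) := hu.continuous_fderiv (by simp)
  set g : E → ENNReal := fun x => ENNReal.ofReal (‖fderiv ℝ u x‖ ^ 2) with hgdef
  have hgc : Continuous g := ENNReal.continuous_ofReal.comp (hd.norm.pow 2)
  have hg : Measurable g := hgc.measurable
  have : IsFiniteMeasure (μ.restrict Q) := ⟨by simpa using hfin.lt_top⟩
  set G := ENNReal.ofReal (2 ^ Module.finrank ℝ E) * ∫⁻ y in Q, g y ∂μ with hG
  have hmem : ∀ᵐ x ∂(μ.restrict Q), x ∈ Q := ae_restrict_mem hQ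
  have hslice : ∀ t ∈ Set.Ioc (0 : ℝ) 1,
      ∫⁻ x in Q, ∫⁻ y in Q, g (x + t • (y - x)) ∂μ ∂μ ≤ G * μ Q := by
    have hhalf : ∀ t : ℝ, 1 / 2 ≤ t → t ≤ 1 →
        ∫⁻ x in Q, ∫⁻ y in Q, g (x + t • (y - x)) ∂μ ∂μ ≤ G * μ Q := by
      intro t h1 h2
      refine (setLIntegral_mono' hQ fun x hx =>
        lintegral_segment_le μ hQ hconv hg h1 h2 hx).trans ?_
      rw [setLIntegral_const]
    rintro t ⟨h0, h1⟩
    by_cases ht : 1 / 2 ≤ t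
    · exact hhalf t ht h1
    -- For t < 1/2 the Jacobian in y would blow up. Exchanging the roles of x and y replaces t by 1
    -- - t, which is at least 1/2.
    · have hm : Measurable (Function.uncurry fun x y : E => g (x + t • (y - x))) := by
        have : Continuous (Function.uncurry fun x y : E => g (x + t • (y - x))) :=
          hgc.comp (by fun_prop)
        exact this.measurable
      rw [lintegral_lintegral_swap hm.aemeasurable]
      refine le_trans (le_of_eq ?_) (hhalf (1 - t) (by linarith) (by linarith))
      refine lintegral_congr fun y => lintegral_congr fun x => ?_
      congr 1
      rw [sub_smul, one_smul, smul_sub, smul_sub]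
      abel
  have hm2 : ∀ x, Measurable (Function.uncurry fun (y : E) (t : ℝ) => g (x + t • (y - x))) :=
    fun x => by
      have : Continuous (Function.uncurry fun (y : E) (t : ℝ) => g (x + t • (y - x))) :=
        hgc.comp (by fun_prop)
      exact this.measurable
  have hm3 : Measurable fun p : (E × ℝ) × E => g (p.1.1 + p.1.2 • (p.2 - p.1.1)) := by
    have : Continuous fun p : (E × ℝ) × E => g (p.1.1 + p.1.2 • (p.2 - p.1.1)) :=
      hgc.comp (by fun_prop)
    exact this.measurable
  calc ∫⁻ x in Q, ∫⁻ y in Q, ENNReal.ofReal (‖u x - u y‖ ^ 2) ∂μ ∂μ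
      ≤ ∫⁻ x in Q, (∫⁻ y in Q, (ENNReal.ofReal (δ ^ 2) *
          ∫⁻ t in Set.Ioc (0 : ℝ) 1, g (x + t • (y - x))) ∂μ) ∂μ := by
        refine setLIntegral_mono' hQ fun x hx => setLIntegral_mono' hQ fun y hy => ?_
        refine (enorm_sub_sq_le_lintegral hu x y).trans ?_
        gcongr
        exact hδ x hx y hy
    _ = ENNReal.ofReal (δ ^ 2) * ∫⁻ x in Q, (∫⁻ y in Q,
          (∫⁻ t in Set.Ioc (0 : ℝ) 1, g (x + t • (y - x))) ∂μ) ∂μ := by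
        rw [← lintegral_const_mul' _ _ ENNReal.ofReal_ne_top]
        refine lintegral_congr fun x => ?_
        rw [← lintegral_const_mul' _ _ ENNReal.ofReal_ne_top]
    _ = ENNReal.ofReal (δ ^ 2) * ∫⁻ t in Set.Ioc (0 : ℝ) 1, (∫⁻ x in Q, (∫⁻ y in Q,
          g (x + t • (y - x)) ∂μ) ∂μ) := by
        congr 1
        exact (lintegral_congr fun x => lintegral_lintegral_swap (hm2 x).aemeasurable).trans
          (lintegral_lintegral_swap (Measurable.lintegral_prod_right' hm3).aemeasurable)
    _ ≤ ENNReal.ofReal (δ ^ 2) * ∫⁻ _ in Set.Ioc (0 : ℝ) 1, G * μ Q := by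
        exact mul_le_mul' le_rfl (setLIntegral_mono' measurableSet_Ioc hslice)
    _ = _ := by
        rw [setLIntegral_const, Real.volume_Ioc, hG, ENNReal.ofReal_mul (sq_nonneg _)]
        simp only [sub_zero, ENNReal.ofReal_one, mul_one]
        ring

-- Expanding the square turns the double integral into a variance; this is how the mean of u enters
-- Poincaré's inequality.
omit [NormedAddCommGroup E] [NormedSpace ℝ E] [FiniteDimensional ℝ E] [BorelSpace E]
  [μ.IsAddHaarMeasure] in
lemma integral_integral_sub_sq {Q : Set E} (hfin : μ Q ≠ ⊤) {u : E → ℂ}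
    (i0 : Integrable u (μ.restrict Q)) (i1 : Integrable (fun x => ‖u x‖ ^ 2) (μ.restrict Q)) :
    (∀ x, Integrable (fun y => ‖u x - u y‖ ^ 2) (μ.restrict Q)) ∧
    Integrable (fun x => ∫ y in Q, ‖u x - u y‖ ^ 2 ∂μ) (μ.restrict Q) ∧
    ∫ x in Q, ∫ y in Q, ‖u x - u y‖ ^ 2 ∂μ ∂μ =
      2 * μ.real Q * ∫ x in Q, ‖u x‖ ^ 2 ∂μ - 2 * ‖∫ x in Q, u x ∂μ‖ ^ 2 := by
  have : IsFiniteMeasure (μ.restrict Q) := ⟨by simpa using hfin.lt_top⟩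
  set N := ∫ x in Q, ‖u x‖ ^ 2 ∂μ with hN
  set U := ∫ x in Q, u x ∂μ with hU
  set q := μ.real Q with hq
  have e1 : ∀ x y, ‖u x - u y‖ ^ 2 = ‖u x‖ ^ 2 - 2 * inner ℝ (u x) (u y) + ‖u y‖ ^ 2 :=
    fun x y => norm_sub_sq_real _ _
  have j2 : ∀ x, Integrable (fun y => 2 * inner ℝ (u x) (u y)) (μ.restrict Q) := fun x =>
    (i0.const_inner (u x)).const_mul 2
  have j1 : ∀ x, Integrable (fun _ : E => ‖u x‖ ^ 2) (μ.restrict Q) := fun x => integrable_const _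
  have e2 : ∀ x, ∫ y in Q, ‖u x - u y‖ ^ 2 ∂μ = q * ‖u x‖ ^ 2 - 2 * inner ℝ (u x) U + N := by
    intro x
    have j12 : Integrable (fun y => ‖u x‖ ^ 2 - 2 * inner ℝ (u x) (u y)) (μ.restrict Q) :=
      (j1 x).sub (j2 x)
    simp only [e1]
    rw [integral_add j12 i1, integral_sub (j1 x) (j2 x), integral_const_mul,
      integral_inner i0, setIntegral_const, smul_eq_mul]
  have j4 : Integrable (fun x => 2 * inner ℝ (u x) U) (μ.restrict Q) :=
    (i0.inner_const U).const_mul 2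
  have j5 : Integrable (fun x => q * ‖u x‖ ^ 2 - 2 * inner ℝ (u x) U) (μ.restrict Q) :=
    (i1.const_mul q).sub j4
  have j3 : Integrable (fun x => q * ‖u x‖ ^ 2 - 2 * inner ℝ (u x) U + N) (μ.restrict Q) :=
    j5.add (integrable_const _)
  refine ⟨fun x => ?_, ?_, ?_⟩
  · simp only [e1]
    exact ((j1 x).sub (j2 x)).add i1
  · simp only [e2]
    exact j3
  · simp only [e2]
    have e4 : ∫ x in Q, inner ℝ (u x) U ∂μ = ‖U‖ ^ 2 := by
      have : ∀ x, inner ℝ (u x) U = inner ℝ U (u x) := fun x => real_inner_comm _ _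
      simp only [this]
      rw [integral_inner i0, ← hU, real_inner_self_eq_norm_sq]
    rw [integral_add j5 (integrable_const _),
      integral_sub (i1.const_mul q) j4, integral_const_mul, integral_const_mul, e4,
      setIntegral_const, smul_eq_mul]
    ring

/-- Poincaré inequality on a convex set for a compactly supported function. -/
theorem poincare_convex {Q : Set E} (hQ : MeasurableSet Q) (hconv : Convex ℝ Q)
    (hfin : μ Q ≠ ⊤) {δ : ℝ} (hδ : ∀ x ∈ Q, ∀ y ∈ Q, ‖x - y‖ ≤ δ) {u : E → ℂ}
    (hu : ContDiff ℝ 1 u) (hc : HasCompactSupport u) :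
    ∫ x in Q, ‖u x‖ ^ 2 ∂μ ≤ δ ^ 2 * 2 ^ Module.finrank ℝ E * ∫ x in Q, ‖fderiv ℝ u x‖ ^ 2 ∂μ +
      ‖((√(μ.real Q))⁻¹ : ℝ) • ∫ x in Q, u x ∂μ‖ ^ 2 := by
  have hd : Continuous (fderiv ℝ u) := hu.continuous_fderiv (by simp)
  have i0 : Integrable u (μ.restrict Q) :=
    (hu.continuous.integrable_of_hasCompactSupport hc).restrict
  have c1 : HasCompactSupport fun x => ‖u x‖ ^ 2 := hc.mono fun x hx hx0 => hx (by simp [hx0])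
  have c2 : HasCompactSupport fun x => ‖fderiv ℝ u x‖ ^ 2 :=
    (hc.fderiv ℝ).mono fun x hx hx0 => hx (by simp [hx0])
  have i1 : Integrable (fun x => ‖u x‖ ^ 2) (μ.restrict Q) :=
    ((hu.continuous.norm.pow 2).integrable_of_hasCompactSupport c1).restrict
  have i2 : Integrable (fun x => ‖fderiv ℝ u x‖ ^ 2) (μ.restrict Q) :=
    ((hd.norm.pow 2).integrable_of_hasCompactSupport c2).restrict
  obtain ⟨k1, k2, k3⟩ := integral_integral_sub_sq μ hfin i0 i1
  have hmain := lintegral_lintegral_sub_le μ hQ hconv hfin hδ hu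
  have e5 : ∫⁻ x in Q, ∫⁻ y in Q, ENNReal.ofReal (‖u x - u y‖ ^ 2) ∂μ ∂μ =
      ENNReal.ofReal (∫ x in Q, ∫ y in Q, ‖u x - u y‖ ^ 2 ∂μ ∂μ) := by
    rw [ofReal_integral_eq_lintegral_ofReal k2
      (ae_of_all _ fun _ => integral_nonneg fun _ => sq_nonneg _)]
    exact lintegral_congr fun x =>
      (ofReal_integral_eq_lintegral_ofReal (k1 x) (ae_of_all _ fun _ => sq_nonneg _)).symm
  have e6 : ∫⁻ x in Q, ENNReal.ofReal (‖fderiv ℝ u x‖ ^ 2) ∂μ =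
      ENNReal.ofReal (∫ x in Q, ‖fderiv ℝ u x‖ ^ 2 ∂μ) :=
    (ofReal_integral_eq_lintegral_ofReal i2 (ae_of_all _ fun _ => sq_nonneg _)).symm
  have e7 : μ Q = ENNReal.ofReal (μ.real Q) := (ENNReal.ofReal_toReal hfin).symm
  have hD0 : 0 ≤ ∫ x in Q, ‖fderiv ℝ u x‖ ^ 2 ∂μ := integral_nonneg fun _ => sq_nonneg _
  set D := ∫ x in Q, ‖fderiv ℝ u x‖ ^ 2 ∂μ with hD
  have hq0 : 0 ≤ μ.real Q := measureReal_nonneg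
  rw [e5, k3, e6, e7, ← ENNReal.ofReal_mul (by positivity),
    ← ENNReal.ofReal_mul (by positivity), ENNReal.ofReal_le_ofReal_iff (by positivity)] at hmain
  -- A null cell is treated apart because the average divides by the measure. Otherwise the double
  -- integral inequality is divided by 2μ(Q), and the resulting factor 1/2 on the gradient is
  -- discarded.
  rcases hq0.eq_or_lt with h | h
  · have hz : μ.restrict Q = 0 := by
      rw [Measure.restrict_eq_zero]
      exact (measureReal_eq_zero_iff hfin).1 h.symm
    rw [hz, integral_zero_measure]
    positivity
  · set N := ∫ x in Q, ‖u x‖ ^ 2 ∂μ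
    set U := ∫ x in Q, u x ∂μ
    set q := μ.real Q
    set c := δ ^ 2 * 2 ^ Module.finrank ℝ E with hcdef
    have hc0 : 0 ≤ c := by positivity
    rw [norm_smul, mul_pow, Real.norm_of_nonneg (by positivity), inv_pow, Real.sq_sqrt hq0]
    rw [← mul_le_mul_iff_right₀ h, mul_add, ← mul_assoc q q⁻¹, mul_inv_cancel₀ h.ne', one_mul]
    have : 0 ≤ c * q * D := by positivity
    nlinarith

end Poincare

namespace ElectromagneticSystem

variable {d : ℕ} {S : ElectromagneticSystem d}
variable {u : EuclideanSpace ℝ (Fin d) → ℂ}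

/-! ### Compactness of the embedding -/

/-- A ball is a finite disjoint union of small convex sets. -/
lemma exists_convex_partition (R : ℝ) {δ : ℝ} (hδ : 0 < δ) :
    ∃ (F : Finset (Fin d → ℤ)) (Q : (Fin d → ℤ) → Set (EuclideanSpace ℝ (Fin d))),
      (∀ k, MeasurableSet (Q k)) ∧ (∀ k, Convex ℝ (Q k)) ∧
      (∀ k, ∀ x ∈ Q k, ∀ y ∈ Q k, ‖x - y‖ ≤ δ) ∧ Pairwise (Function.onFun Disjoint Q) ∧
      ⋃ k ∈ F, Q k = Metric.closedBall 0 R := by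
  -- A cube of side s has diameter at most s√d ≤ δ. The `+ 1` also avoids dividing by zero.
  set s : ℝ := δ / (d + 1) with hs
  have hs0 : 0 < s := by positivity
  let Q : (Fin d → ℤ) → Set (EuclideanSpace ℝ (Fin d)) := fun k =>
    Metric.closedBall 0 R ∩ ⋂ i, {x | ⌊x i / s⌋ = k i}
  have hQ : ∀ k x, x ∈ Q k ↔ ‖x‖ ≤ R ∧ ∀ i, ⌊x i / s⌋ = k i := fun k x => by
    simp [Q]
  refine ⟨Fintype.piFinset fun _ => Finset.Icc ⌊-R / s⌋ ⌊R / s⌋, Q, fun k => ?_, fun k => ?_,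
    fun k x hx y hy => ?_, fun k l hkl => ?_, ?_⟩
  · refine Metric.isClosed_closedBall.measurableSet.inter (MeasurableSet.iInter fun i => ?_)
    have hm : Measurable fun x : EuclideanSpace ℝ (Fin d) => ⌊x i / s⌋ := by
      have : Measurable fun x : EuclideanSpace ℝ (Fin d) => x i / s := by
        have : Continuous fun x : EuclideanSpace ℝ (Fin d) => x i / s := by fun_prop
        exact this.measurable
      exact this.floor
    exact hm (measurableSet_singleton (k i))
  · refine (convex_closedBall 0 R).inter (convex_iInter fun i => ?_)
    have e : {x : EuclideanSpace ℝ (Fin d) | ⌊x i / s⌋ = k i} =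
        (EuclideanSpace.proj (𝕜 := ℝ) i).toLinearMap ⁻¹'
          Set.Ico (s * (k i : ℝ)) (s * ((k i : ℝ) + 1)) := by
      ext x
      simp only [Set.mem_ofPred_eq, Int.floor_eq_iff, Set.mem_preimage, Set.mem_Ico]
      rw [le_div_iff₀ hs0, div_lt_iff₀ hs0, mul_comm s, mul_comm s]
      rfl
    rw [e]
    exact (convex_Ico _ _).linear_preimage _
  · have h1 : ∀ i, (x i - y i) ^ 2 ≤ s ^ 2 := by
      intro i
      have hxi := Int.floor_eq_iff.1 (((hQ k x).1 hx).2 i)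
      have hyi := Int.floor_eq_iff.1 (((hQ k y).1 hy).2 i)
      rw [le_div_iff₀ hs0, div_lt_iff₀ hs0] at hxi hyi
      rw [← sq_abs]
      refine pow_le_pow_left₀ (abs_nonneg _) (abs_le.2 ⟨?_, ?_⟩) 2 <;> nlinarith
    have h2 : ‖x - y‖ ^ 2 ≤ δ ^ 2 := by
      rw [EuclideanSpace.norm_sq_eq]
      simp only [PiLp.sub_apply, Real.norm_eq_abs, sq_abs]
      refine (Finset.sum_le_sum fun i _ => h1 i).trans ?_
      rw [Finset.sum_const, Finset.card_univ, Fintype.card_fin, nsmul_eq_mul, hs, div_pow,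
        ← mul_div_assoc, div_le_iff₀ (by positivity)]
      have h3 : (0 : ℝ) ≤ d := d.cast_nonneg
      nlinarith [sq_nonneg δ, mul_nonneg (sq_nonneg δ) h3]
    exact (abs_le_of_sq_le_sq' h2 hδ.le).2
  · refine Set.disjoint_left.2 fun x hx hy => hkl (funext fun i => ?_)
    rw [← ((hQ k x).1 hx).2 i, ← ((hQ l x).1 hy).2 i]
  · ext x
    simp only [Set.mem_iUnion, exists_prop, hQ, mem_closedBall_zero_iff]
    refine ⟨fun ⟨k, _, h, _⟩ => h, fun h => ⟨fun i => ⌊x i / s⌋, ?_, h, fun _ => rfl⟩⟩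
    refine Fintype.mem_piFinset.2 fun i => Finset.mem_Icc.2 ?_
    have hxi := abs_le.1 ((PiLp.norm_apply_le x i).trans h)
    exact ⟨Int.floor_mono (by gcongr; exact hxi.1), Int.floor_mono (by gcongr; exact hxi.2)⟩

lemma norm_fderiv_sq_le (x : EuclideanSpace ℝ (Fin d)) :
    ‖fderiv ℝ u x‖ ^ 2 ≤ ∑ j, ‖partialD j u x‖ ^ 2 := by
  have h : ‖fderiv ℝ u x‖ ≤ √(∑ j, ‖partialD j u x‖ ^ 2) := by
    refine ContinuousLinearMap.opNorm_le_bound _ (Real.sqrt_nonneg _) fun v => ?_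
    have hv : v = ∑ j, v j • EuclideanSpace.single j (1 : ℝ) := by
      have := (EuclideanSpace.basisFun (Fin d) ℝ).sum_repr v
      simpa using this.symm
    have e : fderiv ℝ u x v = ∑ j, v j • partialD j u x := by
      conv_lhs => rw [hv]
      rw [map_sum]
      simp only [map_smul, partialD]
    rw [e, EuclideanSpace.norm_eq, mul_comm]
    refine (norm_sum_le _ _).trans ?_
    simp only [norm_smul]
    exact Real.sum_mul_le_sqrt_mul_sqrt _ _ _
  calc ‖fderiv ℝ u x‖ ^ 2 ≤ √(∑ j, ‖partialD j u x‖ ^ 2) ^ 2 := by gcongr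
    _ = _ := Real.sq_sqrt (Finset.sum_nonneg fun _ _ => sq_nonneg _)

/-- Since ∂_ju = i(D_ju - A_ju), the ordinary gradient is controlled by the magnetic one wherever A
is bounded, at the cost of an L² term. -/
lemma sum_norm_partialD_sq_le (x : EuclideanSpace ℝ (Fin d)) :
    ∑ j, ‖partialD j u x‖ ^ 2 ≤ 2 * S.energyDensity u x + 2 * ‖S.A x‖ ^ 2 * ‖u x‖ ^ 2 := by
  rw [EuclideanSpace.norm_sq_eq, energyDensity, Finset.mul_sum, Finset.mul_sum, Finset.sum_mul,
    ← Finset.sum_add_distrib]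
  refine Finset.sum_le_sum fun j _ => ?_
  have e : partialD j u x = Complex.I * (S.magD j u x - (S.A x j : ℂ) * u x) := by
    rw [magD]
    linear_combination (partialD j u x) * Complex.I_mul_I
  rw [e, norm_mul, Complex.norm_I, one_mul]
  have h1 := norm_sub_le (S.magD j u x) ((S.A x j : ℂ) * u x)
  rw [norm_mul, Complex.norm_real] at h1
  have h2 := pow_le_pow_left₀ (norm_nonneg _) h1 2
  nlinarith [sq_nonneg (‖S.magD j u x‖ - ‖S.A x j‖ * ‖u x‖)]

/-- Passes between Lebesgue measure, for which Poincaré's inequality holds on full cells, and its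
restriction to Ω. Functions supported in Ω are extended by zero, so cells crossing ∂Ω need no
special care. -/
lemma setIntegral_vol_eq {F : Type*} [NormedAddCommGroup F] [NormedSpace ℝ F]
    {Q : Set (EuclideanSpace ℝ (Fin d))} (hQ : MeasurableSet Q)
    {f : EuclideanSpace ℝ (Fin d) → F} (hf : ∀ x ∉ S.Ω, f x = 0) :
    ∫ x in Q, f x = ∫ x in Q, f x ∂S.vol := by
  rw [Measure.restrict_restrict hQ]
  refine setIntegral_eq_of_subset_of_forall_sdiff_eq_zero hQ Set.inter_subset_left fun x hx => ?_
  exact hf x fun h => hx.2 ⟨hx.1, h⟩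

/-- On bounded sets, the `L²` norm is controlled by the form norm and finitely many averages. -/
lemma IsTestFn.setIntegral_ball_le (hu : S.IsTestFn 1 u) {R δ C : ℝ}
    (hC : ∀ x ∈ S.Ω, ‖x‖ ≤ R → ‖S.A x‖ ≤ C)
    {F : Finset (Fin d → ℤ)} {Q : (Fin d → ℤ) → Set (EuclideanSpace ℝ (Fin d))}
    (hQm : ∀ k, MeasurableSet (Q k)) (hQc : ∀ k, Convex ℝ (Q k))
    (hQd : ∀ k, ∀ x ∈ Q k, ∀ y ∈ Q k, ‖x - y‖ ≤ δ) (hdis : Pairwise (Function.onFun Disjoint Q))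
    (hF : ⋃ k ∈ F, Q k = Metric.closedBall 0 R) :
    ∫ x in Metric.closedBall 0 R, ‖u x‖ ^ 2 ∂S.vol ≤
      δ ^ 2 * 2 ^ d * (2 * ∫ x, S.energyDensity u x ∂S.vol + 2 * C ^ 2 * ∫ x, ‖u x‖ ^ 2 ∂S.vol) +
      ∑ k ∈ F, ‖((√(volume.real (Q k)))⁻¹ : ℝ) • ∫ x in Q k, u x ∂S.vol‖ ^ 2 := by
  have hu0 : ∀ x ∉ S.Ω, x ∉ tsupport u := fun x hx h => hx (hu.tsupport_subset h)
  have hz : ∀ x ∉ S.Ω, u x = 0 := fun x hx => image_eq_zero_of_notMem_tsupport (hu0 x hx)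
  have hzd : ∀ x ∉ S.Ω, fderiv ℝ u x = 0 := fun x hx => by
    by_contra h
    exact hu0 x hx (support_fderiv_subset ℝ h)
  have hd : Continuous (fderiv ℝ u) := hu.contDiff.continuous_fderiv (by simp)
  have c1 : HasCompactSupport fun x => ‖u x‖ ^ 2 :=
    hu.hasCompactSupport.mono fun x hx hx0 => hx (by simp [hx0])
  have c2 : HasCompactSupport fun x => ‖fderiv ℝ u x‖ ^ 2 :=
    (hu.hasCompactSupport.fderiv ℝ).mono fun x hx hx0 => hx (by simp [hx0])
  have i1 : Integrable (fun x => ‖u x‖ ^ 2) volume :=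
    (hu.continuous.norm.pow 2).integrable_of_hasCompactSupport c1
  have i2 : Integrable (fun x => ‖fderiv ℝ u x‖ ^ 2) volume :=
    (hd.norm.pow 2).integrable_of_hasCompactSupport c2
  have hsplit : ∀ f : EuclideanSpace ℝ (Fin d) → ℝ, Integrable f volume →
      ∫ x in Metric.closedBall 0 R, f x = ∑ k ∈ F, ∫ x in Q k, f x := by
    intro f hf
    rw [← hF]
    exact integral_biUnion_finset F (fun k _ => hQm k) (fun k _ l _ hkl => hdis hkl)
      fun k _ => hf.integrableOn
  have hball : MeasurableSet (Metric.closedBall (0 : EuclideanSpace ℝ (Fin d)) R) :=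
    Metric.isClosed_closedBall.measurableSet
  rw [← setIntegral_vol_eq hball (fun x hx => by simp [hz x hx]), hsplit _ i1]
  have hfin : ∀ k ∈ F, volume (Q k) ≠ ⊤ := fun k hk => by
    have hsub : Q k ⊆ Metric.closedBall 0 R := hF ▸ Set.subset_biUnion_of_mem (u := Q) hk
    exact ((measure_mono hsub).trans_lt measure_closedBall_lt_top).ne
  refine (Finset.sum_le_sum fun k hk => poincare_convex volume (hQm k) (hQc k) (hfin k hk)
    (hQd k) hu.contDiff hu.hasCompactSupport).trans ?_
  rw [Finset.sum_add_distrib, ← Finset.mul_sum, ← hsplit _ i2, finrank_euclideanSpace_fin,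
    setIntegral_vol_eq (S := S) hball (fun x hx => by simp [hzd x hx])]
  have hav : ∀ k, ∫ x in Q k, u x = ∫ x in Q k, u x ∂S.vol := fun k =>
    setIntegral_vol_eq (hQm k) hz
  simp only [hav]
  have j1 : Integrable (fun x => 2 * S.energyDensity u x) S.vol :=
    hu.integrable_energyDensity.const_mul 2
  have j2 : Integrable (fun x => 2 * C ^ 2 * ‖u x‖ ^ 2) S.vol := i1.restrict.const_mul _
  have key : ∫ x in Metric.closedBall 0 R, ‖fderiv ℝ u x‖ ^ 2 ∂S.vol ≤
      2 * ∫ x, S.energyDensity u x ∂S.vol + 2 * C ^ 2 * ∫ x, ‖u x‖ ^ 2 ∂S.vol := by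
    rw [← integral_const_mul, ← integral_const_mul, ← integral_add j1 j2]
    have h0 : ∀ x, 0 ≤ 2 * S.energyDensity u x + 2 * C ^ 2 * ‖u x‖ ^ 2 := fun x => by
      have := energyDensity_nonneg (S := S) (u := u) x
      positivity
    refine le_trans (setIntegral_mono_on i2.restrict.integrableOn (j1.add j2).integrableOn hball
      fun x hx => ?_) (setIntegral_le_integral (j1.add j2) (ae_of_all _ h0))
    by_cases hxΩ : x ∈ S.Ω
    · refine (norm_fderiv_sq_le x).trans ((sum_norm_partialD_sq_le (S := S) x).trans ?_)
      have := hC x hxΩ (by simpa using hx)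
      simp only [Pi.add_apply]
      gcongr
    · rw [hzd x hxΩ]
      simpa using h0 x
  gcongr

/-- The Ehrling inequality on test functions. -/
lemma exists_functionals (hV : S.Confining) {η : ℝ} (hη : 0 < η) :
    ∃ (ι : Type) (_ : Fintype ι) (L : S.L2 →L[ℂ] EuclideanSpace ℂ ι), ∀ φ : 𝓓(S.Ω, ℂ),
      ‖S.formEmbedding (S.testForm φ)‖ ≤
        η * ‖S.graphMap (S.testForm φ)‖ + ‖L (S.formEmbedding (S.testForm φ))‖ := by
  -- Beyond radius R, 1 ≤ η²|V|, so the mass there is at most η² times the weighted norm.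
  obtain ⟨R, hR⟩ : ∃ R : ℝ, ∀ x ∈ S.Ω, R ≤ ‖x‖ → 1 / η ^ 2 ≤ ‖S.V x‖ := by
    have h := hV.eventually_ge_atTop (1 / η ^ 2)
    rw [eventually_inf_principal] at h
    obtain ⟨R, -, hR⟩ := (hasBasis_cobounded_norm (E := EuclideanSpace ℝ (Fin d))).mem_iff.1 h
    exact ⟨R, fun x hx hxR => hR hxR hx⟩
  obtain ⟨C, -, hC⟩ := ContDiffUpToBoundary_bound S.contDiff_A R
  set D : ℝ := 2 ^ d * (2 + 2 * C ^ 2) with hD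
  have hD0 : 0 < D := by positivity
  -- The cell size is chosen so that δ²·2^d·(2 + 2C²) = η², which makes the Poincaré remainder on
  -- the ball match the tail estimate.
  obtain ⟨F, Q, hQm, hQc, hQd, hdis, hF⟩ := exists_convex_partition (d := d) R
    (δ := η / √D) (by positivity)
  have hfin : ∀ k : F, S.vol (Q k) ≠ ⊤ := fun k => by
    have hsub : Q k ⊆ Metric.closedBall 0 R := hF ▸ Set.subset_biUnion_of_mem (u := Q) k.2
    exact ((Measure.restrict_apply_le _ _).trans_lt
      ((measure_mono hsub).trans_lt measure_closedBall_lt_top)).ne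
  -- The finitely many functionals are the cell integrals, normalised as in `poincare_convex` so
  -- that their squares add up to the remainder.
  let ℓ : F → (S.L2 →L[ℂ] ℂ) := fun k =>
    (((√(volume.real (Q k)))⁻¹ : ℝ) : ℂ) •
      innerSL ℂ (indicatorConstLp 2 (hQm k) (hfin k) (1 : ℂ))
  have hℓ : ∀ k f, ℓ k f = ((√(volume.real (Q k)))⁻¹ : ℝ) • ∫ x in Q k, f x ∂S.vol := by
    intro k f
    have h1 : inner ℂ (indicatorConstLp 2 (hQm k) (hfin k) (1 : ℂ)) f =
        ∫ x in Q k, f x ∂S.vol := L2.inner_indicatorConstLp_one (hQm k) (hfin k) f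
    rw [← h1]
    rfl
  let L : S.L2 →L[ℂ] EuclideanSpace ℂ F :=
    (EuclideanSpace.equiv F ℂ).symm.toContinuousLinearMap ∘L ContinuousLinearMap.pi ℓ
  refine ⟨F, inferInstance, L, fun φ => ?_⟩
  have hu := isTestFn_one φ
  have hN : ‖S.formEmbedding (S.testForm φ)‖ ^ 2 = ∫ x, ‖φ x‖ ^ 2 ∂S.vol :=
    norm_toLp_sq (S.memLp_test φ)
  have hG : ‖S.graphMap (S.testForm φ)‖ ^ 2 =
      ∫ x, ‖φ x‖ ^ 2 ∂S.vol + ∫ x, ‖S.V x‖ * ‖φ x‖ ^ 2 ∂S.vol +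
        ∫ x, S.energyDensity φ x ∂S.vol := by
    rw [graphMap_testForm]; exact norm_testGraph_sq hu
  have hL : ‖L (S.formEmbedding (S.testForm φ))‖ ^ 2 =
      ∑ k ∈ F, ‖((√(volume.real (Q k)))⁻¹ : ℝ) • ∫ x in Q k, φ x ∂S.vol‖ ^ 2 := by
    rw [EuclideanSpace.norm_sq_eq, ← Finset.sum_coe_sort F]
    refine Finset.sum_congr rfl fun k _ => ?_
    have e : L (S.formEmbedding (S.testForm φ)) k = ℓ k (S.formEmbedding (S.testForm φ)) := rfl
    rw [e, hℓ]
    congr 3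
    refine integral_congr_ae (ae_restrict_of_ae ?_)
    exact (S.memLp_test φ).coeFn_toLp
  have hb := hu.setIntegral_ball_le hC hQm hQc hQd hdis hF
  rw [← hL] at hb
  have i1 : Integrable (fun x => ‖φ x‖ ^ 2) S.vol := by
    simpa using hu.integrable_mul_sq (continuousOn_const (c := (1 : ℝ)))
  have i3 : Integrable (fun x => ‖S.V x‖ * ‖φ x‖ ^ 2) S.vol :=
    hu.integrable_mul_sq S.continuousOn_V.norm
  have hball : MeasurableSet (Metric.closedBall (0 : EuclideanSpace ℝ (Fin d)) R) :=
    Metric.isClosed_closedBall.measurableSet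
  have htail : ∫ x in (Metric.closedBall 0 R)ᶜ, ‖φ x‖ ^ 2 ∂S.vol ≤
      η ^ 2 * ∫ x, ‖S.V x‖ * ‖φ x‖ ^ 2 ∂S.vol := by
    rw [← integral_const_mul]
    have h0 : ∀ x, 0 ≤ η ^ 2 * (‖S.V x‖ * ‖φ x‖ ^ 2) := fun x => by positivity
    refine le_trans ?_ (setIntegral_le_integral (s := (Metric.closedBall 0 R)ᶜ)
      (i3.const_mul _) (ae_of_all _ h0))
    refine setIntegral_mono_on i1.integrableOn (i3.const_mul _).integrableOn hball.compl
      fun x hx => ?_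
    by_cases hxΩ : x ∈ S.Ω
    · have h1 := hR x hxΩ (by
        rw [Set.mem_compl_iff, mem_closedBall_zero_iff, not_le] at hx
        exact hx.le)
      rw [div_le_iff₀ (by positivity)] at h1
      have := mul_le_mul_of_nonneg_right h1 (sq_nonneg ‖φ x‖)
      linarith
    · have h1 : φ x = 0 := image_eq_zero_of_notMem_tsupport fun h => hxΩ (hu.tsupport_subset h)
      simp [h1]
  have hsum := integral_add_compl hball i1
  have hδ : (η / √D) ^ 2 * 2 ^ d * (2 + 2 * C ^ 2) = η ^ 2 := by
    rw [div_pow, Real.sq_sqrt hD0.le, mul_assoc, ← hD]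
    field_simp
  have hE0 : 0 ≤ ∫ x, S.energyDensity φ x ∂S.vol := integral_nonneg energyDensity_nonneg
  have hN0 : 0 ≤ ∫ x, ‖φ x‖ ^ 2 ∂S.vol := integral_nonneg fun _ => sq_nonneg _
  have hc : 0 ≤ (η / √D) ^ 2 * 2 ^ d := by positivity
  have hfinal : ‖S.formEmbedding (S.testForm φ)‖ ^ 2 ≤
      η ^ 2 * ‖S.graphMap (S.testForm φ)‖ ^ 2 +
        ‖L (S.formEmbedding (S.testForm φ))‖ ^ 2 := by
    rw [hN, hG, ← hδ]
    rw [← hδ] at htail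
    set c := (η / √D) ^ 2 * 2 ^ d
    nlinarith [mul_nonneg hc hE0, mul_nonneg hc hN0,
      mul_nonneg (mul_nonneg hc hE0) (sq_nonneg C), mul_nonneg (mul_nonneg hc hN0) (sq_nonneg C)]
  refine abs_le_of_sq_le_sq' (hfinal.trans ?_) (by positivity) |>.2
  have h1 : 0 ≤ η * ‖S.graphMap (S.testForm φ)‖ * ‖L (S.formEmbedding (S.testForm φ))‖ := by
    positivity
  nlinarith

end ElectromagneticSystem

namespace ElectromagneticSystem

variable {d : ℕ} {S : ElectromagneticSystem d}
variable {u w : EuclideanSpace ℝ (Fin d) → ℂ}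

/-! ### The variational space as a Hilbert space -/

lemma norm_graphComp_le (u : S.formDomain) (o : Option (Option (Fin d))) :
    ‖S.graphComp o u‖ ≤ ‖S.graphMap u‖ :=
  PiLp.norm_apply_le (S.graphMap u) o

/-- Splitting |V| as |V|^{1/2}·|V|^{1/2} and applying Cauchy–Schwarz bounds the potential term
without any bound on V. -/
lemma norm_integral_form_le (u v : S.formDomain) :
    ‖∫ x, S.V x * ((u : S.H1A) : S.L2) x * (starRingEnd ℂ) (((v : S.H1A) : S.L2) x) ∂S.vol‖ ≤
      ‖S.weighted u‖ * ‖S.weighted v‖ := by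
  have hu := Lp.memLp (S.weighted u)
  have hv := Lp.memLp (S.weighted v)
  have h := integral_mul_norm_le_Lp_mul_Lq (μ := S.vol) Real.HolderConjugate.two_two
    (f := S.weighted u) (g := S.weighted v) (by simpa using hu) (by simpa using hv)
  simp only [Real.rpow_two, ← norm_sq_L2, ← Real.sqrt_eq_rpow,
    Real.sqrt_sq (norm_nonneg _)] at h
  refine (norm_integral_le_integral_norm _).trans (le_trans (le_of_eq ?_) h)
  refine integral_congr_ae ?_
  filter_upwards [S.coeFn_weighted u, S.coeFn_weighted v] with x h1 h2
  rw [h1, h2]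
  simp only [norm_mul, RCLike.norm_conj, Complex.norm_real,
    Real.norm_of_nonneg (Real.sqrt_nonneg _)]
  nth_rw 1 [← Real.mul_self_sqrt (norm_nonneg (S.V x))]
  ring

lemma norm_form_le (u v : S.formDomain) :
    ‖S.form u v‖ ≤ (d + 1) * ‖S.graphMap u‖ * ‖S.graphMap v‖ := by
  have h1 : ∀ j, ‖(inner ℂ (S.magDeriv j v) (S.magDeriv j u) : ℂ)‖ ≤
      ‖S.graphMap u‖ * ‖S.graphMap v‖ := fun j => by
    refine (norm_inner_le_norm _ _).trans ?_
    rw [mul_comm]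
    exact mul_le_mul (norm_graphComp_le u (some (some j))) (norm_graphComp_le v (some (some j)))
      (norm_nonneg _) (norm_nonneg _)
  have h2 := (norm_integral_form_le u v).trans
    (mul_le_mul (norm_graphComp_le u (some none)) (norm_graphComp_le v (some none))
      (norm_nonneg _) (norm_nonneg _))
  have h3 := (norm_sum_le Finset.univ fun j =>
    (inner ℂ (S.magDeriv j v) (S.magDeriv j u) : ℂ)).trans (Finset.sum_le_sum fun j _ => h1 j)
  rw [Finset.sum_const, Finset.card_univ, Fintype.card_fin, nsmul_eq_mul] at h3
  refine (norm_add_le _ _).trans ((add_le_add h3 h2).trans (le_of_eq ?_))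
  ring

variable (S) in
/-- The variational space, with its form norm. -/
abbrev formSpace : Submodule ℂ S.GraphSpace := LinearMap.range S.graphMap

instance : CompleteSpace S.formSpace := by
  have h : IsClosed (S.formSpace : Set S.GraphSpace) := by
    rw [range_graphMap_eq_closure]; exact isClosed_closure
  exact h.completeSpace_coe

variable (S) in
/-- The identification of the variational space with a closed subspace of `GraphSpace`. -/
def formEquiv : S.formDomain ≃ₗ[ℂ] S.formSpace := LinearEquiv.ofInjective _ S.graphMap_injective

lemma norm_formEquiv (u : S.formDomain) : ‖S.formEquiv u‖ = ‖S.graphMap u‖ := rfl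

variable (S) in
/-- The embedding of the variational space into `L²(Ω)`. -/
def embedding : S.formSpace →L[ℂ] S.L2 := PiLp.proj 2 _ none ∘L S.formSpace.subtypeL

lemma embedding_formEquiv (u : S.formDomain) : S.embedding (S.formEquiv u) = S.formEmbedding u :=
  rfl

/-- The form is represented by a bounded operator on the variational space. -/
lemma exists_formOperator : ∃ a : S.formSpace →L[ℂ] S.formSpace, ∀ u v : S.formDomain,
    inner ℂ (S.formEquiv v) (a (S.formEquiv u)) = S.form u v := by
  let b : S.formSpace →ₗ⋆[ℂ] S.formSpace →ₗ[ℂ] ℂ := LinearMap.mk₂'ₛₗ _ _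
    (fun v u => S.form (S.formEquiv.symm u) (S.formEquiv.symm v))
    (fun _ _ _ => by rw [map_add, form_add_right])
    (fun _ _ _ => by rw [map_smul, form_smul_right]; rfl)
    (fun _ _ _ => by rw [map_add, form_add_left])
    (fun _ _ _ => by rw [map_smul, form_smul_left]; rfl)
  let B : S.formSpace →L⋆[ℂ] S.formSpace →L[ℂ] ℂ := b.mkContinuous₂ (d + 1) fun v u => by
    obtain ⟨v, rfl⟩ := S.formEquiv.surjective v
    obtain ⟨u, rfl⟩ := S.formEquiv.surjective u
    simp only [b, LinearMap.mk₂'ₛₗ_apply, LinearEquiv.symm_apply_apply, norm_formEquiv]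
    rw [mul_assoc, mul_comm ‖S.graphMap v‖, ← mul_assoc]
    exact norm_form_le u v
  -- The Riesz operator of `B` acts on v, the antilinear argument; its adjoint acts on u.
  refine ⟨ContinuousLinearMap.adjoint (InnerProductSpace.continuousLinearMapOfBilin B),
    fun u v => ?_⟩
  rw [ContinuousLinearMap.adjoint_inner_right,
    InnerProductSpace.continuousLinearMapOfBilin_apply]
  change S.form (S.formEquiv.symm _) (S.formEquiv.symm _) = _
  rw [LinearEquiv.symm_apply_apply, LinearEquiv.symm_apply_apply]

lemma inner_toLp {f g : EuclideanSpace ℝ (Fin d) → ℂ} (hf : MemLp f 2 S.vol)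
    (hg : MemLp g 2 S.vol) :
    (inner ℂ (hg.toLp : S.L2) (hf.toLp : S.L2) : ℂ) =
      ∫ x, f x * (starRingEnd ℂ) (g x) ∂S.vol := by
  rw [L2.inner_def]
  refine integral_congr_ae ?_
  filter_upwards [hf.coeFn_toLp, hg.coeFn_toLp] with x h1 h2
  rw [h1, h2, RCLike.inner_apply]

/-- The form on compactly supported `C¹` functions. -/
lemma form_eq_integral_formDensity {U W : S.formDomain} (hu : S.IsTestFn 1 u)
    (hw : S.IsTestFn 1 w) (hU : S.graphMap U = testGraph hu) (hW : S.graphMap W = testGraph hw) :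
    S.form U W = ∫ x, S.formDensity u w x ∂S.vol := by
  have hc : Continuous (starRingEnd ℂ) := Complex.continuous_conj
  have compU : ∀ o, S.graphComp o U = (hu.memLp_testComp o).toLp := fun o => by
    rw [← graphMap_apply, hU, testGraph_apply]
  have compW : ∀ o, S.graphComp o W = (hw.memLp_testComp o).toLp := fun o => by
    rw [← graphMap_apply, hW, testGraph_apply]
  have hj : ∀ j, (inner ℂ (S.magDeriv j W) (S.magDeriv j U) : ℂ) =
      ∫ x, S.magD j u x * (starRingEnd ℂ) (S.magD j w x) ∂S.vol := fun j => by
    have e1 : S.magDeriv j U = _ := compU (some (some j))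
    have e2 : S.magDeriv j W = _ := compW (some (some j))
    rw [e1, e2, inner_toLp]
    rfl
  have hVUW : ∫ x, S.V x * ((U : S.H1A) : S.L2) x * (starRingEnd ℂ) (((W : S.H1A) : S.L2) x)
      ∂S.vol = ∫ x, S.V x * u x * (starRingEnd ℂ) (w x) ∂S.vol := by
    have e1 : ((U : S.H1A) : S.L2) = _ := compU none
    have e2 : ((W : S.H1A) : S.L2) = _ := compW none
    refine integral_congr_ae ?_
    filter_upwards [(hu.memLp_testComp none).coeFn_toLp, (hw.memLp_testComp none).coeFn_toLp]
      with x h1 h2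
    rw [e1, e2, h1, h2]
    rfl
  have ij : ∀ j ∈ Finset.univ, Integrable
      (fun x => S.magD j u x * (starRingEnd ℂ) (S.magD j w x)) S.vol := fun j _ =>
    hu.integrable ((hu.continuousOn_magD j).mul (hc.comp_continuousOn (hw.continuousOn_magD j)))
      fun x hx => by simp [magD_eq_zero_of_notMem_tsupport hx]
  have iV : Integrable (fun x => S.V x * u x * (starRingEnd ℂ) (w x)) S.vol :=
    hu.integrable ((S.continuousOn_V.mul hu.continuous.continuousOn).mul
      (hc.comp hw.continuous).continuousOn) fun x hx => by
        simp [image_eq_zero_of_notMem_tsupport hx]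
  rw [form, hVUW, Finset.sum_congr rfl fun j _ => hj j, ← integral_finsetSum _ ij,
    ← integral_add (integrable_finsetSum _ ij) iV]
  rfl

/-! ### Multiplication by `Φ` -/

variable (S) in
/-- Test functions, as elements of the variational space. -/
def testSpace : 𝓓(S.Ω, ℂ) →ₗ[ℂ] S.formSpace := S.formEquiv.toLinearMap ∘ₗ S.testForm

lemma testSpace_apply (φ : 𝓓(S.Ω, ℂ)) : S.testSpace φ = S.formEquiv (S.testForm φ) := rfl

lemma norm_testSpace_sq (φ : 𝓓(S.Ω, ℂ)) : ‖S.testSpace φ‖ ^ 2 = ∫ x, ‖φ x‖ ^ 2 ∂S.vol +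
    ∫ x, ‖S.V x‖ * ‖φ x‖ ^ 2 ∂S.vol + ∫ x, S.energyDensity φ x ∂S.vol := by
  rw [testSpace_apply, norm_formEquiv, graphMap_testForm]
  exact norm_testGraph_sq (isTestFn_one φ)

lemma denseRange_testSpace : DenseRange S.testSpace := by
  rw [DenseRange, Topology.IsInducing.subtypeVal.dense_iff]
  intro x
  rw [← Set.range_comp]
  exact range_graphMap_eq_closure.subset x.2

lemma isTestFn_Phi_mul (φ : 𝓓(S.Ω, ℂ)) : S.IsTestFn 1 fun y => (S.Phi y : ℂ) * φ y :=
  (isTestFn_one φ).mul S.contDiffOn_Phi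

variable (S) in
/-- Multiplication by `Φ`, on test functions. -/
def testMulPhi : 𝓓(S.Ω, ℂ) →ₗ[ℂ] S.formSpace where
  toFun φ := ⟨testGraph (isTestFn_Phi_mul φ), by
    have h := (isTestFn_Phi_mul φ).testGraph_mem_closure
    rwa [← range_graphMap_eq_closure] at h⟩
  map_add' φ ψ := by
    refine Subtype.ext ?_
    have h := testGraph_linear 1 (isTestFn_Phi_mul φ) (isTestFn_Phi_mul ψ)
    rw [one_smul] at h
    have e : (fun y => (S.Phi y : ℂ) * (φ + ψ) y) =
        fun y => 1 * ((S.Phi y : ℂ) * φ y) + (S.Phi y : ℂ) * ψ y := funext fun y => by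
      change (S.Phi y : ℂ) * (φ y + ψ y) = _
      ring
    exact (testGraph_congr (isTestFn_Phi_mul (φ + ψ)) _ e).trans h
  map_smul' c φ := by
    refine Subtype.ext ?_
    -- The linearity lemma concerns combinations cu + w, so a multiple cf is written as (c - 1)f +
    -- f.
    have h := testGraph_linear (c - 1) (isTestFn_Phi_mul φ) (isTestFn_Phi_mul φ)
    have e : (c - 1) • testGraph (isTestFn_Phi_mul φ) + testGraph (isTestFn_Phi_mul φ) =
        c • testGraph (isTestFn_Phi_mul φ) := by rw [sub_smul, one_smul, sub_add_cancel]
    have e' : (fun y => (S.Phi y : ℂ) * (c • φ) y) =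
        fun y => (c - 1) * ((S.Phi y : ℂ) * φ y) + (S.Phi y : ℂ) * φ y := funext fun y => by
      change (S.Phi y : ℂ) * (c * φ y) = _
      ring
    exact (testGraph_congr (isTestFn_Phi_mul (c • φ)) _ e').trans (h.trans e)

/-- Follows from the product rule, |Φ| ≤ 1 and (a + b)² ≤ 2a² + 2b². -/
lemma energyDensity_Phi_mul_le (hu : S.IsTestFn 1 u) (x : EuclideanSpace ℝ (Fin d)) :
    S.energyDensity (fun y => (S.Phi y : ℂ) * u y) x ≤
      2 * S.energyDensity u x + 2 * (S.normSqGradPhi x * ‖u x‖ ^ 2) := by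
  rw [energyDensity, energyDensity, normSqGradPhi, Finset.sum_mul, Finset.mul_sum, Finset.mul_sum,
    ← Finset.sum_add_distrib]
  refine Finset.sum_le_sum fun j _ => ?_
  rw [hu.magD_mul S.contDiffOn_Phi]
  have h1 := norm_sub_le ((S.Phi x : ℂ) * S.magD j u x)
    (Complex.I * ((partialD j S.Phi x : ℝ) * u x))
  simp only [norm_mul, Complex.norm_I, one_mul, Complex.norm_real, Real.norm_eq_abs] at h1
  have h2 : |S.Phi x| * ‖S.magD j u x‖ ≤ ‖S.magD j u x‖ :=
    mul_le_of_le_one_left (norm_nonneg _) (S.abs_Phi_le x)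
  have h3 := pow_le_pow_left₀ (norm_nonneg _) (h1.trans (add_le_add_left h2 _)) 2
  refine h3.trans ?_
  rw [← sq_abs (partialD j S.Phi x)]
  nlinarith [sq_nonneg (‖S.magD j u x‖ - |partialD j S.Phi x| * ‖u x‖)]

lemma norm_testMulPhi_le {γ₁ γ₂ : ℝ} (hd : 1 ≤ d) (hγ : 0 ≤ γ₁) (h : S.MainBound γ₁ γ₂) :
    ∃ C, ∀ φ : 𝓓(S.Ω, ℂ), ‖S.testMulPhi φ‖ ≤ C * ‖S.testSpace φ‖ := by
  -- The energy of Φφ is at most 4E + 4W + 2|γ₂|N, where E, W and N denote the energy, weighted and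
  -- L² terms of φ. Adding the other two components, at most W and N, gives coefficients no larger
  -- than 5 + 2|γ₂|. As this constant is at least 1, it also bounds its own square root.
  refine ⟨5 + 2 * |γ₂|, fun φ => ?_⟩
  have hu := isTestFn_one φ
  have hw := isTestFn_Phi_mul φ
  have hN : ∀ x, ‖(S.Phi x : ℂ) * φ x‖ ^ 2 ≤ ‖φ x‖ ^ 2 := fun x => by
    rw [norm_mul, Complex.norm_real, Real.norm_eq_abs]
    exact pow_le_pow_left₀ (by positivity)
      (mul_le_of_le_one_left (norm_nonneg _) (S.abs_Phi_le x)) 2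
  have i1 : Integrable (fun x => ‖φ x‖ ^ 2) S.vol := by
    simpa using hu.integrable_mul_sq (continuousOn_const (c := (1 : ℝ)))
  have i1' : Integrable (fun x => ‖(S.Phi x : ℂ) * φ x‖ ^ 2) S.vol := by
    simpa only [one_mul] using hw.integrable_mul_sq (continuousOn_const (c := (1 : ℝ)))
  have i2 : Integrable (fun x => ‖S.V x‖ * ‖φ x‖ ^ 2) S.vol :=
    hu.integrable_mul_sq S.continuousOn_V.norm
  have i2' := hw.integrable_mul_sq S.continuousOn_V.norm
  have i3 := hu.integrable_energyDensity
  have i4 := hu.integrable_mul_sq S.continuousOn_normSqGradPhi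
  have e1 := integral_mono i1' i1 hN
  have e2 := integral_mono i2' i2 fun x => mul_le_mul_of_nonneg_left (hN x) (norm_nonneg _)
  have e3 := integral_mono hw.integrable_energyDensity ((i3.const_mul 2).add (i4.const_mul 2))
    (energyDensity_Phi_mul_le hu)
  have e4 := integral_add (i3.const_mul 2) (i4.const_mul 2)
  simp only [Pi.add_apply] at e3
  rw [e4, integral_const_mul, integral_const_mul] at e3
  have e5 := IsTestFn.integral_normSqGradPhi_le hd hγ h
    ((S.isTestFn_coe φ).of_le (k := 2) le_top)
  have n1 : ‖S.testMulPhi φ‖ ^ 2 = _ := norm_testGraph_sq hw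
  have p1 : 0 ≤ ∫ x, ‖φ x‖ ^ 2 ∂S.vol := integral_nonneg fun _ => sq_nonneg _
  have p2 : 0 ≤ ∫ x, ‖S.V x‖ * ‖φ x‖ ^ 2 ∂S.vol := integral_nonneg fun _ => by positivity
  have p3 : 0 ≤ ∫ x, S.energyDensity φ x ∂S.vol := integral_nonneg energyDensity_nonneg
  have hg := abs_nonneg γ₂
  have key : ‖S.testMulPhi φ‖ ^ 2 ≤ (5 + 2 * |γ₂|) * ‖S.testSpace φ‖ ^ 2 := by
    rw [n1, norm_testSpace_sq]
    nlinarith [mul_nonneg hg p2, mul_nonneg hg p3]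
  refine abs_le_of_sq_le_sq' (key.trans ?_) (by positivity) |>.2
  rw [mul_pow]
  exact mul_le_mul_of_nonneg_right (by nlinarith) (sq_nonneg _)

/-! ### Compactness of the resolvent -/

lemma isCompactOperator_embedding (hV : S.Confining) : IsCompactOperator S.embedding := by
  refine isCompactOperator_of_norm_le S.embedding fun ε hε => ?_
  obtain ⟨ι, _, L, hL⟩ := exists_functionals hV hε
  refine ⟨ι, inferInstance, L ∘L S.embedding, fun x => ?_⟩
  refine denseRange_testSpace.induction_on x (isClosed_le (by fun_prop) (by fun_prop)) fun φ => ?_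
  exact hL φ

/-- Under the main hypothesis, the form is coercive in the generalised sense. -/
theorem hasCompactResolvent_operator {γ₁ γ₂ : ℝ} (hd : 1 ≤ d) (hγ : 0 < γ₁)
    (h : S.MainBound γ₁ γ₂) (hV : S.Confining) : HasCompactResolvent S.operator := by
  obtain ⟨a, ha⟩ := exists_formOperator (S := S)
  have hbound := norm_testMulPhi_le hd hγ.le h
  -- The multiplier is extended from test functions by density, so its action on a general element
  -- is never described; the required inequalities also pass to the closure.
  let M : S.formSpace →L[ℂ] S.formSpace := S.testMulPhi.extendOfNorm S.testSpace
  have hM : ∀ φ, M (S.testSpace φ) = S.testMulPhi φ :=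
    LinearMap.extendOfNorm_eq denseRange_testSpace hbound
  have hN : ∀ φ : 𝓓(S.Ω, ℂ), ‖S.embedding (S.testSpace φ)‖ ^ 2 = ∫ x, ‖φ x‖ ^ 2 ∂S.vol :=
    fun φ => norm_toLp_sq (S.memLp_test φ)
  have hform : ∀ φ, ∃ u : S.formDomain, S.formEquiv u = S.testMulPhi φ ∧
      S.graphMap u = testGraph (isTestFn_Phi_mul φ) := fun φ => by
    obtain ⟨u, hu⟩ := S.formEquiv.surjective (S.testMulPhi φ)
    exact ⟨u, hu, congrArg Subtype.val hu⟩
  have hφφ : ∀ φ, inner ℂ (S.testSpace φ) (a (S.testSpace φ)) =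
      ∫ x, S.formDensity φ φ x ∂S.vol := fun φ => by
    rw [testSpace_apply, ha]
    exact form_eq_integral_formDensity _ _ (graphMap_testForm φ) (graphMap_testForm φ)
  -- The energy and weighted terms have coefficients 1/2 and γ₁. The shift γ₂ + α cancels -γ₂ and
  -- supplies the missing L² part of the form norm.
  set α := min (1 / 2) γ₁ with hα
  have hα0 : 0 < α := lt_min (by norm_num) hγ
  have hcoer : ∀ (φ : 𝓓(S.Ω, ℂ)) (t : ℝ), 1 / 2 * ∫ x, S.energyDensity φ x ∂S.vol +
      γ₁ * ∫ x, ‖S.V x‖ * ‖φ x‖ ^ 2 ∂S.vol - γ₂ * ∫ x, ‖φ x‖ ^ 2 ∂S.vol ≤ t →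
      α * ‖S.testSpace φ‖ ^ 2 ≤ t + (γ₂ + α) * ‖S.embedding (S.testSpace φ)‖ ^ 2 := by
    intro φ t ht
    have p2 : 0 ≤ ∫ x, ‖S.V x‖ * ‖φ x‖ ^ 2 ∂S.vol := integral_nonneg fun _ => by positivity
    have p3 : 0 ≤ ∫ x, S.energyDensity φ x ∂S.vol := integral_nonneg energyDensity_nonneg
    have a1 := mul_le_mul_of_nonneg_right (min_le_left (1 / 2) γ₁) p3
    have a2 := mul_le_mul_of_nonneg_right (min_le_right (1 / 2) γ₁) p2
    rw [norm_testSpace_sq, hN]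
    rw [← hα] at a1 a2
    linarith
  refine hasCompactResolvent_of_form S.operator S.embedding a M α (γ₂ + α) hα0
    (fun u w => ?_) (isCompactOperator_embedding hV) (fun x => ?_) (fun x => ?_) fun x => ?_
  · rw [mem_operator_graph_iff]
    constructor
    · rintro ⟨U, hU, hw⟩
      refine ⟨S.formEquiv U, hU, fun v => ?_⟩
      obtain ⟨v, rfl⟩ := S.formEquiv.surjective v
      rw [ha, hw, embedding_formEquiv]
    · rintro ⟨x, hx, hw⟩
      obtain ⟨U, rfl⟩ := S.formEquiv.surjective x
      refine ⟨U, hx, fun v => ?_⟩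
      rw [← ha, hw, embedding_formEquiv]
  · refine denseRange_testSpace.induction_on x (isClosed_le (by fun_prop) ?_) fun φ => ?_
    · exact ((Complex.continuous_re.comp (continuous_id.inner a.continuous)).add
        (Complex.continuous_im.comp (M.continuous.inner a.continuous))).add (by fun_prop)
    · obtain ⟨U, hU, hU'⟩ := hform φ
      refine hcoer φ _ ?_
      rw [hφφ, hM, ← hU, testSpace_apply, ha,
        form_eq_integral_formDensity (isTestFn_one φ) _ (graphMap_testForm φ) hU']
      exact IsTestFn.coercive_left hd h ((S.isTestFn_coe φ).of_le (k := 2) le_top)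
  · refine denseRange_testSpace.induction_on x (isClosed_le (by fun_prop) ?_) fun φ => ?_
    · exact ((Complex.continuous_re.comp (continuous_id.inner a.continuous)).add
        (Complex.continuous_im.comp (continuous_id.inner (a ∘L M).continuous))).add (by fun_prop)
    · obtain ⟨U, hU, hU'⟩ := hform φ
      refine hcoer φ _ ?_
      rw [hφφ, hM, ← hU, testSpace_apply, ha,
        form_eq_integral_formDensity _ (isTestFn_one φ) hU' (graphMap_testForm φ)]
      exact IsTestFn.coercive_right hd h ((S.isTestFn_coe φ).of_le (k := 2) le_top)
  · refine denseRange_testSpace.induction_on x (isClosed_eq ?_ continuous_const) fun φ => ?_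
    · exact Complex.continuous_im.comp
        (S.embedding.continuous.inner (S.embedding ∘L M).continuous)
    · rw [hM]
      have e1 : S.embedding (S.testSpace φ) = (S.memLp_test φ).toLp := rfl
      have e2 : S.embedding (S.testMulPhi φ) =
        ((isTestFn_Phi_mul φ).memLp_testComp none).toLp := rfl
      rw [e1, e2, inner_toLp]
      -- As Φ is real, ⟨φ,Φφ⟩ is real, which is the compatibility of the multiplier with the shift.
      have e3 : ∀ x, S.testComp (fun y => (S.Phi y : ℂ) * φ y) none x * (starRingEnd ℂ) (φ x) =
          ((S.Phi x * ‖φ x‖ ^ 2 : ℝ) : ℂ) := fun x => by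
        change (S.Phi x : ℂ) * φ x * _ = _
        rw [mul_assoc, Complex.mul_conj']
        norm_cast
      simp only [e3]
      rw [integral_complex_ofReal, Complex.ofReal_im]

end ElectromagneticSystem

end

theorem mainTheorem5 (d : ℕ) (hd : 1 ≤ d) (S : ElectromagneticSystem d)
    (hS : S.MainAssumption) (hV : S.Confining) :
    HasCompactResolvent S.operator := by
  obtain ⟨γ₁, γ₂, hγ, h⟩ := hS
  exact ElectromagneticSystem.hasCompactResolvent_operator hd hγ h hV
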